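/- Let $d\in\{1,2,3\}$, $\gamma\in(1,2]$, $T>0$, and let $\Omega\subset\mathbb R^d$ be a bounded domain which can be covered by rectangular meshes: a mesh $\mathcal T_h$ of $\Omega$ is a finite set of closed non-degenerate boxes with sides parallel to the axes and pairwise disjoint interiors, such that $\Omega$ is the interior of their union, and any two cells that overlap in a boundary piece of positive $(d-1)$-dimensional measure share a whole face; $h$ is the largest diameter of a cell. For $U=(\varrho,m,E)$ with $\varrho>0$ put $u=m/\varrho$, $e=E/\varrho-\frac12|u|^2$, $p=(\gamma-1)\varrho e$, $F(U)=(m,\,u\otimes m+p\mathbb I,\,u(E+p))$, $\eta(U)=\frac{1}{\gamma-1}\varrho\ln(p/\varrho^\gamma)$ and $q(U)=\eta u$. In the variables $(\varrho,\eta)$ this reads $p(\varrho,\eta)=\varrho^\gamma e^{(\gamma-1)\eta/\varrho}$; let $\vartheta=p/\varrho$. *Strong solution.* Let $\tilde\varrho,\tilde u,\tilde\eta\in W^{1,\infty}((0,T)\times\Omega)\cap C^0([0,T]\times\overline\Omega)$ with $\tilde\varrho>0$ and $\vartheta(\tilde\varrho,\tilde\eta)>0$ on $[0,T]\times\overline\Omega$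 be such that $\tilde U=U(\tilde\varrho,\tilde u,\tilde\eta)$ satisfies the Euler system $\partial_t\tilde U+\operatorname{div}_xF(\tilde U)=0$ almost everywhere in $(0,T)\times\Omega$ and $\tilde u\cdot n=0$ at every point of $\partial\Omega$ at which the outer unit normal $n$ exists. Let $U_0=\tilde U(0,\cdot)$ and $\tilde m=\tilde\varrho\tilde u$. *Godunov method.* Its solution on $\mathcal T_h$ is a function $U_h=(\varrho_h,m_h,E_h)$ on $[0,T]\times\Omega$ that is constant on the interior of each cell, whose cell values are differentiable in $t\in[0,T]$, with $U_h(0)=\Pi_hU_0$ (cell averages) and, for all $t\in[0,T]$ and all scalar functions $\phi$ that are constant on each cell, $$\int_\Omega\phi\,\frac{d}{dt}U_h\,dx-\sum_{\sigma\ \text{interior}}\int_\sigma F(U^{RP}_\sigma)\cdot n\,[\![\phi]\!]\,dS_x+\sum_{\sigma\subset\partial\Omega}\int_\sigma F(U^{RP}_\sigma)\cdot n\,\phi\,dS_x=0 .$$ Here $[\![\phi]\!]$ is the jump of $\phi$ in the direction of $n$, and $n$ is the outer normal on $\partial\Omega$. On an interior face, $U_\sigma^{RP}$ is the value at the interface of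 the exact solution (a piecewise $C^1$ self-similar entropy solution, possibly with vacuum) of the one-dimensional Riemann problem in the direction $n$ whose data are the two adjacent cell values. On a boundary face it is the value at the wall of the exact solution of the Riemann problem with the adjacent cell value as datum and the impermeability condition $u\cdot n=0$ at the wall; thus $F(U_\sigma^{RP})\cdot n=(0,p\,n,0)$ there. *Claim.* Let $\underline\varrho,\overline E,C_0>0$. There is a constant $C>0$, which may depend on $d,\gamma,T,\Omega,(\tilde\varrho,\tilde u,\tilde\eta),\underline\varrho,\overline E,C_0$ but not on the mesh, such that for every mesh $\mathcal T_h$ of $\Omega$ and every solution $U_h$ of the Godunov method on $\mathcal T_h$ with $$\underline\varrho\le\varrho_h,\qquad 0<E_h\le\overline E\quad\text{for all }t\in[0,T],\qquad \|U_h(0)-U_0\|_{L^2(\Omega)}\le C_0h^{1/2},$$ and with $\eta_h=\eta(U_h)$, one has for every $\tau\in(0,T)$ $$\|(\varrho_h-\tilde\varrho)(\tau)\|_{L^2(\Omega)}\le C h^{1/4},\qquad \|(m_h-\tilde m)(\tau)\|_{L^2(\Omega)}\le C h^{1/4},\qquad \|(\eta_h-\tilde\eta)(\tau)\|_{L^2(\Omega)}\le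 C h^{1/4}.$$ -/

import Mathlib

open MeasureTheory Set Filter Topology
open scoped ENNReal NNReal ContDiff

namespace EulerGodunov

noncomputable section

/-! ### The Euler system of a perfect gas -/

/-- Points and vectors of `ℝ^d`, with the Euclidean norm. -/
abbrev Vec (d : ℕ) := EuclideanSpace ℝ (Fin d)

/-- Conserved variables `U = (ϱ, m, E)`: density, momentum, total energy. -/
abbrev State (d : ℕ) := ℝ × Vec d × ℝ

variable {d : ℕ}

def density (U : State d) : ℝ := U.1

def momentum (U : State d) : Vec d := U.2.1

def energy (U : State d) : ℝ := U.2.2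

/-- `u = m / ϱ`. -/
def velocity (U : State d) : Vec d := (density U)⁻¹ • momentum U

/-- Specific internal energy `e = E / ϱ - |u|² / 2`. -/
def internalEnergy (U : State d) : ℝ := energy U / density U - ‖velocity U‖ ^ 2 / 2

/-- State equation of a perfect gas, `p = (γ - 1) ϱ e`. -/
def pressure (γ : ℝ) (U : State d) : ℝ := (γ - 1) * density U * internalEnergy U

/-- The `i`-th column of the flux `F(U) = (m, u ⊗ m + p 𝕀, u (E + p))`. -/
def flux (γ : ℝ) (i : Fin d) (U : State d) : State d :=
  (momentum U i,
    velocity U i • momentum U + pressure γ U • EuclideanSpace.single i (1 : ℝ),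
    velocity U i * (energy U + pressure γ U))

/-- Total entropy `η = C_v ϱ S`, with `C_v = 1 / (γ - 1)` and `S = log (p / ϱ^γ)`. -/
def entropy (γ : ℝ) (U : State d) : ℝ :=
  1 / (γ - 1) * density U * Real.log (pressure γ U / density U ^ γ)

/-- The `i`-th component of the entropy flux `q = η u`. -/
def entropyFlux (γ : ℝ) (i : Fin d) (U : State d) : ℝ := entropy γ U * velocity U i

/-- Non-vacuum states: positive density and pressure. -/
def IsGasState (γ : ℝ) (U : State d) : Prop := 0 < density U ∧ 0 < pressure γ U

/-! Thermodynamics in the independent variables `(ϱ, η)`. -/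

/-- The pressure `p(ϱ, η)`, obtained by solving `η = C_v ϱ log (p / ϱ^γ)` for `p`. -/
def pressureOf (γ ϱ η : ℝ) : ℝ := ϱ ^ γ * Real.exp ((γ - 1) * η / ϱ)

/-- The absolute temperature `ϑ = p / ϱ`. -/
def temperatureOf (γ ϱ η : ℝ) : ℝ := pressureOf γ ϱ η / ϱ

/-- The conserved variables `U(ϱ, u, η)`. -/
def stateOf (γ ϱ : ℝ) (u : Vec d) (η : ℝ) : State d :=
  (ϱ, ϱ • u, ϱ * ‖u‖ ^ 2 / 2 + pressureOf γ ϱ η / (γ - 1))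

/-! ### Weak derivatives and strong solutions -/

/-- `g` is the weak derivative on the open space-time set `D` of `f` in the direction `v`. -/
def HasWeakDeriv {X : Type*} [NormedAddCommGroup X] [NormedSpace ℝ X]
    (D : Set (ℝ × Vec d)) (f g : ℝ × Vec d → X) (v : ℝ × Vec d) : Prop :=
  ∀ φ : ℝ × Vec d → ℝ, ContDiff ℝ ∞ φ → HasCompactSupport φ → tsupport φ ⊆ D →
    ∫ z in D, fderiv ℝ φ z v • f z = - ∫ z in D, φ z • g z

/-- The Sobolev space `W^{1,∞}(D)`. -/
def MemW1inf {X : Type*} [NormedAddCommGroup X] [NormedSpace ℝ X]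
    (D : Set (ℝ × Vec d)) (f : ℝ × Vec d → X) : Prop :=
  MemLp f ∞ (volume.restrict D) ∧
    ∀ v, ∃ g, MemLp g ∞ (volume.restrict D) ∧ HasWeakDeriv D f g v

/-- `n` is the outer unit normal of `Ω` at the boundary point `x`: near `x`, the set `Ω` contains
every open cone around `-n`, and misses every open cone around `n`. -/
def IsOuterNormal (Ω : Set (Vec d)) (x n : Vec d) : Prop :=
  x ∈ frontier Ω ∧ ‖n‖ = 1 ∧ ∀ ε > 0, ∃ r > 0, ∀ y ∈ Metric.ball x r,
    (inner ℝ (y - x) n < -ε * ‖y - x‖ → y ∈ Ω) ∧ (ε * ‖y - x‖ < inner ℝ (y - x) n → y ∉ Ω)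

/-- `(ϱ, u, η)` is a strong solution on `(0,T) × Ω` of the Euler system with impermeable boundary.
Functions in `W^{1,∞}` are taken together with their continuous representative, up to the boundary
of the space-time cylinder. -/
structure IsStrongSolution (γ T : ℝ) (Ω : Set (Vec d))
    (ϱ : ℝ × Vec d → ℝ) (u : ℝ × Vec d → Vec d) (η : ℝ × Vec d → ℝ) : Prop where
  cont_density : ContinuousOn ϱ (Icc 0 T ×ˢ closure Ω)
  cont_velocity : ContinuousOn u (Icc 0 T ×ˢ closure Ω)
  cont_entropy : ContinuousOn η (Icc 0 T ×ˢ closure Ω)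
  mem_density : MemW1inf (Ioo 0 T ×ˢ Ω) ϱ
  mem_velocity : MemW1inf (Ioo 0 T ×ˢ Ω) u
  mem_entropy : MemW1inf (Ioo 0 T ×ˢ Ω) η
  density_pos : ∀ z ∈ Icc 0 T ×ˢ closure Ω, 0 < ϱ z
  temperature_pos : ∀ z ∈ Icc 0 T ×ˢ closure Ω, 0 < temperatureOf γ (ϱ z) (η z)
  /-- `∂_t U + div F(U) = 0` almost everywhere, with weak derivatives in `L^∞`. -/
  equation : ∃ (A : ℝ × Vec d → State d) (B : Fin d → ℝ × Vec d → State d),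
    MemLp A ∞ (volume.restrict (Ioo 0 T ×ˢ Ω)) ∧
    HasWeakDeriv (Ioo 0 T ×ˢ Ω) (fun z => stateOf γ (ϱ z) (u z) (η z)) A (1, 0) ∧
    (∀ i, MemLp (B i) ∞ (volume.restrict (Ioo 0 T ×ˢ Ω)) ∧
      HasWeakDeriv (Ioo 0 T ×ˢ Ω) (fun z => flux γ i (stateOf γ (ϱ z) (u z) (η z))) (B i)
        (0, EuclideanSpace.single i (1 : ℝ))) ∧
    ∀ᵐ z ∂(volume.restrict (Ioo 0 T ×ˢ Ω)), A z + ∑ i, B i z = 0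
  /-- `u · n = 0` on the boundary, wherever the normal exists. -/
  impermeable : ∀ t ∈ Icc 0 T, ∀ x n, IsOuterNormal Ω x n → inner ℝ (u (t, x)) n = 0

/-! ### Local Riemann problems -/

/-- `(t, x) ↦ W (x_i / t)` is a piecewise `C¹` self-similar entropy solution of the Euler system,
for `x_i / t` in the interval `I`. The conservation laws and the entropy inequality are written in
integral form, which comprises the Rankine-Hugoniot and entropy conditions at the jumps. The
vacuum, `W ξ = 0`, is allowed (there, flux, entropy and entropy flux evaluate to zero). -/
structure IsFan (γ : ℝ) (i : Fin d) (I : Set ℝ) (W : ℝ → State d) : Prop where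
  admissible : ∀ ξ ∈ I, IsGasState γ (W ξ) ∨ W ξ = 0
  piecewise : ∃ D : Finset ℝ, ContDiffOn ℝ 1 W (I \ D) ∧
    ∀ s ∈ D, (∃ a, Tendsto W (𝓝[I ∩ Iio s] s) (𝓝 a)) ∧ ∃ b, Tendsto W (𝓝[I ∩ Ioi s] s) (𝓝 b)
  entropy_integrable : ∀ ξ₁ ∈ I, ∀ ξ₂ ∈ I,
    IntervalIntegrable (fun ξ => entropy γ (W ξ)) volume ξ₁ ξ₂
  conservation : ∀ ξ₁ ∈ I, ∀ ξ₂ ∈ I, ξ₁ ≤ ξ₂ →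
    flux γ i (W ξ₂) - flux γ i (W ξ₁) = ξ₂ • W ξ₂ - ξ₁ • W ξ₁ - ∫ ξ in ξ₁..ξ₂, W ξ
  entropy_inequality : ∀ ξ₁ ∈ I, ∀ ξ₂ ∈ I, ξ₁ ≤ ξ₂ →
    ξ₂ * entropy γ (W ξ₂) - ξ₁ * entropy γ (W ξ₁) - (∫ ξ in ξ₁..ξ₂, entropy γ (W ξ))
      ≤ entropyFlux γ i (W ξ₂) - entropyFlux γ i (W ξ₁)

/-- `V` is the value at the interface `{x_i = 0}` of the exact solution of the Riemann problem
with data `U_L` for `x_i < 0` and `U_R` for `x_i > 0`. -/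
def IsRiemannState (γ : ℝ) (i : Fin d) (U_L U_R V : State d) : Prop :=
  ∃ W : ℝ → State d, IsFan γ i univ W ∧ (∀ᶠ ξ in atBot, W ξ = U_L) ∧
    (∀ᶠ ξ in atTop, W ξ = U_R) ∧ W 0 = V

/-- `V` is the value at the wall `{x_i = 0}` of the exact solution of the Riemann problem with data
`U_L` in the gas region `{x_i < 0}` and vanishing normal velocity at the wall. -/
def IsRightWallState (γ : ℝ) (i : Fin d) (U_L V : State d) : Prop :=
  ∃ W : ℝ → State d, IsFan γ i (Iic 0) W ∧ (∀ᶠ ξ in atBot, W ξ = U_L) ∧ W 0 = V ∧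
    momentum V i = 0

/-- The same for a gas region `{x_i > 0}` with data `U_R`. -/
def IsLeftWallState (γ : ℝ) (i : Fin d) (U_R V : State d) : Prop :=
  ∃ W : ℝ → State d, IsFan γ i (Ici 0) W ∧ (∀ᶠ ξ in atTop, W ξ = U_R) ∧ W 0 = V ∧
    momentum V i = 0

/-! ### Rectangular meshes and the Godunov method -/

/-- A mesh cell: a non-degenerate box with sides parallel to the axes. -/
abbrev Cell (d : ℕ) := BoxIntegral.Box (Fin d)

def closedCell (K : Cell d) : Set (Vec d) := {x | ∀ i, x i ∈ Icc (K.lower i) (K.upper i)}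

def openCell (K : Cell d) : Set (Vec d) := {x | ∀ i, x i ∈ Ioo (K.lower i) (K.upper i)}

/-- `|K|`. -/
def cellVolume (K : Cell d) : ℝ := ∏ j, (K.upper j - K.lower j)

/-- The area of the two faces of `K` that are orthogonal to the `i`-th axis. -/
def faceArea (i : Fin d) (K : Cell d) : ℝ := ∏ j ∈ Finset.univ.erase i, (K.upper j - K.lower j)

/-- The upper face of `K` in direction `i` is the lower face of `L` in direction `i`. -/
def Adjacent (i : Fin d) (K L : Cell d) : Prop :=
  K.upper i = L.lower i ∧ ∀ j, j ≠ i → K.lower j = L.lower j ∧ K.upper j = L.upper j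

/-- `𝒯` is a rectangular mesh of `Ω`. Conformity: two cells whose boundaries overlap in a set of
positive area share a whole face. -/
structure IsRectMesh (Ω : Set (Vec d)) (𝒯 : Finset (Cell d)) : Prop where
  domain_eq : Ω = interior (⋃ K ∈ 𝒯, closedCell K)
  disjoint : ∀ K ∈ 𝒯, ∀ L ∈ 𝒯, K ≠ L → Disjoint (openCell K) (openCell L)
  conforming : ∀ K ∈ 𝒯, ∀ L ∈ 𝒯, ∀ i, K.upper i = L.lower i →
    (∀ j, j ≠ i → max (K.lower j) (L.lower j) < min (K.upper j) (L.upper j)) → Adjacent i K L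

/-- The mesh parameter `h`: the largest diameter of a cell. -/
def meshSize (𝒯 : Finset (Cell d)) : ℝ :=
  (𝒯.sup fun K => (⟨Metric.diam (closedCell K), Metric.diam_nonneg⟩ : ℝ≥0) : ℝ≥0)

/-- The piecewise constant function with value `v K` on the interior of each cell `K`. -/
def piecewiseConst {X : Type*} [AddCommMonoid X] (𝒯 : Finset (Cell d)) (v : Cell d → X) :
    Vec d → X :=
  fun x => ∑ K ∈ 𝒯, (openCell K).indicator (fun _ => v K) x

open Classical in
/-- `U K t`, for `K ∈ 𝒯` and `t ∈ [0,T]`, are the cell values of a solution of the semi-discrete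
Godunov method with initial data `Π_h U₀`. The test functions `φ` are piecewise constant. The jump
of `φ` across the interior face between `K` and its upper neighbour `L` is `φ L - φ K`. On the
faces at the boundary of `Ω` the flux is that of the Riemann problem with an impermeable wall. -/
structure IsGodunovSolution (γ T : ℝ) (𝒯 : Finset (Cell d)) (U₀ : Vec d → State d)
    (U : Cell d → ℝ → State d) : Prop where
  initial : ∀ K ∈ 𝒯, U K 0 = ⨍ x in closedCell K, U₀ x
  scheme : ∀ t ∈ Icc 0 T, ∃ (dU : Cell d → State d) (V : Fin d → Cell d → Cell d → State d)
      (Vr Vl : Fin d → Cell d → State d),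
    (∀ K ∈ 𝒯, HasDerivWithinAt (U K) (dU K) (Icc 0 T) t) ∧
    (∀ i, ∀ K ∈ 𝒯, ∀ L ∈ 𝒯, Adjacent i K L → IsRiemannState γ i (U K t) (U L t) (V i K L)) ∧
    (∀ i, ∀ K ∈ 𝒯, (∀ L ∈ 𝒯, ¬ Adjacent i K L) → IsRightWallState γ i (U K t) (Vr i K)) ∧
    (∀ i, ∀ K ∈ 𝒯, (∀ L ∈ 𝒯, ¬ Adjacent i L K) → IsLeftWallState γ i (U K t) (Vl i K)) ∧
    ∀ φ : Cell d → ℝ,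
      (∑ K ∈ 𝒯, (cellVolume K * φ K) • dU K)
        - (∑ i, ∑ K ∈ 𝒯, ∑ L ∈ 𝒯 with Adjacent i K L,
            (faceArea i K * (φ L - φ K)) • flux γ i (V i K L))
        + (∑ i, ∑ K ∈ 𝒯 with ∀ L ∈ 𝒯, ¬ Adjacent i K L,
            (faceArea i K * φ K) • flux γ i (Vr i K))
        - (∑ i, ∑ K ∈ 𝒯 with ∀ L ∈ 𝒯, ¬ Adjacent i L K,
            (faceArea i K * φ K) • flux γ i (Vl i K)) = 0

end

end EulerGodunov

open EulerGodunov

/-! The theorem is a stability estimate in relative entropy. For gas states let H(W|U) = -(η(W) -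
η(U) - η'(U)(W - U)). It is nonnegative, since η is concave in the conserved variables, and on a
compact convex set of gas states it is comparable with |W - U|². Let w be the strong solution and
U_K the cell values, and let Y(t) be the integral over Ω of H(U_K|w). Then Y controls the squared L²
errors of density, momentum and entropy, so the rate h^{1/4} follows from Y ≤ A√h.

In the time derivative of Y, the Euler system for w and the symmetry of η''F' (`fderiv_entVar_time`)
leave the remainder F(U_K) - F(w) - F'(w)(U_K - w), which costs a multiple of H, and face integrals
of η'(w) against F(U_K). If F(U_K) is replaced there by the numerical flux F(V), the face terms
cancel between neighbours and vanish at walls by impermeability. What is left is the difference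
between cell means and face values of η'(w), of order h, times F(U_K) - F(V).

This consistency error is controlled by the entropy produced in the exact Riemann solution
(`exists_faceBound`). On the side of a cell with value U, the fan W joins U to V, and F(U) - F(V) is
the integral of W - U over that half of the fan. The integral D of H(W|U) over the same half is at
most the entropy produced there. Hence |F(U) - F(V)| ≤ C(ε + D/ε + D) for every ε > 0, with no bound
assumed on the intermediate states or on the extent of the fan. The choice ε = √h gives a total
defect of order √h (|Ω| + P), where P is the growth rate of the total discrete entropy. Its time
integral is bounded because the entropy is, and Gronwall's lemma applies
(`IsRegularOn.sum_cellRelEnt_le`).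

The constants are uniform in the mesh because all states lie in one compact convex set
(`IsRegularOn.exists_common_gasBox`). The missing lower bound on the pressure comes from the minimum
entropy principle: gas in a Riemann fan has specific entropy no smaller than the datum it comes
from, so a cell of minimal specific entropy cannot lose any.

Two points of regularity remain. A W^{1,∞} solution is Lipschitz on every closed cell, with one
constant, and satisfies the system pointwise almost everywhere. The cell values are only
differentiable in time, with no integrability of the derivative given; their absolute continuity
follows by comparison with the increasing function G(t) = |Ω| t + total entropy. -/

namespace EulerGodunov

noncomputable section

variable {d : ℕ}

/-! ### Thermodynamics and the relative entropy -/

/-- Specific entropy `s = η / ϱ`. -/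
def specificEntropy (γ : ℝ) (U : State d) : ℝ :=
  1 / (γ - 1) * Real.log (pressure γ U / density U ^ γ)

/-- Temperature `ϑ = p / ϱ`. -/
def temperature (γ : ℝ) (U : State d) : ℝ := pressure γ U / density U

/-- The entropy variables: the derivative of `η` at `U`. -/
def entVar (γ : ℝ) (U : State d) : State d →L[ℝ] ℝ :=
  (specificEntropy γ U - γ / (γ - 1) + ‖velocity U‖ ^ 2 / (2 * temperature γ U)) •
      ContinuousLinearMap.fst ℝ ℝ (Vec d × ℝ)
    - (temperature γ U)⁻¹ • ((innerSL ℝ (velocity U)).comp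
      ((ContinuousLinearMap.fst ℝ (Vec d) ℝ).comp (ContinuousLinearMap.snd ℝ ℝ (Vec d × ℝ))))
    + (temperature γ U)⁻¹ •
      ((ContinuousLinearMap.snd ℝ (Vec d) ℝ).comp (ContinuousLinearMap.snd ℝ ℝ (Vec d × ℝ)))

lemma entVar_apply (γ : ℝ) (U W : State d) :
    entVar γ U W = (specificEntropy γ U - γ / (γ - 1)
        + ‖velocity U‖ ^ 2 / (2 * temperature γ U)) * density W
      - (temperature γ U)⁻¹ * inner ℝ (velocity U) (momentum W)
      + (temperature γ U)⁻¹ * energy W := by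
  simp [entVar, density, momentum, energy]

/-- Relative entropy of `W` with respect to `U`. -/
def relEnt (γ : ℝ) (W U : State d) : ℝ := density U + entVar γ U W - entropy γ W

/-- Relative entropy flux. -/
def relFlux (γ : ℝ) (i : Fin d) (W U : State d) : ℝ :=
  momentum U i + entVar γ U (flux γ i W) - entropyFlux γ i W

lemma entropy_eq_mul (γ : ℝ) (U : State d) : entropy γ U = density U * specificEntropy γ U := by
  unfold entropy specificEntropy; ring

lemma momentum_eq {U : State d} (h : 0 < density U) :
    momentum U = density U • velocity U := by
  unfold velocity; rw [smul_smul, mul_inv_cancel₀ h.ne', one_smul]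

lemma pressure_eq {γ : ℝ} {U : State d} (h : 0 < density U) :
    pressure γ U = density U * temperature γ U := by
  unfold temperature; field_simp

lemma energy_eq {γ : ℝ} (hγ : 1 < γ) {U : State d} (h : 0 < density U) :
    energy U = density U * ‖velocity U‖ ^ 2 / 2 + density U * temperature γ U / (γ - 1) := by
  have : γ - 1 ≠ 0 := by linarith
  unfold temperature pressure internalEnergy
  field_simp
  ring

lemma IsGasState.temperature_pos {γ : ℝ} {U : State d} (h : IsGasState γ U) :
    0 < temperature γ U := div_pos h.2 h.1

lemma specificEntropy_eq {γ : ℝ} (hγ : 1 < γ) {U : State d} (h : IsGasState γ U) :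
    specificEntropy γ U = Real.log (temperature γ U) / (γ - 1) - Real.log (density U) := by
  have : γ - 1 ≠ 0 := by linarith
  have hϱ := h.1
  have hθ := h.temperature_pos
  unfold specificEntropy
  rw [pressure_eq hϱ, Real.log_div (by positivity) (by positivity), Real.log_mul hϱ.ne' hθ.ne',
    Real.log_rpow hϱ]
  field_simp
  ring

/-- η(λU) = λη(U) - λ ln λ ϱ(U), and the right-hand side is the derivative of this at λ = 1. It
explains the term `density U` in `relEnt`. -/
lemma entVar_self {γ : ℝ} (hγ : 1 < γ) {U : State d} (h : IsGasState γ U) :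
    entVar γ U U = entropy γ U - density U := by
  have : γ - 1 ≠ 0 := by linarith
  have hθ := h.temperature_pos
  rw [entVar_apply, entropy_eq_mul, energy_eq hγ h.1, momentum_eq h.1, inner_smul_right,
    real_inner_self_eq_norm_sq]
  field_simp
  ring

lemma relEnt_self {γ : ℝ} (hγ : 1 < γ) {U : State d} (h : IsGasState γ U) :
    relEnt γ U U = 0 := by
  unfold relEnt; rw [entVar_self hγ h]; ring

/-- Splits H into a kinetic, a thermal and a density part. Each is nonnegative by an elementary
inequality for the logarithm, so the Hessian of η is never computed. -/
lemma relEnt_eq {γ : ℝ} (hγ : 1 < γ) {W U : State d} (hW : IsGasState γ W) (hU : IsGasState γ U) :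
    relEnt γ W U = density W * ‖velocity W - velocity U‖ ^ 2 / (2 * temperature γ U)
      + density W / (γ - 1) * (temperature γ W / temperature γ U - 1
          - Real.log (temperature γ W / temperature γ U))
      + density U * (density W / density U * Real.log (density W / density U)
          - density W / density U + 1) := by
  have h1 : γ - 1 ≠ 0 := by linarith
  have hθ := hU.temperature_pos
  have hθ' := hW.temperature_pos
  have hϱ := hU.1
  have hϱ' := hW.1
  unfold relEnt
  rw [entVar_apply, entropy_eq_mul, energy_eq hγ hW.1, momentum_eq hW.1, inner_smul_right,
    specificEntropy_eq hγ hU, specificEntropy_eq hγ hW, norm_sub_sq_real,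
    Real.log_div hθ'.ne' hθ.ne', Real.log_div hϱ'.ne' hϱ.ne', real_inner_comm]
  field_simp
  ring

lemma zero_entropy (γ : ℝ) : entropy γ (0 : State d) = 0 := by
  simp [entropy, density]

lemma zero_entropyFlux (γ : ℝ) (i : Fin d) : entropyFlux γ i (0 : State d) = 0 := by
  simp [entropyFlux, zero_entropy]

lemma relEnt_zero (γ : ℝ) (U : State d) : relEnt γ 0 U = density U := by
  simp [relEnt, zero_entropy]

/-- From ln √x ≤ √x - 1. Being valid for every x > 0, this bound and the next one apply to states W
that are not known to be bounded. -/
lemma sq_sqrt_sub_one_le_sub_log {x : ℝ} (hx : 0 < x) : (√x - 1) ^ 2 ≤ x - 1 - Real.log x := by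
  have h1 := Real.log_le_sub_one_of_pos (Real.sqrt_pos.2 hx)
  rw [Real.log_sqrt hx.le] at h1
  nlinarith [Real.sq_sqrt hx.le]

lemma sq_sqrt_sub_one_le_mul_log {y : ℝ} (hy : 0 < y) :
    (√y - 1) ^ 2 ≤ y * Real.log y - y + 1 := by
  have hs := Real.sqrt_pos.2 hy
  have h1 := Real.one_sub_inv_le_log_of_pos hs
  rw [Real.log_sqrt hy.le] at h1
  have h2 := mul_le_mul_of_nonneg_left h1 hy.le
  have h3 : y * (√y)⁻¹ = √y := by
    rw [← div_eq_mul_inv, Real.div_sqrt]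
  nlinarith [Real.sq_sqrt hy.le]

lemma relEnt_nonneg {γ : ℝ} (hγ : 1 < γ) {W U : State d} (hW : IsGasState γ W ∨ W = 0)
    (hU : IsGasState γ U) : 0 ≤ relEnt γ W U := by
  rcases hW with hW | rfl
  · rw [relEnt_eq hγ hW hU]
    have hθ := hU.temperature_pos
    have hθ' := hW.temperature_pos
    have hϱ := hU.1
    have hϱ' := hW.1
    have h1 : 0 < γ - 1 := by linarith
    have h2 := (sq_nonneg _).trans (sq_sqrt_sub_one_le_sub_log (div_pos hθ' hθ))
    have h3 := (sq_nonneg _).trans (sq_sqrt_sub_one_le_mul_log (div_pos hϱ' hϱ))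
    positivity
  · rw [relEnt_zero]; exact hU.1.le

/-- H is transported with the velocity of W, up to a product of two differences. So the relative
flux is of second order in W - U; both the derivative of q and the finite speed of propagation are
read off from this. -/
lemma relFlux_eq {γ : ℝ} (hγ : 1 < γ) (i : Fin d) {W U : State d} (hW : IsGasState γ W)
    (hU : IsGasState γ U) :
    relFlux γ i W U = velocity W i * relEnt γ W U
      + (velocity W i - velocity U i) * (pressure γ W - pressure γ U) / temperature γ U := by
  have h1 : γ - 1 ≠ 0 := by linarith
  have hθ := hU.temperature_pos
  have hϱ := hU.1
  -- In F_i(W) = u_i W + p (0, e_i, u_i), the first term produces u_i H and the second the product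
  -- of differences.
  have e1 : flux γ i W = velocity W i • W
      + pressure γ W • ((0, EuclideanSpace.single i (1 : ℝ), velocity W i) : State d) := by
    have : momentum W i = velocity W i * density W := by
      rw [momentum_eq hW.1]; simp [mul_comm]
    unfold flux
    rw [this]
    ext
    · simp [density]
    · simp [momentum]
    · simp [energy]; ring
  have e2 : entVar γ U ((0, EuclideanSpace.single i (1 : ℝ), velocity W i) : State d)
      = (velocity W i - velocity U i) / temperature γ U := by
    rw [entVar_apply]
    simp [density, momentum, energy, EuclideanSpace.inner_single_right]
    ring
  unfold relFlux relEnt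
  rw [e1, map_add, map_smul, map_smul, e2, smul_eq_mul, smul_eq_mul, momentum_eq hU.1,
    entropyFlux, pressure_eq hU.1]
  simp only [PiLp.smul_apply, smul_eq_mul]
  field_simp
  ring

lemma relFlux_self {γ : ℝ} (hγ : 1 < γ) (i : Fin d) {U : State d} (hU : IsGasState γ U) :
    relFlux γ i U U = 0 := by
  rw [relFlux_eq hγ i hU hU, relEnt_self hγ hU]; simp

/-! ### Coercivity of the relative entropy. -/

/-- Quantitative bounds on a gas state. -/
structure BoundedState (γ B : ℝ) (U : State d) : Prop where
  gas : IsGasState γ U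
  density_le : density U ≤ B
  le_density : B⁻¹ ≤ density U
  temperature_le : temperature γ U ≤ B
  le_temperature : B⁻¹ ≤ temperature γ U
  velocity_le : ‖velocity U‖ ≤ B

lemma norm_state_le {W : State d} {c : ℝ} (h1 : |density W| ≤ c) (h2 : ‖momentum W‖ ≤ c)
    (h3 : |energy W| ≤ c) : ‖W‖ ≤ c :=
  max_le h1 (max_le h2 h3)

lemma abs_density_le (W : State d) : |density W| ≤ ‖W‖ := le_max_left _ _

lemma norm_momentum_le (W : State d) : ‖momentum W‖ ≤ ‖W‖ :=
  (le_max_left _ _).trans (le_max_right _ _)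

lemma norm_le_of_bounded {γ B : ℝ} (hγ : 1 < γ) (hB : 1 ≤ B)
    (hγB : (γ - 1)⁻¹ ≤ B) {U : State d} (hU : BoundedState γ B U) : ‖U‖ ≤ 2 * B ^ 3 := by
  have h1 : 0 < γ - 1 := by linarith
  have hϱ := hU.gas.1
  have hθ := hU.gas.temperature_pos
  have h2 := hU.density_le
  have h3 := hU.temperature_le
  have h4 := hU.velocity_le
  have hB2 : B ≤ B ^ 2 := by nlinarith
  have hB3 : B ^ 2 ≤ B ^ 3 := by nlinarith [sq_nonneg B]
  have hv := norm_nonneg (velocity U)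
  apply norm_state_le
  · rw [abs_of_pos hϱ]; linarith
  · rw [momentum_eq hϱ, norm_smul, Real.norm_eq_abs, abs_of_pos hϱ]
    nlinarith [mul_le_mul h2 h4 hv (by linarith)]
  · have e := energy_eq hγ hϱ
    have h5 : ‖velocity U‖ ^ 2 ≤ B ^ 2 := by gcongr
    have h6 : density U * ‖velocity U‖ ^ 2 ≤ B * B ^ 2 := by gcongr
    have h7 : density U * temperature γ U / (γ - 1) ≤ B * B * B := by
      rw [div_eq_mul_inv]; gcongr
    have h8 : 0 < density U * temperature γ U / (γ - 1) := by positivity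
    have h9 : 0 ≤ density U * ‖velocity U‖ ^ 2 := by positivity
    rw [e, abs_of_nonneg (by positivity)]
    nlinarith

/-- With ρ = a², r = b², x = c², the hypotheses bound a v, a - b and a(c - 1) by multiples of h.
Each quantity in the conclusion is one of these times a factor growing at most like B + h, hence h +
h². The weight 1/G is at least 1 and may be dropped; here γ ≤ 2 enters. -/
lemma sqrt_coordinate_bounds {B G h ρ r x v : ℝ} (hB : 1 ≤ B) (hG1 : G ≤ 1) (hG : 0 < G)
    (hr : 0 < r) (hrB : r ≤ B) (hρ : 0 < ρ) (hx : 0 < x) (hv : 0 ≤ v) (hh : 0 ≤ h)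
    (hA : ρ * v ^ 2 ≤ 2 * B * h ^ 2) (hf : ρ / G * (√x - 1) ^ 2 ≤ h ^ 2)
    (hk : r * (√(ρ / r) - 1) ^ 2 ≤ h ^ 2) :
    ρ * v ≤ 2 * B ^ 2 * (h + h ^ 2) ∧ |ρ - r| ≤ 2 * B * (h + h ^ 2) ∧
      ρ * |x - 1| ≤ 3 * B * (h + h ^ 2) := by
  obtain ⟨a, ha, rfl⟩ : ∃ a, 0 < a ∧ a ^ 2 = ρ := ⟨√ρ, Real.sqrt_pos.2 hρ, Real.sq_sqrt hρ.le⟩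
  obtain ⟨b, hb, rfl⟩ : ∃ b, 0 < b ∧ b ^ 2 = r := ⟨√r, Real.sqrt_pos.2 hr, Real.sq_sqrt hr.le⟩
  obtain ⟨c, hc, rfl⟩ : ∃ c, 0 < c ∧ c ^ 2 = x := ⟨√x, Real.sqrt_pos.2 hx, Real.sq_sqrt hx.le⟩
  rw [Real.sqrt_sq hc.le] at hf
  have hB0 : 0 ≤ B := by linarith
  have hbB : b ≤ B := abs_le_of_sq_le_sq' (by nlinarith) hB0 |>.2
  have hab : |a - b| ≤ h := by
    apply abs_le_of_sq_le_sq _ hh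
    rw [← div_pow, Real.sqrt_sq (by positivity)] at hk
    have : b ^ 2 * (a / b - 1) ^ 2 = (a - b) ^ 2 := by field_simp
    linarith
  have hab1 : a ≤ B + h := by linarith [(abs_le.1 hab).2]
  have hav : a * v ≤ 2 * B * h := by
    apply abs_le_of_sq_le_sq' _ (by positivity) |>.2
    have : B * h ^ 2 ≤ B * B * h ^ 2 := by gcongr; nlinarith
    calc (a * v) ^ 2 = a ^ 2 * v ^ 2 := by ring
      _ ≤ 2 * B * h ^ 2 := hA
      _ ≤ (2 * B * h) ^ 2 := by nlinarith [sq_nonneg h]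
  have hac : a * |c - 1| ≤ h := by
    apply abs_le_of_sq_le_sq' _ hh |>.2
    rw [mul_pow, sq_abs]
    refine le_trans ?_ hf
    gcongr
    rw [le_div_iff₀ hG]
    nlinarith [sq_nonneg a]
  have hBh : h ^ 2 ≤ B * h ^ 2 := by nlinarith [sq_nonneg h]
  refine ⟨?_, ?_, ?_⟩
  · calc a ^ 2 * v = a * (a * v) := by ring
      _ ≤ (B + h) * (2 * B * h) := by gcongr
      _ = 2 * B * (B * h + h ^ 2) := by ring
      _ ≤ 2 * B * (B * h + B * h ^ 2) := by gcongr
      _ = _ := by ring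
  · calc |a ^ 2 - b ^ 2| = |a - b| * (a + b) := by
          rw [sq_sub_sq, abs_mul, abs_of_pos (by positivity), mul_comm]
      _ ≤ h * (B + h + B) := by gcongr
      _ = 2 * B * h + h ^ 2 := by ring
      _ ≤ 2 * B * h + 2 * (B * h ^ 2) := by nlinarith [sq_nonneg h]
      _ = _ := by ring
  · calc a ^ 2 * |c ^ 2 - 1| = (a * |c - 1|) * (a * (c - 1) + 2 * a) := by
          have : c ^ 2 - 1 = (c - 1) * (c + 1) := by ring
          rw [this, abs_mul, abs_of_pos (by positivity : 0 < c + 1)]; ring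
      _ ≤ (a * |c - 1|) * (h + 2 * (B + h)) := by
          gcongr
          exact (mul_le_mul_of_nonneg_left (le_abs_self _) ha.le).trans hac
      _ ≤ h * (h + 2 * (B + h)) := by gcongr
      _ = 2 * (B * h) + 3 * h ^ 2 := by ring
      _ ≤ 3 * (B * h) + 3 * (B * h ^ 2) := by
        have : 0 ≤ B * h := by positivity
        linarith
      _ = _ := by ring

/-- Only the reference state U is bounded; W is any gas state or the vacuum. The root governs small
H, the linear term large H. This makes intermediate states of a fan usable without a priori bounds.
-/
lemma norm_sub_le_relEnt {γ B : ℝ} (hγ : 1 < γ) (hγ2 : γ ≤ 2) (hB : 1 ≤ B)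
    (hγB : (γ - 1)⁻¹ ≤ B) {W U : State d} (hW : IsGasState γ W ∨ W = 0)
    (hU : BoundedState γ B U) :
    ‖W - U‖ ≤ 9 * B ^ 4 * (√(relEnt γ W U) + relEnt γ W U) := by
  have hB0 : 0 < B := by linarith
  have hB2 : B ≤ B ^ 2 := by nlinarith
  have hB3 : B ^ 2 ≤ B ^ 3 := by nlinarith [sq_nonneg B]
  have hB4 : B ^ 3 ≤ B ^ 4 := by nlinarith [pow_pos hB0 3]
  have h1 : 0 < γ - 1 := by linarith
  have hϱ := hU.gas.1
  have hθ := hU.gas.temperature_pos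
  rcases hW with hW | rfl
  · have hH := relEnt_nonneg hγ (Or.inl hW) hU.gas
    have hϱ' := hW.1
    have hθ' := hW.temperature_pos
    have e := relEnt_eq hγ hW hU.gas
    obtain ⟨H, hHdef⟩ : ∃ H, H = relEnt γ W U := ⟨_, rfl⟩
    rw [← hHdef] at hH e ⊢
    obtain ⟨h, hh⟩ : ∃ h, h = √H := ⟨_, rfl⟩
    rw [← hh]
    have hhs : h ^ 2 = H := hh ▸ Real.sq_sqrt hH
    have hh0 : 0 ≤ h := hh ▸ Real.sqrt_nonneg _
    have f1 := sq_sqrt_sub_one_le_sub_log (div_pos hθ' hθ)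
    have k1 := sq_sqrt_sub_one_le_mul_log (div_pos hϱ' hϱ)
    obtain ⟨x, hx⟩ : ∃ x, x = temperature γ W / temperature γ U := ⟨_, rfl⟩
    obtain ⟨y, hy⟩ : ∃ y, y = density W / density U := ⟨_, rfl⟩
    rw [← hx] at e f1
    rw [← hy] at e k1
    have hA0 : 0 ≤ density W * ‖velocity W - velocity U‖ ^ 2 / (2 * temperature γ U) := by
      positivity
    have hf0 : 0 ≤ density W / (γ - 1) * (x - 1 - Real.log x) :=
      mul_nonneg (by positivity) ((sq_nonneg _).trans f1)
    have hk0 : 0 ≤ density U * (y * Real.log y - y + 1) :=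
      mul_nonneg hϱ.le ((sq_nonneg _).trans k1)
    have hA : density W * ‖velocity W - velocity U‖ ^ 2 ≤ 2 * B * h ^ 2 := by
      have h3 : density W * ‖velocity W - velocity U‖ ^ 2 / (2 * temperature γ U) ≤ h ^ 2 := by
        linarith
      rw [div_le_iff₀ (by positivity)] at h3
      have := mul_le_mul_of_nonneg_right hU.temperature_le (sq_nonneg h)
      linarith
    have hf : density W / (γ - 1) * (√x - 1) ^ 2 ≤ h ^ 2 := by
      have := mul_le_mul_of_nonneg_left f1 (by positivity : 0 ≤ density W / (γ - 1))
      linarith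
    have hk : density U * (√y - 1) ^ 2 ≤ h ^ 2 := by
      have := mul_le_mul_of_nonneg_left k1 hϱ.le
      linarith
    obtain ⟨hϱv, hϱϱ, hϱx⟩ := sqrt_coordinate_bounds hB (by linarith : γ - 1 ≤ 1) h1 hϱ
      hU.density_le hϱ' (hx ▸ div_pos hθ' hθ : 0 < x) (norm_nonneg _) hh0 hA hf (hy ▸ hk)
    rw [hhs] at hϱv hϱϱ hϱx
    rw [hhs] at hA
    obtain ⟨v, hv⟩ : ∃ v, v = ‖velocity W - velocity U‖ := ⟨_, rfl⟩
    rw [← hv] at hA hϱv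
    have hv0 : 0 ≤ v := hv ▸ norm_nonneg _
    have hS : 0 ≤ h + H := by positivity
    have hvB := hU.velocity_le
    have hv1 := norm_nonneg (velocity U)
    have hm : momentum W - momentum U = density W • (velocity W - velocity U)
        + (density W - density U) • velocity U := by
      rw [momentum_eq hϱ', momentum_eq hϱ]; module
    apply norm_state_le
    · calc |density (W - U)| = |density W - density U| := rfl
        _ ≤ _ := hϱϱ
        _ ≤ _ := by gcongr ?_ * _; linarith
    · calc ‖momentum (W - U)‖ = ‖momentum W - momentum U‖ := rfl
        _ ≤ density W * v + |density W - density U| * ‖velocity U‖ := by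
          rw [hm]
          refine (norm_add_le _ _).trans ?_
          rw [norm_smul, norm_smul, Real.norm_eq_abs, Real.norm_eq_abs, abs_of_pos hϱ', hv]
        _ ≤ 2 * B ^ 2 * (h + H) + 2 * B * (h + H) * B := by gcongr
        _ = 4 * B ^ 2 * (h + H) := by ring
        _ ≤ _ := by gcongr ?_ * _; linarith
    -- Expansion about U; each of the five terms contains a quantity already estimated.
    · have e1 : energy W - energy U = density W * v ^ 2 / 2
          + density W * inner ℝ (velocity W - velocity U) (velocity U)
          + (density W - density U) * (‖velocity U‖ ^ 2 / 2)
          + temperature γ U * (density W * (x - 1)) * (γ - 1)⁻¹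
          + temperature γ U * (density W - density U) * (γ - 1)⁻¹ := by
        rw [energy_eq hγ hϱ', energy_eq hγ hϱ, hv, norm_sub_sq_real, inner_sub_left,
          real_inner_self_eq_norm_sq, hx]
        field_simp
        ring
      have b1 : |density W * v ^ 2 / 2| ≤ B * (h + H) := by
        rw [abs_of_nonneg (by positivity), mul_add]
        have := mul_nonneg hB0.le hh0
        linarith
      have b2 : |density W * inner ℝ (velocity W - velocity U) (velocity U)|
          ≤ 2 * B ^ 2 * (h + H) * B := by
        rw [abs_mul, abs_of_pos hϱ']
        calc density W * |inner ℝ (velocity W - velocity U) (velocity U)|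
            ≤ density W * (v * ‖velocity U‖) := by
              rw [hv]; gcongr; exact abs_real_inner_le_norm _ _
          _ = density W * v * ‖velocity U‖ := by ring
          _ ≤ _ := by gcongr
      have b3 : |(density W - density U) * (‖velocity U‖ ^ 2 / 2)|
          ≤ 2 * B * (h + H) * (B ^ 2 / 2) := by
        rw [abs_mul, abs_of_nonneg (by positivity : 0 ≤ ‖velocity U‖ ^ 2 / 2)]
        gcongr
      have b4 : |temperature γ U * (density W * (x - 1)) * (γ - 1)⁻¹|
          ≤ B * (3 * B * (h + H)) * B := by
        rw [abs_mul, abs_mul, abs_mul, abs_of_pos hθ, abs_of_pos hϱ',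
          abs_of_pos (inv_pos.2 h1)]
        gcongr
        exact hU.temperature_le
      have b5 : |temperature γ U * (density W - density U) * (γ - 1)⁻¹|
          ≤ B * (2 * B * (h + H)) * B := by
        rw [abs_mul, abs_mul, abs_of_pos hθ, abs_of_pos (inv_pos.2 h1)]
        gcongr
        exact hU.temperature_le
      calc |energy (W - U)| = |energy W - energy U| := rfl
        _ ≤ B * (h + H) + 2 * B ^ 2 * (h + H) * B + 2 * B * (h + H) * (B ^ 2 / 2)
            + B * (3 * B * (h + H)) * B + B * (2 * B * (h + H)) * B := by
          rw [e1]
          refine (abs_add_le _ _).trans (add_le_add ?_ b5)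
          refine (abs_add_le _ _).trans (add_le_add ?_ b4)
          refine (abs_add_le _ _).trans (add_le_add ?_ b3)
          exact (abs_add_le _ _).trans (add_le_add b1 b2)
        _ = (B + 8 * B ^ 3) * (h + H) := by ring
        _ ≤ _ := by gcongr ?_ * _; linarith
  -- At the vacuum H = ϱ(U) ≥ B⁻¹, so the linear term alone dominates ‖U‖.
  · rw [relEnt_zero, zero_sub, norm_neg]
    have h2 := norm_le_of_bounded hγ hB hγB hU
    have h3 : 1 ≤ B * density U := by
      have := mul_le_mul_of_nonneg_left hU.le_density hB0.le
      rwa [mul_inv_cancel₀ hB0.ne'] at this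
    have h4 : 0 ≤ √(density U) := Real.sqrt_nonneg _
    have h5 : B ^ 3 * 1 ≤ B ^ 3 * (B * density U) := by gcongr
    have h6 : 0 ≤ B ^ 4 * √(density U) := by positivity
    have h7 : 0 < B ^ 3 := by positivity
    calc ‖U‖ ≤ 2 * B ^ 3 := h2
      _ ≤ 9 * (B ^ 3 * (B * density U)) + 9 * (B ^ 4 * √(density U)) := by linarith
      _ = _ := by ring

/-! ### Smoothness -/

lemma contDiff_density {n : WithTop ℕ∞} : ContDiff ℝ n (density : State d → ℝ) := contDiff_fst

lemma contDiff_momentum {n : WithTop ℕ∞} : ContDiff ℝ n (momentum : State d → Vec d) :=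
  contDiff_fst.comp contDiff_snd

lemma contDiff_energy {n : WithTop ℕ∞} : ContDiff ℝ n (energy : State d → ℝ) :=
  contDiff_snd.comp contDiff_snd

lemma contDiffAt_velocity {n : WithTop ℕ∞} {U : State d} (h : density U ≠ 0) :
    ContDiffAt ℝ n (velocity : State d → Vec d) U :=
  (contDiff_density.contDiffAt.inv h).smul contDiff_momentum.contDiffAt

lemma contDiffAt_velocity_apply {n : WithTop ℕ∞} {U : State d} (h : density U ≠ 0) (i : Fin d) :
    ContDiffAt ℝ n (fun W : State d => velocity W i) U :=
  (EuclideanSpace.proj (𝕜 := ℝ) i).contDiff.contDiffAt.comp U (contDiffAt_velocity h)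

lemma contDiffAt_pressure {n : WithTop ℕ∞} (γ : ℝ) {U : State d} (h : density U ≠ 0) :
    ContDiffAt ℝ n (pressure γ : State d → ℝ) U :=
  (contDiffAt_const.mul contDiff_density.contDiffAt).mul
    ((contDiff_energy.contDiffAt.div contDiff_density.contDiffAt h).sub
      (((contDiffAt_velocity h).norm_sq ℝ).div_const 2))

lemma contDiffAt_temperature {n : WithTop ℕ∞} (γ : ℝ) {U : State d} (h : density U ≠ 0) :
    ContDiffAt ℝ n (temperature γ : State d → ℝ) U :=
  (contDiffAt_pressure γ h).div contDiff_density.contDiffAt h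

lemma contDiffAt_flux {n : WithTop ℕ∞} (γ : ℝ) (i : Fin d) {U : State d} (h : density U ≠ 0) :
    ContDiffAt ℝ n (flux γ i : State d → State d) U := by
  refine ContDiffAt.prodMk ?_ (ContDiffAt.prodMk ?_ ?_)
  · exact (EuclideanSpace.proj (𝕜 := ℝ) i).contDiff.contDiffAt.comp U contDiff_momentum.contDiffAt
  · exact ((contDiffAt_velocity_apply h i).smul contDiff_momentum.contDiffAt).add
      ((contDiffAt_pressure γ h).smul contDiffAt_const)
  · exact (contDiffAt_velocity_apply h i).mul
      (contDiff_energy.contDiffAt.add (contDiffAt_pressure γ h))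

lemma contDiffAt_specificEntropy {n : WithTop ℕ∞} {γ : ℝ} {U : State d} (h : IsGasState γ U) :
    ContDiffAt ℝ n (specificEntropy γ : State d → ℝ) U := by
  have hp := Real.rpow_pos_of_pos h.1 γ
  refine contDiffAt_const.mul (ContDiffAt.log ?_ (div_pos h.2 hp).ne')
  exact (contDiffAt_pressure γ h.1.ne').div
    (contDiff_density.contDiffAt.rpow_const_of_ne h.1.ne') hp.ne'

lemma contDiffAt_entropy {n : WithTop ℕ∞} {γ : ℝ} {U : State d} (h : IsGasState γ U) :
    ContDiffAt ℝ n (entropy γ : State d → ℝ) U := by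
  have : (entropy γ : State d → ℝ) = fun U => density U * specificEntropy γ U := by
    ext U; exact entropy_eq_mul γ U
  rw [this]
  exact contDiff_density.contDiffAt.mul (contDiffAt_specificEntropy h)

lemma contDiffAt_entropyFlux {n : WithTop ℕ∞} {γ : ℝ} (i : Fin d) {U : State d}
    (h : IsGasState γ U) : ContDiffAt ℝ n (entropyFlux γ i : State d → ℝ) U :=
  (contDiffAt_entropy h).mul (contDiffAt_velocity_apply h.1.ne' i)

lemma isOpen_gasState (γ : ℝ) : IsOpen {U : State d | IsGasState γ U} := by
  rw [isOpen_iff_mem_nhds]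
  intro U hU
  have h1 := (contDiff_density (n := 0)).continuous.continuousAt.eventually (lt_mem_nhds hU.1)
  have h2 := (contDiffAt_pressure (n := 0) γ hU.1.ne').continuousAt.eventually
    (lt_mem_nhds hU.2)
  filter_upwards [h1, h2] with W hW1 hW2 using ⟨hW1, hW2⟩

/-- W ↦ H(W|U) attains its minimum 0 at U on the open set of gas states, so its derivative `entVar γ
U` - η'(U) vanishes there. -/
lemma hasFDerivAt_entropy {γ : ℝ} (hγ : 1 < γ) {U : State d} (h : IsGasState γ U) :
    HasFDerivAt (entropy γ) (entVar γ U) U := by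
  have h1 := ((contDiffAt_entropy (n := 1) h).differentiableAt one_ne_zero).hasFDerivAt
  have h2 : HasFDerivAt (fun W => relEnt γ W U) (entVar γ U - fderiv ℝ (entropy γ) U) U :=
    ((entVar γ U).hasFDerivAt.const_add (density U)).sub h1
  have h3 : IsLocalMin (fun W => relEnt γ W U) U := by
    filter_upwards [(isOpen_gasState γ).mem_nhds h] with W hW
    rw [relEnt_self hγ h]
    exact relEnt_nonneg hγ (Or.inl hW) h
  have h4 := h3.hasFDerivAt_eq_zero h2
  rw [sub_eq_zero] at h4
  rw [h4]; exact h1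

lemma entVar_eventuallyEq {γ : ℝ} (hγ : 1 < γ) {U : State d} (h : IsGasState γ U) :
    entVar γ =ᶠ[𝓝 U] fderiv ℝ (entropy γ) := by
  filter_upwards [(isOpen_gasState γ).mem_nhds h] with W hW
  exact (hasFDerivAt_entropy hγ hW).fderiv.symm

lemma contDiffAt_entVar {n : ℕ} {γ : ℝ} (hγ : 1 < γ) {U : State d} (h : IsGasState γ U) :
    ContDiffAt ℝ n (entVar γ : State d → State d →L[ℝ] ℝ) U :=
  ((contDiffAt_entropy (n := (n + 1 : ℕ)) h).fderiv_right (by norm_cast)).congr_of_eventuallyEq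
    (entVar_eventuallyEq hγ h)

/-- The compatibility q' = η'F'. In `relFlux_eq`, H vanishes at U together with its derivative, and
the other term is a product of two factors vanishing at U; hence the derivative of the relative flux
at U is zero. -/
lemma hasFDerivAt_entropyFlux {γ : ℝ} (hγ : 1 < γ) (i : Fin d) {U : State d}
    (h : IsGasState γ U) :
    HasFDerivAt (entropyFlux γ i) ((entVar γ U).comp (fderiv ℝ (flux γ i) U)) U := by
  have h1 := ((contDiffAt_entropyFlux (n := 1) i h).differentiableAt one_ne_zero).hasFDerivAt
  have hF := ((contDiffAt_flux (n := 1) γ i h.1.ne').differentiableAt one_ne_zero).hasFDerivAt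
  have h2 : HasFDerivAt (fun W => relFlux γ i W U)
      ((entVar γ U).comp (fderiv ℝ (flux γ i) U) - fderiv ℝ (entropyFlux γ i) U) U :=
    (((entVar γ U).hasFDerivAt.comp U hF).const_add (momentum U i)).sub h1
  have hH : HasFDerivAt (fun W => relEnt γ W U) (entVar γ U - entVar γ U) U :=
    ((entVar γ U).hasFDerivAt.const_add (density U)).sub (hasFDerivAt_entropy hγ h)
  have hu := ((contDiffAt_velocity_apply (n := 1) h.1.ne' i).differentiableAt
    one_ne_zero).hasFDerivAt
  have hp := ((contDiffAt_pressure (n := 1) γ h.1.ne').differentiableAt one_ne_zero).hasFDerivAt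
  have h3 := (hu.mul hH).add (((hu.sub_const (velocity U i)).mul
    (hp.sub_const (pressure γ U))).mul_const (temperature γ U)⁻¹)
  simp only [relEnt_self hγ h, sub_self, zero_smul, smul_zero, add_zero] at h3
  have h4 := h3.congr_of_eventuallyEq (f₁ := fun W => relFlux γ i W U) (by
    filter_upwards [(isOpen_gasState γ).mem_nhds h] with W hW
    rw [relFlux_eq hγ i hW h]; simp [div_eq_mul_inv])
  have h5 := h2.unique h4
  rw [sub_eq_zero] at h5
  rw [h5]; exact h1

/-- The matrix `η'' F_i'` is symmetric. -/
lemma fderiv_entVar_fderiv_flux {γ : ℝ} (hγ : 1 < γ) (i : Fin d) {U : State d}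
    (h : IsGasState γ U) (v w : State d) :
    fderiv ℝ (entVar γ) U v (fderiv ℝ (flux γ i) U w)
      = fderiv ℝ (entVar γ) U (fderiv ℝ (flux γ i) U v) w := by
  have hmin : minSmoothness ℝ 2 ≤ 2 := by simp
  have s1 : IsSymmSndFDerivAt ℝ (entropy γ) U :=
    (contDiffAt_entropy (n := 2) h).isSymmSndFDerivAt hmin
  have s2 : IsSymmSndFDerivAt ℝ (entropyFlux γ i) U :=
    (contDiffAt_entropyFlux (n := 2) i h).isSymmSndFDerivAt hmin
  have s3 : IsSymmSndFDerivAt ℝ (flux γ i) U :=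
    (contDiffAt_flux (n := 2) γ i h.1.ne').isSymmSndFDerivAt hmin
  have e1 : fderiv ℝ (entVar γ) U = fderiv ℝ (fderiv ℝ (entropy γ)) U :=
    (entVar_eventuallyEq hγ h).fderiv_eq
  have ha := ((contDiffAt_entVar (n := 1) hγ h).differentiableAt (by simp)).hasFDerivAt
  have hF := (((contDiffAt_flux (n := 2) γ i h.1.ne').fderiv_right (m := 1)
    (by norm_num)).differentiableAt one_ne_zero).hasFDerivAt
  have e2 : fderiv ℝ (entropyFlux γ i) =ᶠ[𝓝 U]
      fun W => (entVar γ W).comp (fderiv ℝ (flux γ i) W) := by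
    filter_upwards [(isOpen_gasState γ).mem_nhds h] with W hW
    exact (hasFDerivAt_entropyFlux hγ i hW).fderiv
  have e3 := (ha.clm_comp hF).congr_of_eventuallyEq e2
  -- Differentiating q' = η'F' once more. The second derivatives of q and F_i are symmetric, hence
  -- so is the remaining term.
  have key : ∀ v w, fderiv ℝ (fderiv ℝ (entropyFlux γ i)) U v w
      = entVar γ U (fderiv ℝ (fderiv ℝ (flux γ i)) U v w)
        + fderiv ℝ (entVar γ) U v (fderiv ℝ (flux γ i) U w) := by
    intro v w
    rw [e3.fderiv]
    simp
  have k1 := key v w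
  have k2 := key w v
  rw [s2.eq v w, s3.eq v w] at k1
  have k3 : fderiv ℝ (entVar γ) U v (fderiv ℝ (flux γ i) U w)
      = fderiv ℝ (entVar γ) U w (fderiv ℝ (flux γ i) U v) := by linarith
  rw [k3, e1]
  exact s1.eq w _

/-! ### Compact convex sets of gas states -/

lemma exists_lipschitz_of_contDiffAt {E F : Type*} [NormedAddCommGroup E] [NormedSpace ℝ E]
    [NormedAddCommGroup F] [NormedSpace ℝ F] {f : E → F} {K : Set E} (hK : IsCompact K)
    (hc : Convex ℝ K) (hf : ∀ x ∈ K, ContDiffAt ℝ 1 f x) :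
    ∃ C, 0 ≤ C ∧ (∀ x ∈ K, ‖f x‖ ≤ C) ∧ (∀ x ∈ K, ‖fderiv ℝ f x‖ ≤ C) ∧
      ∀ x ∈ K, ∀ y ∈ K, ‖f y - f x‖ ≤ C * ‖y - x‖ := by
  obtain ⟨C, hC⟩ := hK.exists_bound_of_continuousOn (f := fderiv ℝ f) fun x hx =>
    ((hf x hx).continuousAt_fderiv one_ne_zero).continuousWithinAt
  obtain ⟨C', hC'⟩ := hK.exists_bound_of_continuousOn (f := f) fun x hx =>
    (hf x hx).continuousAt.continuousWithinAt
  refine ⟨max 0 (max C C'), le_max_left _ _, fun x hx => (hC' x hx).trans (by simp),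
    fun x hx => (hC x hx).trans (by simp), fun x hx y hy => ?_⟩
  refine (hc.norm_image_sub_le_of_norm_fderiv_le (𝕜 := ℝ)
    (fun z hz => (hf z hz).differentiableAt one_ne_zero) hC hx hy).trans ?_
  gcongr
  simp

lemma exists_quadratic_of_contDiffAt {E F : Type*} [NormedAddCommGroup E] [NormedSpace ℝ E]
    [NormedAddCommGroup F] [NormedSpace ℝ F] {f : E → F} {K : Set E} (hK : IsCompact K)
    (hc : Convex ℝ K) (hf : ∀ x ∈ K, ContDiffAt ℝ 2 f x) :
    ∃ C, 0 ≤ C ∧ ∀ x ∈ K, ∀ y ∈ K, ‖f y - f x - fderiv ℝ f x (y - x)‖ ≤ C * ‖y - x‖ ^ 2 := by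
  obtain ⟨C, hC0, -, -, hC⟩ := exists_lipschitz_of_contDiffAt (f := fderiv ℝ f) hK hc
    fun x hx => (hf x hx).fderiv_right (by norm_num)
  refine ⟨C, hC0, fun x hx y hy => ?_⟩
  have hseg : segment ℝ x y ⊆ K := hc.segment_subset hx hy
  have := (convex_segment x y).norm_image_sub_le_of_norm_hasFDerivWithin_le' (𝕜 := ℝ) (f := f)
    (f' := fderiv ℝ f) (φ := fderiv ℝ f x) (C := C * ‖y - x‖)
    (fun z hz => ((hf z (hseg hz)).differentiableAt (by simp)).hasFDerivAt.hasFDerivWithinAt)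
    (fun z hz => ?_) (left_mem_segment ℝ x y) (right_mem_segment ℝ x y)
  · rwa [pow_two, ← mul_assoc]
  · refine (hC x hx z (hseg hz)).trans ?_
    gcongr
    obtain ⟨θ, hθ, rfl⟩ := (segment_eq_image' ℝ x y ▸ hz :
      z ∈ (fun θ : ℝ => x + θ • (y - x)) '' Icc 0 1)
    simp only [add_sub_cancel_left, norm_smul, Real.norm_eq_abs, abs_of_nonneg hθ.1]
    exact mul_le_of_le_one_left (norm_nonneg _) hθ.2

/-- Gas states with density at least `r`, norm at most `R` and pressure at least `π₀`. -/
def gasBox (d : ℕ) (γ r R π₀ : ℝ) : Set (State d) :=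
  {U | r ≤ density U ∧ ‖U‖ ≤ R ∧
    ∀ v : Vec d, π₀ ≤ (γ - 1) * (energy U - inner ℝ v (momentum U) + density U * ‖v‖ ^ 2 / 2)}

lemma pressure_eq_energy (γ : ℝ) {U : State d} (h : 0 < density U) :
    pressure γ U = (γ - 1) * (energy U - density U * ‖velocity U‖ ^ 2 / 2) := by
  unfold pressure internalEnergy
  field_simp

/-- The expression in v equals p + (γ - 1) ϱ|u - v|²/2 and is smallest at v = u. Thus p ≥ π₀ is an
intersection of half-spaces in U, which makes the set convex and closed. -/
lemma mem_gasBox_iff {γ r R π₀ : ℝ} (hγ : 1 < γ) (hr : 0 < r) {U : State d} :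
    U ∈ gasBox d γ r R π₀ ↔ r ≤ density U ∧ ‖U‖ ≤ R ∧ π₀ ≤ pressure γ U := by
  unfold gasBox
  rw [mem_ofPred_eq]
  refine and_congr_right fun h1 => and_congr_right fun _ => ?_
  have hϱ : 0 < density U := hr.trans_le h1
  have key : ∀ v : Vec d, (γ - 1) * (energy U - inner ℝ v (momentum U) + density U * ‖v‖ ^ 2 / 2)
      = pressure γ U + (γ - 1) * (density U * ‖velocity U - v‖ ^ 2 / 2) := by
    intro v
    rw [pressure_eq_energy γ hϱ, momentum_eq hϱ, inner_smul_right, norm_sub_sq_real,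
      real_inner_comm]
    ring
  have h2 : 0 < γ - 1 := by linarith
  constructor
  · intro h
    have := h (velocity U)
    rw [key] at this
    simpa using this
  · intro h v
    rw [key]
    have : 0 ≤ (γ - 1) * (density U * ‖velocity U - v‖ ^ 2 / 2) := by positivity
    linarith

lemma gasBox_gas {γ r R π₀ : ℝ} (hγ : 1 < γ) (hr : 0 < r) (hπ : 0 < π₀) {U : State d}
    (hU : U ∈ gasBox d γ r R π₀) : IsGasState γ U := by
  obtain ⟨h1, -, h3⟩ := (mem_gasBox_iff hγ hr).1 hU
  exact ⟨hr.trans_le h1, hπ.trans_le h3⟩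

lemma convex_gasBox (γ r R π₀ : ℝ) : Convex ℝ (gasBox d γ r R π₀) := by
  have e : gasBox d γ r R π₀ = {U : State d | r ≤ ContinuousLinearMap.fst ℝ ℝ (Vec d × ℝ) U} ∩
      (Metric.closedBall 0 R ∩ ⋂ v : Vec d, {U : State d | π₀ ≤
        ((γ - 1) • ((ContinuousLinearMap.snd ℝ (Vec d) ℝ).comp
          (ContinuousLinearMap.snd ℝ ℝ (Vec d × ℝ))
        - (innerSL ℝ v).comp ((ContinuousLinearMap.fst ℝ (Vec d) ℝ).comp
          (ContinuousLinearMap.snd ℝ ℝ (Vec d × ℝ)))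
        + (‖v‖ ^ 2 / 2) • ContinuousLinearMap.fst ℝ ℝ (Vec d × ℝ))) U}) := by
    ext U
    simp only [gasBox, mem_ofPred_eq, mem_inter_iff, mem_iInter, Metric.mem_closedBall,
      dist_zero_right]
    refine and_congr_right fun _ => and_congr_right fun _ => forall_congr' fun v => ?_
    simp [density, energy, momentum]
    ring_nf
  rw [e]
  refine (convex_halfSpace_ge (ContinuousLinearMap.fst ℝ ℝ (Vec d × ℝ)).isLinear r).inter
    ((convex_closedBall 0 R).inter (convex_iInter fun v => ?_))
  exact convex_halfSpace_ge (LinearMap.isLinear (ContinuousLinearMap.toLinearMap _)) π₀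

lemma isCompact_gasBox (γ r R π₀ : ℝ) : IsCompact (gasBox d γ r R π₀) := by
  refine (isCompact_closedBall (0 : State d) R).of_isClosed_subset ?_ fun U hU => by
    simpa using hU.2.1
  have h1 := (contDiff_density (d := d) (n := 0)).continuous
  have h2 := (contDiff_momentum (d := d) (n := 0)).continuous
  have h3 := (contDiff_energy (d := d) (n := 0)).continuous
  have e : gasBox d γ r R π₀ = {U | r ≤ density U} ∩ ({U | ‖U‖ ≤ R} ∩ ⋂ v : Vec d,
      {U | π₀ ≤ (γ - 1) * (energy U - inner ℝ v (momentum U) + density U * ‖v‖ ^ 2 / 2)}) := by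
    ext U; simp [gasBox]
  rw [e]
  refine (isClosed_le continuous_const h1).inter ((isClosed_le continuous_norm
    continuous_const).inter (isClosed_iInter fun v => isClosed_le continuous_const ?_))
  fun_prop

lemma exists_boundedState {γ : ℝ} {K : Set (State d)} (hK : IsCompact K)
    (hgas : ∀ U ∈ K, IsGasState γ U) :
    ∃ B, 1 ≤ B ∧ (γ - 1)⁻¹ ≤ B ∧ ∀ U ∈ K, BoundedState γ B U := by
  have hc1 : ContinuousOn (density : State d → ℝ) K :=
    (contDiff_density (n := 0)).continuous.continuousOn
  have hc2 : ContinuousOn (temperature γ : State d → ℝ) K := fun U hU =>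
    (contDiffAt_temperature (n := 0) γ (hgas U hU).1.ne').continuousAt.continuousWithinAt
  have hc3 : ContinuousOn (velocity : State d → Vec d) K := fun U hU =>
    (contDiffAt_velocity (n := 0) (hgas U hU).1.ne').continuousAt.continuousWithinAt
  obtain ⟨C1, h1⟩ := hK.exists_bound_of_continuousOn hc1
  obtain ⟨C2, h2⟩ := hK.exists_bound_of_continuousOn hc2
  obtain ⟨C3, h3⟩ := hK.exists_bound_of_continuousOn hc3
  obtain ⟨C4, h4⟩ := hK.exists_bound_of_continuousOn (hc1.inv₀ fun U hU => (hgas U hU).1.ne')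
  obtain ⟨C5, h5⟩ := hK.exists_bound_of_continuousOn
    (hc2.inv₀ fun U hU => (hgas U hU).temperature_pos.ne')
  obtain ⟨B, hB⟩ := ((Finset.finite_toSet {1, (γ - 1)⁻¹, C1, C2, C3, C4, C5}).bddAbove)
  simp only [Finset.coe_insert, Finset.coe_singleton, mem_upperBounds, mem_insert_iff,
    mem_singleton_iff, forall_eq_or_imp, forall_eq] at hB
  obtain ⟨b0, b00, b1, b2, b3, b4, b5⟩ := hB
  refine ⟨B, b0, b00, fun U hU => ?_⟩
  have hϱ := (hgas U hU).1
  have hθ := (hgas U hU).temperature_pos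
  refine ⟨hgas U hU, (le_abs_self _).trans ((h1 U hU).trans b1), ?_,
    (le_abs_self _).trans ((h2 U hU).trans b2), ?_, (h3 U hU).trans b3⟩
  · exact inv_le_of_inv_le₀ hϱ ((le_abs_self _).trans ((h4 U hU).trans b4))
  · exact inv_le_of_inv_le₀ hθ ((le_abs_self _).trans ((h5 U hU).trans b5))

lemma relEnt_eq_remainder {γ : ℝ} (hγ : 1 < γ) {W U : State d} (hU : IsGasState γ U) :
    relEnt γ W U = -(entropy γ W - entropy γ U - entVar γ U (W - U)) := by
  unfold relEnt
  rw [map_sub, entVar_self hγ hU]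
  ring

/-- On compact convex sets of gas states, the relative entropy is comparable with the square of
the distance. -/
lemma exists_relEnt_equiv {γ : ℝ} (hγ : 1 < γ) (hγ2 : γ ≤ 2) {K : Set (State d)}
    (hK : IsCompact K) (hc : Convex ℝ K) (hgas : ∀ U ∈ K, IsGasState γ U) :
    ∃ C, 0 ≤ C ∧ ∀ U ∈ K, ∀ W ∈ K, relEnt γ W U ≤ C * ‖W - U‖ ^ 2 ∧
      ‖W - U‖ ^ 2 ≤ C * relEnt γ W U := by
  obtain ⟨B, hB1, hB2, hB⟩ := exists_boundedState hK hgas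
  obtain ⟨C, hC0, hC⟩ := exists_quadratic_of_contDiffAt (f := entropy γ) hK hc
    fun U hU => contDiffAt_entropy (hgas U hU)
  obtain ⟨R, hR⟩ := hK.isBounded.exists_norm_le
  have hup : ∀ U ∈ K, ∀ W ∈ K, relEnt γ W U ≤ C * ‖W - U‖ ^ 2 := by
    intro U hU W hW
    rw [relEnt_eq_remainder hγ (hgas U hU), ← (hasFDerivAt_entropy hγ (hgas U hU)).fderiv]
    exact (neg_le_abs _).trans (hC U hU W hW)
  -- M bounds √H on K, so the linear term of `norm_sub_le_relEnt` is at most M√H.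
  set M := √(C * (R + R) ^ 2) with hM
  have hM0 : 0 ≤ M := Real.sqrt_nonneg _
  refine ⟨max C ((9 * B ^ 4 * (1 + M)) ^ 2), hC0.trans (le_max_left _ _),
    fun U hU W hW => ⟨(hup U hU W hW).trans (by gcongr; exact le_max_left _ _), ?_⟩⟩
  have hH := relEnt_nonneg hγ (Or.inl (hgas W hW)) (hgas U hU)
  have h1 := norm_sub_le_relEnt hγ hγ2 hB1 hB2 (Or.inl (hgas W hW)) (hB U hU)
  have h2 : √(relEnt γ W U) ≤ M := by
    apply Real.sqrt_le_sqrt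
    refine (hup U hU W hW).trans ?_
    gcongr
    exact (norm_sub_le _ _).trans (add_le_add (hR W hW) (hR U hU))
  have h3 : ‖W - U‖ ≤ 9 * B ^ 4 * (1 + M) * √(relEnt γ W U) := by
    refine h1.trans ?_
    rw [mul_assoc (9 * B ^ 4)]
    gcongr
    nlinarith [Real.sq_sqrt hH, Real.sqrt_nonneg (relEnt γ W U)]
  calc ‖W - U‖ ^ 2 ≤ (9 * B ^ 4 * (1 + M) * √(relEnt γ W U)) ^ 2 := by gcongr
    _ = (9 * B ^ 4 * (1 + M)) ^ 2 * relEnt γ W U := by rw [mul_pow, Real.sq_sqrt hH]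
    _ ≤ _ := by gcongr; exact le_max_right _ _

/-- Finite speed of propagation for states close to a compact set. -/
lemma exists_relFlux_le {γ : ℝ} (hγ : 1 < γ) (hγ2 : γ ≤ 2) {K : Set (State d)}
    (hK : IsCompact K) (hc : Convex ℝ K) (hgas : ∀ U ∈ K, IsGasState γ U) (i : Fin d) :
    ∃ c₀ > 0, ∃ Λ, 0 ≤ Λ ∧ ∀ U ∈ K, ∀ W, (IsGasState γ W ∨ W = 0) → relEnt γ W U < c₀ →
      |relFlux γ i W U| ≤ Λ * relEnt γ W U := by
  obtain ⟨B, hB1, hB2, hB⟩ := exists_boundedState hK hgas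
  have hB0 : 0 < B := by linarith
  -- W is not assumed to lie in K; small H puts it in this compact convex neighbourhood of gas
  -- states.
  obtain ⟨δ, hδ, hδK⟩ := hK.exists_cthickening_subset_open (isOpen_gasState γ) hgas
  set K' := Metric.cthickening δ K
  have hK' : IsCompact K' := hK.cthickening
  have hc' : Convex ℝ K' := hc.cthickening δ
  have hgas' : ∀ U ∈ K', IsGasState γ U := hδK
  have hKK' : K ⊆ K' := Metric.self_subset_cthickening K
  obtain ⟨C1, hC10, hC1⟩ := exists_relEnt_equiv hγ hγ2 hK' hc' hgas'
  obtain ⟨C2, hC20, hC2b, -, hC2⟩ := exists_lipschitz_of_contDiffAt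
    (f := fun U : State d => velocity U i) hK' hc'
    fun U hU => contDiffAt_velocity_apply (hgas' U hU).1.ne' i
  obtain ⟨C3, hC30, -, -, hC3⟩ := exists_lipschitz_of_contDiffAt (f := pressure γ) hK' hc'
    fun U hU => contDiffAt_pressure γ (hgas' U hU).1.ne'
  set A := 9 * B ^ 4 with hA
  have hA0 : 0 < A := by positivity
  -- Below the threshold H ≤ √H ≤ δ/(2A), so `norm_sub_le_relEnt` places W within δ of U.
  refine ⟨min 1 ((δ / (2 * A)) ^ 2), by positivity, C2 + C2 * C3 * C1 * B, by positivity,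
    fun U hU W hW hWU => ?_⟩
  have hH := relEnt_nonneg hγ hW (hgas U hU)
  have hs : √(relEnt γ W U) ≤ δ / (2 * A) := by
    apply Real.sqrt_le_iff.2 ⟨by positivity, (hWU.le.trans (min_le_right _ _))⟩
  have hs2 : relEnt γ W U ≤ √(relEnt γ W U) := by
    have h1 : √(relEnt γ W U) ≤ 1 := Real.sqrt_le_one.2 (hWU.le.trans (min_le_left _ _))
    nlinarith [Real.sq_sqrt hH, Real.sqrt_nonneg (relEnt γ W U)]
  have hWK : W ∈ K' := by
    refine Metric.mem_cthickening_of_dist_le W U δ K hU ?_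
    rw [dist_eq_norm]
    calc ‖W - U‖ ≤ A * (√(relEnt γ W U) + relEnt γ W U) :=
          norm_sub_le_relEnt hγ hγ2 hB1 hB2 hW (hB U hU)
      _ ≤ A * (δ / (2 * A) + δ / (2 * A)) := by gcongr; linarith
      _ = δ := by field_simp; ring
  have hθ := (hgas U hU).temperature_pos
  have hθB : (temperature γ U)⁻¹ ≤ B := inv_le_of_inv_le₀ hB0 (hB U hU).le_temperature
  rw [relFlux_eq hγ i (hgas' W hWK) (hgas U hU)]
  have e1 : |velocity W i| ≤ C2 := hC2b W hWK
  have e2 : |velocity W i - velocity U i| ≤ C2 * ‖W - U‖ := hC2 U (hKK' hU) W hWK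
  have e3 : |pressure γ W - pressure γ U| ≤ C3 * ‖W - U‖ := hC3 U (hKK' hU) W hWK
  have e4 := (hC1 U (hKK' hU) W hWK).2
  refine (abs_add_le _ _).trans ?_
  rw [abs_mul, abs_div, abs_mul, abs_of_nonneg hH, abs_of_pos hθ, div_eq_mul_inv]
  calc _ ≤ C2 * relEnt γ W U + C2 * ‖W - U‖ * (C3 * ‖W - U‖) * B := by gcongr
    _ = C2 * relEnt γ W U + C2 * C3 * B * ‖W - U‖ ^ 2 := by ring
    _ ≤ C2 * relEnt γ W U + C2 * C3 * B * (C1 * relEnt γ W U) := by gcongr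
    _ = _ := by ring

/-! ### Self-similar solutions -/

/-- The integral properties of a self-similar entropy solution. -/
structure WeakFan (γ : ℝ) (i : Fin d) (I : Set ℝ) (W : ℝ → State d) : Prop where
  admissible : ∀ ξ ∈ I, IsGasState γ (W ξ) ∨ W ξ = 0
  integrable : ∀ ξ₁ ∈ I, ∀ ξ₂ ∈ I, IntervalIntegrable W volume ξ₁ ξ₂
  entropy_integrable : ∀ ξ₁ ∈ I, ∀ ξ₂ ∈ I,
    IntervalIntegrable (fun ξ => entropy γ (W ξ)) volume ξ₁ ξ₂
  conservation : ∀ ξ₁ ∈ I, ∀ ξ₂ ∈ I, ξ₁ ≤ ξ₂ →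
    flux γ i (W ξ₂) - flux γ i (W ξ₁) = ξ₂ • W ξ₂ - ξ₁ • W ξ₁ - ∫ ξ in ξ₁..ξ₂, W ξ
  entropy_inequality : ∀ ξ₁ ∈ I, ∀ ξ₂ ∈ I, ξ₁ ≤ ξ₂ →
    ξ₂ * entropy γ (W ξ₂) - ξ₁ * entropy γ (W ξ₁) - (∫ ξ in ξ₁..ξ₂, entropy γ (W ξ))
      ≤ entropyFlux γ i (W ξ₂) - entropyFlux γ i (W ξ₁)

lemma WeakFan.mono {γ : ℝ} {i : Fin d} {I J : Set ℝ} {W : ℝ → State d} (h : WeakFan γ i I W)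
    (hJ : J ⊆ I) : WeakFan γ i J W :=
  ⟨fun ξ hξ => h.admissible ξ (hJ hξ),
    fun a ha b hb => h.integrable a (hJ ha) b (hJ hb),
    fun a ha b hb => h.entropy_integrable a (hJ ha) b (hJ hb),
    fun a ha b hb => h.conservation a (hJ ha) b (hJ hb),
    fun a ha b hb => h.entropy_inequality a (hJ ha) b (hJ hb)⟩

/-- Continuity gives local integrability off the finite set `D`, one-sided limits give it at the
points of `D`, and compactness does the rest. -/
lemma integrableOn_of_piecewise_continuous {X : Type*} [NormedAddCommGroup X]
    {W : ℝ → X} {I : Set ℝ} {D : Finset ℝ} (hc : ContinuousOn W (I \ D))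
    (hD : ∀ s ∈ D, (∃ a, Tendsto W (𝓝[I ∩ Iio s] s) (𝓝 a)) ∧
      ∃ b, Tendsto W (𝓝[I ∩ Ioi s] s) (𝓝 b)) {a b : ℝ} (hab : Icc a b ⊆ I) :
    IntegrableOn W (Icc a b) volume := by
  have hmeas : AEStronglyMeasurable W (volume.restrict (Icc a b)) := by
    have h1 : AEStronglyMeasurable W (volume.restrict (Icc a b \ D)) :=
      (hc.mono (sdiff_subset_sdiff_left hab)).aestronglyMeasurable
        (measurableSet_Icc.diff D.measurableSet)
    have h2 : (Icc a b \ D : Set ℝ) =ᵐ[volume] Icc a b :=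
      sdiff_null_ae_eq_self (D.countable_toSet.measure_zero volume)
    rwa [Measure.restrict_congr_set h2] at h1
  have hm : ∀ s : Set ℝ, MeasurableSet s → ∀ x, StronglyMeasurableAtFilter W (𝓝[s ∩ Icc a b] x)
      volume := fun s hs x =>
    ⟨s ∩ Icc a b, self_mem_nhdsWithin, hmeas.mono_measure
      (Measure.restrict_mono inter_subset_right le_rfl)⟩
  refine LocallyIntegrableOn.integrableOn_isCompact (fun x hx => ?_) isCompact_Icc
  by_cases hxD : x ∈ D
  · obtain ⟨⟨l, hl⟩, r, hr⟩ := hD x hxD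
    have hsplit : 𝓝[Icc a b] x
        ≤ 𝓝[Iio x ∩ Icc a b] x ⊔ (𝓝[{x} ∩ Icc a b] x ⊔ 𝓝[Ioi x ∩ Icc a b] x) := by
      rw [← nhdsWithin_union, ← nhdsWithin_union]
      apply nhdsWithin_mono
      intro y hy
      rcases lt_trichotomy y x with h | h | h
      · exact Or.inl ⟨h, hy⟩
      · exact Or.inr (Or.inl ⟨h, hy⟩)
      · exact Or.inr (Or.inr ⟨h, hy⟩)
    refine IntegrableAtFilter.filter_mono hsplit ?_
    rw [IntegrableAtFilter.sup_iff, IntegrableAtFilter.sup_iff]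
    have := (measurableSet_Iio.inter (measurableSet_Icc (a := a) (b := b))
      ).nhdsWithin_isMeasurablyGenerated (a := x) (s := Iio x ∩ Icc a b)
    have := (measurableSet_Ioi.inter (measurableSet_Icc (a := a) (b := b))
      ).nhdsWithin_isMeasurablyGenerated (a := x) (s := Ioi x ∩ Icc a b)
    refine ⟨?_, ?_, ?_⟩
    · refine Filter.Tendsto.integrableAtFilter (hm _ measurableSet_Iio x)
        (Measure.finiteAt_nhdsWithin _ _ _) (hl.mono_left (nhdsWithin_mono _ ?_))
      exact fun y hy => ⟨hab hy.2, hy.1⟩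
    · have : IntegrableOn W ({x} : Set ℝ) volume := by
        rw [IntegrableOn, Measure.restrict_eq_zero.2 (by simp)]
        exact integrable_zero_measure
      exact ⟨{x} ∩ Icc a b, self_mem_nhdsWithin, this.mono_set inter_subset_left⟩
    · refine Filter.Tendsto.integrableAtFilter (hm _ measurableSet_Ioi x)
        (Measure.finiteAt_nhdsWithin _ _ _) (hr.mono_left (nhdsWithin_mono _ ?_))
      exact fun y hy => ⟨hab hy.2, hy.1⟩
  · have hx' : (D : Set ℝ)ᶜ ∈ 𝓝 x := D.finite_toSet.isClosed.isOpen_compl.mem_nhds hxD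
    have h1 : Tendsto W (𝓝[Icc a b] x) (𝓝 (W x)) := by
      have h2 := hc x ⟨hab hx, hxD⟩
      refine h2.mono_left ?_
      exact nhdsWithin_le_of_mem (inter_mem (mem_of_superset self_mem_nhdsWithin hab)
        (mem_nhdsWithin_of_mem_nhds hx'))
    refine h1.integrableAtFilter ?_ (Measure.finiteAt_nhdsWithin _ _ _)
    exact ⟨Icc a b, self_mem_nhdsWithin, hmeas⟩

lemma IsFan.weakFan {γ : ℝ} {i : Fin d} {I : Set ℝ} {W : ℝ → State d} (h : IsFan γ i I W)
    (hI : I.OrdConnected) : WeakFan γ i I W := by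
  refine ⟨h.admissible, fun a ha b hb => ?_, h.entropy_integrable, h.conservation,
    h.entropy_inequality⟩
  obtain ⟨D, hc, hD⟩ := h.piecewise
  have := integrableOn_of_piecewise_continuous hc.continuousOn hD (hI.uIcc_subset ha hb)
  exact IntegrableOn.intervalIntegrable this

/-! #### Reflection -/

/-- Reflection of the `i`-th coordinate. -/
def flipCoord (i : Fin d) : Vec d ≃ₗᵢ[ℝ] Vec d :=
  LinearIsometryEquiv.piLpCongrRight 2 fun j =>
    if j = i then LinearIsometryEquiv.neg ℝ else LinearIsometryEquiv.refl ℝ ℝ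

lemma flipCoord_apply (i j : Fin d) (v : Vec d) :
    flipCoord i v j = if j = i then -v j else v j := by
  unfold flipCoord
  simp only [LinearIsometryEquiv.piLpCongrRight_apply]
  split_ifs <;> simp

/-- Reflection of a state in the `i`-th coordinate. -/
def mirrorState (i : Fin d) : State d →L[ℝ] State d :=
  (ContinuousLinearMap.id ℝ ℝ).prodMap
    (((flipCoord i : Vec d ≃L[ℝ] Vec d) : Vec d →L[ℝ] Vec d).prodMap (ContinuousLinearMap.id ℝ ℝ))

lemma mirrorState_apply (i : Fin d) (U : State d) : mirrorState i U = (U.1, flipCoord i U.2.1, U.2.2) := rfl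

lemma density_mirror (i : Fin d) (U : State d) : density (mirrorState i U) = density U := rfl

lemma momentum_mirror (i : Fin d) (U : State d) :
    momentum (mirrorState i U) = flipCoord i (momentum U) := rfl

lemma energy_mirror (i : Fin d) (U : State d) : energy (mirrorState i U) = energy U := rfl

lemma norm_mirror (i : Fin d) (U : State d) : ‖mirrorState i U‖ = ‖U‖ := by
  rw [mirrorState_apply]
  simp [Prod.norm_def]

lemma velocity_mirror (i : Fin d) (U : State d) :
    velocity (mirrorState i U) = flipCoord i (velocity U) := by
  simp [velocity, density_mirror, momentum_mirror]

lemma pressure_mirror (γ : ℝ) (i : Fin d) (U : State d) :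
    pressure γ (mirrorState i U) = pressure γ U := by
  simp [pressure, internalEnergy, density_mirror, energy_mirror, velocity_mirror]

lemma specificEntropy_mirror (γ : ℝ) (i : Fin d) (U : State d) :
    specificEntropy γ (mirrorState i U) = specificEntropy γ U := by
  simp [specificEntropy, pressure_mirror, density_mirror]

lemma entropy_mirror (γ : ℝ) (i : Fin d) (U : State d) :
    entropy γ (mirrorState i U) = entropy γ U := by
  simp [entropy, pressure_mirror, density_mirror]

lemma entropyFlux_mirror (γ : ℝ) (i : Fin d) (U : State d) :
    entropyFlux γ i (mirrorState i U) = -entropyFlux γ i U := by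
  simp [entropyFlux, entropy_mirror, velocity_mirror, flipCoord_apply]

lemma isGasState_mirror (γ : ℝ) (i : Fin d) (U : State d) :
    IsGasState γ (mirrorState i U) ↔ IsGasState γ U := by
  simp [IsGasState, pressure_mirror, density_mirror]

lemma flux_mirror (γ : ℝ) (i : Fin d) (U : State d) :
    flux γ i (mirrorState i U) = -mirrorState i (flux γ i U) := by
  unfold flux
  rw [pressure_mirror, momentum_mirror, velocity_mirror, energy_mirror, mirrorState_apply]
  ext j
  · simp [flipCoord_apply]
  · by_cases h : j = i
    · subst h; simp [flipCoord_apply, add_comm]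
    · simp [flipCoord_apply, h]
  · simp [flipCoord_apply]

lemma entVar_mirror (γ : ℝ) (i : Fin d) (U W : State d) :
    entVar γ (mirrorState i U) (mirrorState i W) = entVar γ U W := by
  rw [entVar_apply, entVar_apply]
  simp [velocity_mirror, momentum_mirror, density_mirror, energy_mirror, specificEntropy_mirror,
    temperature, pressure_mirror]

/-- Reflecting both ξ and x_i exchanges the two sides of an interface. Lower faces, left walls and
gas coming from the right then need no argument of their own. -/
lemma WeakFan.mirror {γ : ℝ} {i : Fin d} {I : Set ℝ} {W : ℝ → State d} (h : WeakFan γ i I W) :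
    WeakFan γ i {ξ | -ξ ∈ I} fun ξ => mirrorState i (W (-ξ)) := by
  have hint : ∀ ξ₁, -ξ₁ ∈ I → ∀ ξ₂, -ξ₂ ∈ I →
      IntervalIntegrable (fun ξ => W (-ξ)) volume ξ₁ ξ₂ := fun a ha b hb => by
    have := (h.integrable _ ha _ hb).comp_sub_left 0
    simpa using this
  refine ⟨fun ξ hξ => ?_, fun a ha b hb => ?_, fun a ha b hb => ?_, fun a ha b hb hab => ?_,
    fun a ha b hb hab => ?_⟩
  · rcases h.admissible _ hξ with h1 | h1
    · exact Or.inl ((isGasState_mirror γ i _).2 h1)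
    · right; simp [h1]
  · exact ⟨(mirrorState i).integrable_comp (hint a ha b hb).1,
      (mirrorState i).integrable_comp (hint a ha b hb).2⟩
  · simp only [entropy_mirror]
    have := (h.entropy_integrable _ ha _ hb).comp_sub_left 0
    simpa using this
  · have h1 := congrArg (mirrorState i) (h.conservation _ hb _ ha (neg_le_neg hab))
    rw [(mirrorState i).intervalIntegral_comp_comm (hint a ha b hb),
      intervalIntegral.integral_comp_neg, flux_mirror, flux_mirror]
    simp only [map_sub, neg_smul, map_neg, map_smul] at h1
    rw [sub_neg_eq_add, neg_add_eq_sub, h1]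
    abel
  · have h1 := h.entropy_inequality _ hb _ ha (neg_le_neg hab)
    simp only [entropy_mirror, entropyFlux_mirror]
    rw [intervalIntegral.integral_comp_neg (fun ξ => entropy γ (W ξ))]
    linarith

/-! #### Entropy production of half of a fan -/

lemma WeakFan.relEnt_intervalIntegrable {γ : ℝ} {i : Fin d} {I : Set ℝ} {W : ℝ → State d}
    (h : WeakFan γ i I W) (U : State d) {a b : ℝ} (ha : a ∈ I) (hb : b ∈ I) :
    IntervalIntegrable (fun ξ => relEnt γ (W ξ) U) volume a b := by
  unfold relEnt
  refine (IntervalIntegrable.add (by simp) ?_).sub (h.entropy_integrable a ha b hb)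
  exact ⟨(entVar γ U).integrable_comp (h.integrable a ha b hb).1,
    (entVar γ U).integrable_comp (h.integrable a ha b hb).2⟩

/-- Integrated form of (Q - ξH)' ≤ -H for the relative flux Q: the conservation law tested with
η'(U), minus the entropy inequality. -/
lemma WeakFan.integral_relEnt_le {γ : ℝ} {i : Fin d} {I : Set ℝ} {W : ℝ → State d}
    (h : WeakFan γ i I W) (U : State d) {a b : ℝ} (ha : a ∈ I) (hb : b ∈ I) (hab : a ≤ b) :
    ∫ ξ in a..b, relEnt γ (W ξ) U ≤ (relFlux γ i (W a) U - a * relEnt γ (W a) U)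
      - (relFlux γ i (W b) U - b * relEnt γ (W b) U) := by
  have h1 := congrArg (entVar γ U) (h.conservation a ha b hb hab)
  have h2 := h.entropy_inequality a ha b hb hab
  have hi := h.integrable a ha b hb
  have hiE : IntervalIntegrable (fun ξ => entVar γ U (W ξ)) volume a b :=
    ⟨(entVar γ U).integrable_comp hi.1, (entVar γ U).integrable_comp hi.2⟩
  have e : ∫ ξ in a..b, relEnt γ (W ξ) U = (b - a) * density U
      + (∫ ξ in a..b, entVar γ U (W ξ)) - ∫ ξ in a..b, entropy γ (W ξ) := by
    unfold relEnt
    rw [intervalIntegral.integral_sub (IntervalIntegrable.add (by simp) hiE)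
      (h.entropy_integrable a ha b hb), intervalIntegral.integral_add (by simp) hiE]
    simp
  rw [e]
  simp only [map_sub, map_smul, smul_eq_mul,
    ← (entVar γ U).intervalIntegral_comp_comm hi] at h1
  unfold relEnt relFlux
  linarith

/-- `W` connects `U` to the value `V` at the interface, for a gas on the left of the interface. -/
structure HalfFan (γ : ℝ) (i : Fin d) (W : ℝ → State d) (U V : State d) : Prop where
  fan : WeakFan γ i (Iic 0) W
  far : ∃ M, 0 ≤ M ∧ ∀ ξ ≤ -M, W ξ = U
  interface : W 0 = V

/-- Conservation on [-M, 0]. At ξ = 0 the term ξ W(ξ) vanishes, so V enters only through its flux.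
-/
lemma HalfFan.flux_sub {γ : ℝ} {i : Fin d} {W : ℝ → State d} {U V : State d}
    (h : HalfFan γ i W U V) {M : ℝ} (hM : 0 ≤ M) (hMU : ∀ ξ ≤ -M, W ξ = U) :
    flux γ i U - flux γ i V = ∫ ξ in (-M)..0, (W ξ - U) := by
  have h1 := h.fan.conservation (-M) (by simpa using hM) 0 (by simp) (by linarith)
  have hi := h.fan.integrable (-M) (by simpa using hM) 0 (by simp)
  rw [hMU _ le_rfl, h.interface] at h1
  rw [intervalIntegral.integral_sub hi (by simp), intervalIntegral.integral_const, ← neg_sub, h1]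
  simp only [zero_smul]
  module

/-- Bounds at an interface (`ς = 1`: upper face, `ς = -1`: lower face) of a cell with value `U`
and interface value `V`, in terms of the entropy production `D`. -/
structure FaceBound (γ : ℝ) (i : Fin d) (C ς : ℝ) (U V : State d) (D : ℝ) : Prop where
  nonneg : 0 ≤ D
  entropy_le : ς * (entropyFlux γ i U - entropyFlux γ i V) + D
    ≤ ς * entVar γ U (flux γ i U - flux γ i V)
  norm_le : ∀ ε > 0, ‖flux γ i U - flux γ i V‖ ≤ C * (ε + D / ε + D)

/-- D is the integral of H(W|U) over the half fan. It bounds the entropy production from below, and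
it controls the integral of W - U, which is the flux difference, through ‖W - U‖ ≤ A(√H + H). The
constant must not depend on M, the extent of the fan; finite speed of propagation ensures this. -/
lemma exists_faceBound {γ : ℝ} (hγ : 1 < γ) (hγ2 : γ ≤ 2) {K : Set (State d)}
    (hK : IsCompact K) (hc : Convex ℝ K) (hgas : ∀ U ∈ K, IsGasState γ U) (i : Fin d) :
    ∃ C, 0 ≤ C ∧ ∀ U ∈ K, ∀ V W, HalfFan γ i W U V → ∃ D, FaceBound γ i C 1 U V D := by
  obtain ⟨B, hB1, hB2, hB⟩ := exists_boundedState hK hgas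
  obtain ⟨c₀, hc₀, Λ, hΛ, hQ⟩ := exists_relFlux_le hγ hγ2 hK hc hgas i
  obtain ⟨A, hA⟩ : ∃ A, A = 9 * B ^ 4 := ⟨_, rfl⟩
  have hA0 : 0 ≤ A := by rw [hA]; positivity
  have hs0 : 0 < √c₀ := Real.sqrt_pos.2 hc₀
  refine ⟨A * (Λ + 1 + (√c₀)⁻¹ + 1), by positivity, fun U hU V W hW => ?_⟩
  have hUg := hgas U hU
  obtain ⟨M₀, hM₀, hM₀U⟩ := hW.far
  set M := max M₀ Λ with hMdef
  have hM : 0 ≤ M := hM₀.trans (le_max_left _ _)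
  have hMU : ∀ ξ ≤ -M, W ξ = U := fun ξ hξ =>
    hM₀U ξ (hξ.trans (neg_le_neg (le_max_left _ _)))
  have hMmem : -M ∈ Iic (0 : ℝ) := by simpa using hM
  have h0mem : (0 : ℝ) ∈ Iic (0 : ℝ) := by simp
  have hH : ∀ ξ ∈ Iic (0 : ℝ), 0 ≤ relEnt γ (W ξ) U := fun ξ hξ =>
    relEnt_nonneg hγ (hW.fan.admissible ξ hξ) hUg
  have hint := hW.fan.relEnt_intervalIntegrable U hMmem h0mem
  -- Integration from the far field, where Q and H vanish, up to ξ gives Q ≤ ξH.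
  have hle : ∀ ξ, -M ≤ ξ → ξ ≤ 0 → 0 ≤ -(relFlux γ i (W ξ) U - ξ * relEnt γ (W ξ) U) := by
    intro ξ h1 h2
    have h3 := hW.fan.integral_relEnt_le U hMmem h2 h1
    rw [hMU _ le_rfl, relEnt_self hγ hUg, relFlux_self hγ i hUg] at h3
    have h4 : 0 ≤ ∫ ξ in (-M)..ξ, relEnt γ (W ξ) U :=
      intervalIntegral.integral_nonneg h1 fun x hx => hH x (hx.2.trans h2)
    linarith
  set D := ∫ ξ in (-M)..0, relEnt γ (W ξ) U with hD
  have hD0 : 0 ≤ D := intervalIntegral.integral_nonneg (by linarith) fun x hx => hH x hx.2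
  refine ⟨D, hD0, ?_, fun ε hε => ?_⟩
  · have h3 := hW.fan.integral_relEnt_le U hMmem h0mem (by linarith)
    rw [hMU _ le_rfl, relEnt_self hγ hUg, relFlux_self hγ i hUg, hW.interface] at h3
    have h4 := relFlux_self hγ i hUg
    unfold relFlux at h3 h4
    rw [map_sub]
    linarith
  -- For ξ < -Λ, the inequalities Q ≤ ξH and |Q| ≤ ΛH leave only H = 0 unless H ≥ c₀, and in that
  -- case √H ≤ H/√c₀. So ε is paid on [-Λ, 0] only.
  · have hpt : ∀ ξ ∈ Icc (-M) 0, ‖W ξ - U‖ ≤ A * (indicator (Ici (-Λ)) (fun _ => ε) ξ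
        + (ε⁻¹ + (√c₀)⁻¹ + 1) * relEnt γ (W ξ) U) := by
      intro ξ hξ
      have hHξ := hH ξ hξ.2
      have h1 := norm_sub_le_relEnt hγ hγ2 hB1 hB2 (hW.fan.admissible ξ hξ.2) (hB U hU)
      rw [← hA] at h1
      refine h1.trans (mul_le_mul_of_nonneg_left ?_ hA0)
      set H := relEnt γ (W ξ) U with hHdef
      have hsq := Real.sq_sqrt hHξ
      have hs := Real.sqrt_nonneg H
      have hcH : 0 ≤ (√c₀)⁻¹ * H := by positivity
      have hεH : 0 ≤ ε⁻¹ * H := by positivity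
      by_cases hξΛ : ξ ∈ Ici (-Λ)
      · rw [indicator_of_mem hξΛ]
        -- Either √H ≤ ε, or √H = H/√H ≤ H/ε.
        have : √H ≤ ε + ε⁻¹ * H := by
          rcases le_total (√H) ε with h | h
          · linarith
          · have h2 : 1 ≤ ε⁻¹ * √H := by
              rw [inv_mul_eq_div, one_le_div hε]; exact h
            have h3 : 1 * √H ≤ ε⁻¹ * √H * √H := by gcongr
            rw [mul_assoc, ← pow_two, hsq] at h3
            linarith
        linarith
      · rw [indicator_of_notMem hξΛ]
        have hξ' : ξ < -Λ := by simpa using hξΛ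
        by_cases hc : H < c₀
        · have h2 := hQ U hU (W ξ) (hW.fan.admissible ξ hξ.2) hc
          have h3 := hle ξ hξ.1 hξ.2
          have h5 : H = 0 := by
            have := (abs_le.1 h2).1
            nlinarith
          rw [h5]; simp
        · have h3 : √H ≤ (√c₀)⁻¹ * H := by
            rw [inv_mul_eq_div, le_div_iff₀ hs0]
            have := Real.sqrt_le_sqrt (not_lt.1 hc)
            nlinarith
          linarith
    have hi1 := (hW.fan.integrable _ hMmem 0 h0mem).sub (intervalIntegrable_const (c := U))
    have hi2 : IntervalIntegrable (indicator (Ici (-Λ)) fun _ => ε) volume (-M) 0 :=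
      ⟨(intervalIntegrable_const.1).indicator measurableSet_Ici,
        (intervalIntegrable_const.2).indicator measurableSet_Ici⟩
    have hi3 : ∫ ξ in (-M)..0, indicator (Ici (-Λ)) (fun _ => ε) ξ ≤ Λ * ε := by
      rw [intervalIntegral.integral_of_le (by linarith), setIntegral_indicator measurableSet_Ici,
        setIntegral_const, smul_eq_mul]
      gcongr
      calc volume.real (Ioc (-M) 0 ∩ Ici (-Λ)) ≤ volume.real (Icc (-Λ) 0) :=
            measureReal_mono (fun x hx => ⟨hx.2, hx.1.2⟩) (by simp)
        _ = Λ := by simp [hΛ]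
    rw [hW.flux_sub hM hMU]
    have hcst : 0 ≤ ε⁻¹ + (√c₀)⁻¹ + 1 := by positivity
    calc ‖∫ ξ in (-M)..0, (W ξ - U)‖ ≤ ∫ ξ in (-M)..0, ‖W ξ - U‖ :=
          intervalIntegral.norm_integral_le_integral_norm (by linarith)
      _ ≤ ∫ ξ in (-M)..0, A * (indicator (Ici (-Λ)) (fun _ => ε) ξ
            + (ε⁻¹ + (√c₀)⁻¹ + 1) * relEnt γ (W ξ) U) :=
          intervalIntegral.integral_mono_on (by linarith) hi1.norm
            ((hi2.add (hint.const_mul _)).const_mul _) hpt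
      _ = A * ((∫ ξ in (-M)..0, indicator (Ici (-Λ)) (fun _ => ε) ξ)
            + (ε⁻¹ + (√c₀)⁻¹ + 1) * D) := by
          rw [intervalIntegral.integral_const_mul, intervalIntegral.integral_add hi2
            (hint.const_mul _), intervalIntegral.integral_const_mul]
      _ ≤ A * (Λ * ε + (ε⁻¹ + (√c₀)⁻¹ + 1) * D) := by gcongr
      _ ≤ A * ((Λ + 1 + (√c₀)⁻¹ + 1) * (ε + D / ε + D)) := by
          have e1 : 0 ≤ D / ε := by positivity
          have e2 : 0 ≤ (√c₀)⁻¹ := by positivity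
          have e3 : ε⁻¹ * D = D / ε := by rw [inv_mul_eq_div]
          gcongr
          rw [add_mul, add_mul, e3]
          nlinarith [mul_nonneg hΛ e1, mul_nonneg hΛ hD0, mul_nonneg e2 hε.le, mul_nonneg e2 e1]
      _ = _ := by ring

/-! #### The minimum entropy principle for fans -/

/-- Mass flux through the ray `x_i = ξ t`. -/
def massFlux (i : Fin d) (W : ℝ → State d) (ξ : ℝ) : ℝ := momentum (W ξ) i - ξ * density (W ξ)

section
variable {γ : ℝ} {i : Fin d} {I : Set ℝ} {W : ℝ → State d}

lemma WeakFan.density_nonneg (h : WeakFan γ i I W) {ξ : ℝ} (hξ : ξ ∈ I) :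
    0 ≤ density (W ξ) := by
  rcases h.admissible ξ hξ with h1 | h1
  · exact h1.1.le
  · simp [h1, density]

lemma WeakFan.density_intervalIntegrable (h : WeakFan γ i I W) {a b : ℝ} (ha : a ∈ I)
    (hb : b ∈ I) : IntervalIntegrable (fun ξ => density (W ξ)) volume a b :=
  ⟨(ContinuousLinearMap.fst ℝ ℝ (Vec d × ℝ)).integrable_comp (h.integrable a ha b hb).1,
    (ContinuousLinearMap.fst ℝ ℝ (Vec d × ℝ)).integrable_comp (h.integrable a ha b hb).2⟩

lemma WeakFan.massFlux_sub (h : WeakFan γ i I W) {a b : ℝ} (ha : a ∈ I) (hb : b ∈ I)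
    (hab : a ≤ b) : massFlux i W b - massFlux i W a = -∫ ξ in a..b, density (W ξ) := by
  have h1 := congrArg (ContinuousLinearMap.fst ℝ ℝ (Vec d × ℝ)) (h.conservation a ha b hb hab)
  simp only [map_sub, map_smul, smul_eq_mul, ← (ContinuousLinearMap.fst ℝ ℝ
    (Vec d × ℝ)).intervalIntegral_comp_comm (h.integrable a ha b hb)] at h1
  have h2 : momentum (W b) i - momentum (W a) i = b * density (W b) - a * density (W a)
    - ∫ ξ in a..b, density (W ξ) := h1
  unfold massFlux
  linarith

lemma WeakFan.massFlux_le (h : WeakFan γ i I W) {a b : ℝ} (ha : a ∈ I) (hb : b ∈ I)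
    (hab : a ≤ b) (hI : I.OrdConnected) : massFlux i W b ≤ massFlux i W a := by
  have h1 := h.massFlux_sub ha hb hab
  have : 0 ≤ ∫ ξ in a..b, density (W ξ) :=
    intervalIntegral.integral_nonneg hab fun x hx => h.density_nonneg (hI.out ha hb hx)
  linarith

lemma WeakFan.massFlux_eq_zero_of_vacuum {ξ : ℝ} (h : W ξ = 0) : massFlux i W ξ = 0 := by
  simp [massFlux, h, momentum, density]

lemma massFlux_mul_specificEntropy (h : WeakFan γ i I W) {ξ : ℝ} (hξ : ξ ∈ I) :
    massFlux i W ξ * specificEntropy γ (W ξ)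
      = entropyFlux γ i (W ξ) - ξ * entropy γ (W ξ) := by
  rcases h.admissible ξ hξ with h1 | h1
  · unfold massFlux entropyFlux
    rw [entropy_eq_mul, momentum_eq h1.1]
    simp
    ring
  · rw [WeakFan.massFlux_eq_zero_of_vacuum h1, h1, zero_entropy, zero_entropyFlux]
    simp

/-- The mass flux g is nonincreasing in ξ, so it is positive on all rays to the left: the gas seen
there comes from U. The entropy inequality says Z' ≤ -f in integrated form, for Z = g(c - s) and f =
ϱ(c - s). As f ≥ 0 wherever Z > 0, Z cannot become positive. -/
lemma WeakFan.le_specificEntropy_of_pos (h : WeakFan γ i I W) {M c ξ : ℝ} {U : State d}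
    (hI : Iic ξ ⊆ I) (hM : ∀ x ≤ -M, W x = U) (hc : c ≤ specificEntropy γ U)
    (hξ : 0 < massFlux i W ξ) : c ≤ specificEntropy γ (W ξ) := by
  by_contra! hlt
  obtain ⟨a, ha1, ha2⟩ : ∃ a, a ≤ ξ ∧ a ≤ -M := ⟨min ξ (-M), min_le_left _ _, min_le_right _ _⟩
  have hmem : ∀ x, x ≤ ξ → x ∈ I := fun x hx => hI hx
  have h' : WeakFan γ i (Iic ξ) W := h.mono hI
  have hg : ∀ x ≤ ξ, 0 < massFlux i W x := fun x hx =>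
    hξ.trans_le (h'.massFlux_le hx (mem_Iic.2 le_rfl) hx ordConnected_Iic)
  set Z : ℝ → ℝ := fun x => massFlux i W x * (c - specificEntropy γ (W x)) with hZ
  set f : ℝ → ℝ := fun x => c * density (W x) - entropy γ (W x) with hf
  have hfi : ∀ x y, x ≤ ξ → y ≤ ξ → IntervalIntegrable f volume x y := fun x y hx hy =>
    ((h.density_intervalIntegrable (hmem x hx) (hmem y hy)).const_mul c).sub
      (h.entropy_integrable x (hmem x hx) y (hmem y hy))
  have hfeq : ∀ x ≤ ξ, f x = density (W x) * (c - specificEntropy γ (W x)) := by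
    intro x _
    simp only [hf, entropy_eq_mul]
    ring
  have hZle : ∀ x y, x ≤ y → y ≤ ξ → Z y ≤ Z x - ∫ t in x..y, f t := by
    intro x y hxy hy
    have hx := hxy.trans hy
    have h1 := h.massFlux_sub (hmem x hx) (hmem y hy) hxy
    have h2 := h.entropy_inequality x (hmem x hx) y (hmem y hy) hxy
    have h3 := massFlux_mul_specificEntropy h (hmem x hx)
    have h4 := massFlux_mul_specificEntropy h (hmem y hy)
    simp only [hZ, hf]
    rw [intervalIntegral.integral_sub
      ((h.density_intervalIntegrable (hmem x hx) (hmem y hy)).const_mul c)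
      (h.entropy_integrable x (hmem x hx) y (hmem y hy)), intervalIntegral.integral_const_mul]
    have h5 : c * massFlux i W y - c * massFlux i W x = -(c * ∫ t in x..y, density (W t)) := by
      rw [← mul_sub, h1]; ring
    linarith
  have hZa : Z a ≤ 0 := by
    simp only [hZ]
    rw [hM a ha2]
    exact mul_nonpos_of_nonneg_of_nonpos (hg a ha1).le (by linarith)
  have hZξ : 0 < Z ξ := mul_pos hξ (by linarith)
  -- Z may jump, so the supremum of S need not belong to S. A point of S close to it suffices, by
  -- continuity of the primitive of f.
  set S : Set ℝ := {x | a ≤ x ∧ x ≤ ξ ∧ Z x ≤ 0} with hS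
  have hSne : S.Nonempty := ⟨a, le_rfl, ha1, hZa⟩
  have hSbdd : BddAbove S := ⟨ξ, fun x hx => hx.2.1⟩
  set τ := sSup S with hτ
  have hτξ : τ ≤ ξ := csSup_le hSne fun x hx => hx.2.1
  have haτ : a ≤ τ := le_csSup hSbdd ⟨le_rfl, ha1, hZa⟩
  have hpos : ∀ x, τ < x → x ≤ ξ → 0 ≤ f x := by
    intro x hx1 hx2
    have h1 : 0 < Z x := by
      by_contra! hn
      exact hx1.not_ge (le_csSup hSbdd ⟨haτ.trans hx1.le, hx2, hn⟩)
    have h2 : 0 < c - specificEntropy γ (W x) := (pos_iff_pos_of_mul_pos h1).1 (hg x hx2)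
    rw [hfeq x hx2]
    exact mul_nonneg (h.density_nonneg (hmem x hx2)) h2.le
  have hint : 0 ≤ ∫ t in τ..ξ, f t := by
    rw [intervalIntegral.integral_of_le hτξ]
    exact setIntegral_nonneg measurableSet_Ioc fun x hx => hpos x hx.1 hx.2
  have hcont : ContinuousOn (fun x => ∫ t in a..x, f t) (Icc a ξ) := by
    have := intervalIntegral.continuousOn_primitive_interval' (hfi a ξ ha1 le_rfl)
      (left_mem_uIcc)
    rwa [uIcc_of_le ha1] at this
  have hev := (hcont τ ⟨haτ, hτξ⟩).eventually (gt_mem_nhds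
    (show ∫ t in a..τ, f t < (∫ t in a..τ, f t) + Z ξ by linarith))
  obtain ⟨δ, hδ, hball⟩ := Metric.mem_nhdsWithin_iff.1 hev
  obtain ⟨x, hxS, hxτ⟩ := exists_lt_of_lt_csSup hSne (show τ - δ < sSup S by linarith)
  have hxle : x ≤ τ := le_csSup hSbdd hxS
  have h1 : ∫ t in a..x, f t < (∫ t in a..τ, f t) + Z ξ := hball
    ⟨by rw [Metric.mem_ball, Real.dist_eq, abs_lt]; constructor <;> linarith, hxS.1, hxS.2.1⟩
  have h2 := hZle x ξ hxS.2.1 le_rfl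
  have h3 := intervalIntegral.integral_add_adjacent_intervals (hfi a x ha1 hxS.2.1)
    (hfi x ξ hxS.2.1 le_rfl)
  have h4 := intervalIntegral.integral_add_adjacent_intervals (hfi a τ ha1 hτξ)
    (hfi τ ξ hτξ le_rfl)
  have h5 := hxS.2.2
  linarith

lemma massFlux_mirror (x : ℝ) :
    massFlux i (fun ξ => mirrorState i (W (-ξ))) x = -massFlux i W (-x) := by
  simp [massFlux, momentum_mirror, density_mirror, flipCoord_apply]
  ring

lemma WeakFan.le_specificEntropy_of_neg (h : WeakFan γ i I W) {M c ξ : ℝ} {U : State d}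
    (hI : Ici ξ ⊆ I) (hM : ∀ x, M ≤ x → W x = U) (hc : c ≤ specificEntropy γ U)
    (hξ : massFlux i W ξ < 0) : c ≤ specificEntropy γ (W ξ) := by
  have := h.mirror.le_specificEntropy_of_pos (M := M) (c := c) (ξ := -ξ) (U := mirrorState i U)
    (fun x hx => hI (by simp only [mem_Iic] at hx; simp only [mem_Ici]; linarith))
    (fun x hx => by rw [hM (-x) (by linarith)]) (by rwa [specificEntropy_mirror])
    (by rw [massFlux_mirror]; simpa using hξ)
  simpa [specificEntropy_mirror] using this

/-- Between two zeros of the mass flux the integral of ϱ is zero, so there is vacuum almost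
everywhere. A single gas ray of zero mass flux, such as a contact discontinuity, disappears in the
null set. -/
lemma WeakFan.ae_vacuum_of_massFlux_eq_zero (h : WeakFan γ i I W) (hI : I.OrdConnected) :
    ∀ᵐ ξ, ξ ∈ I → massFlux i W ξ = 0 → W ξ = 0 := by
  set Z : Set ℝ := {ξ | ξ ∈ I ∧ massFlux i W ξ = 0 ∧ W ξ ≠ 0} with hZ
  have key : ∀ a ∈ Z, ∀ b ∈ Z, a < b → volume (Z ∩ Ioc a b) = 0 := by
    intro a ha b hb hab
    have h1 := h.massFlux_sub ha.1 hb.1 hab.le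
    rw [ha.2.1, hb.2.1, sub_self, eq_comm, neg_eq_zero,
      intervalIntegral.integral_of_le hab.le] at h1
    have h2 := (setIntegral_eq_zero_iff_of_nonneg_ae (ae_restrict_of_forall_mem measurableSet_Ioc
      fun x hx => h.density_nonneg (hI.out ha.1 hb.1 (Ioc_subset_Icc_self hx)))
      (h.density_intervalIntegrable ha.1 hb.1).1).1 h1
    have h3 : ∀ᵐ x, x ∈ Ioc a b → x ∉ Z := by
      filter_upwards [(ae_restrict_iff' measurableSet_Ioc).1 h2] with x hx hxab hxZ
      rcases h.admissible x hxZ.1 with h4 | h4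
      · exact h4.1.ne' (hx hxab)
      · exact hxZ.2.2 h4
    rw [ae_iff] at h3
    convert h3 using 2
    ext x
    simp only [mem_inter_iff, mem_ofPred_eq, Classical.not_imp, not_not]
    tauto
  have hnull : volume Z = 0 := by
    refine measure_null_of_locally_null Z fun x hx => ?_
    obtain ⟨a, hax, ha⟩ : ∃ a < x, volume (Z ∩ Ioc a x) = 0 := by
      by_cases hex : ∃ a ∈ Z, a < x
      · obtain ⟨a, haZ, hax⟩ := hex
        exact ⟨a, hax, key a haZ x hx hax⟩
      · push Not at hex
        refine ⟨x - 1, by linarith, measure_mono_null (t := {x}) (fun y hy => ?_) (by simp)⟩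
        exact le_antisymm hy.2.2 (hex y hy.1)
    obtain ⟨b, hxb, hb⟩ : ∃ b, x < b ∧ volume (Z ∩ Ioo x b) = 0 := by
      by_cases hex : ∃ b ∈ Z, x < b
      · obtain ⟨b, hbZ, hxb⟩ := hex
        exact ⟨b, hxb, measure_mono_null (inter_subset_inter_right _ Ioo_subset_Ioc_self)
          (key x hx b hbZ hxb)⟩
      · push Not at hex
        refine ⟨x + 1, by linarith, measure_mono_null (t := ∅) (fun y hy => ?_) (by simp)⟩
        exact (hex y hy.1).not_gt hy.2.1
    refine ⟨Z ∩ Ioo a b, inter_mem_nhdsWithin _ (Ioo_mem_nhds hax hxb),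
      measure_mono_null (fun y hy => ?_) (measure_union_null ha hb)⟩
    rcases le_or_gt y x with hyx | hyx
    · exact Or.inl ⟨hy.1, hy.2.1, hyx⟩
    · exact Or.inr ⟨hy.1, hyx, hy.2.2⟩
  have : ∀ᵐ x, x ∉ Z := by rw [ae_iff]; simpa using hnull
  filter_upwards [this] with x hx hxI hg
  by_contra hne
  exact hx ⟨hxI, hg, hne⟩

end

/-- The functional η'(U) - s(U)ϱ is ϱ(U) times the derivative of the specific entropy s at U. On
F(U) - F(V) it is the integral over the half fan of H(W|U) + ϱ(W)(s(W) - s(U)), both terms being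
nonnegative. -/
lemma HalfFan.entVar_sub_nonneg {γ : ℝ} (hγ : 1 < γ) {i : Fin d} {W : ℝ → State d} {U V : State d}
    (h : HalfFan γ i W U V) (hU : IsGasState γ U)
    (hs : ∀ᵐ ξ, ξ ∈ Iic (0 : ℝ) → W ξ = 0 ∨ specificEntropy γ U ≤ specificEntropy γ (W ξ)) :
    0 ≤ entVar γ U (flux γ i U - flux γ i V)
      - specificEntropy γ U * density (flux γ i U - flux γ i V) := by
  obtain ⟨M, hM, hMU⟩ := h.far
  set L : State d →L[ℝ] ℝ := entVar γ U
    - specificEntropy γ U • ContinuousLinearMap.fst ℝ ℝ (Vec d × ℝ) with hL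
  have hLa : ∀ X : State d, L X = entVar γ U X - specificEntropy γ U * density X := fun X => by
    simp [hL, density]
  rw [← hLa, h.flux_sub hM hMU]
  have hi := (h.fan.integrable (-M) (by simpa using hM) 0 (by simp)).sub
    (intervalIntegrable_const (c := U))
  rw [← L.intervalIntegral_comp_comm hi, intervalIntegral.integral_of_le (by linarith)]
  refine setIntegral_nonneg_of_ae_restrict ?_
  rw [EventuallyLE, ae_restrict_iff' measurableSet_Ioc]
  filter_upwards [hs] with ξ hξ hmem
  have hξ0 : ξ ∈ Iic (0 : ℝ) := hmem.2
  rw [hLa, Pi.zero_apply, map_sub, entVar_self hγ hU]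
  have h1 := relEnt_nonneg hγ (h.fan.admissible ξ hξ0) hU
  unfold relEnt at h1
  have h2 : density (W ξ - U) = density (W ξ) - density U := rfl
  have h3 : density (W ξ) * specificEntropy γ U ≤ entropy γ (W ξ) := by
    rcases hξ hξ0 with h4 | h4
    · simp [h4, zero_entropy, density]
    · rw [entropy_eq_mul]
      exact mul_le_mul_of_nonneg_left h4 (h.fan.density_nonneg hξ0)
  rw [h2, entropy_eq_mul γ U]
  linarith

/-! #### Riemann problems and walls -/

/-- The sign of the mass flux on a ray tells which datum the gas there comes from; where it is zero
there is vacuum, up to a null set. -/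
lemma IsRiemannState.exists_halfFan {γ : ℝ} {i : Fin d} {U U' V : State d}
    (h : IsRiemannState γ i U U' V) : ∃ W, HalfFan γ i W U V ∧
      ∀ c, c ≤ specificEntropy γ U → c ≤ specificEntropy γ U' →
        ∀ᵐ ξ, ξ ∈ Iic (0 : ℝ) → W ξ = 0 ∨ c ≤ specificEntropy γ (W ξ) := by
  obtain ⟨W, hW, hL, hR, h0⟩ := h
  obtain ⟨a, ha⟩ := eventually_atBot.1 hL
  obtain ⟨b, hb⟩ := eventually_atTop.1 hR
  have hwf := hW.weakFan ordConnected_univ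
  refine ⟨W, ⟨hwf.mono (subset_univ _), ⟨max 0 (-a), le_max_left _ _, fun ξ hξ => ha ξ ?_⟩, h0⟩,
    fun c hc hc' => ?_⟩
  · linarith [le_max_right 0 (-a)]
  · filter_upwards [hwf.ae_vacuum_of_massFlux_eq_zero ordConnected_univ] with ξ hξ _
    rcases lt_trichotomy (massFlux i W ξ) 0 with h1 | h1 | h1
    · exact Or.inr (hwf.le_specificEntropy_of_neg (subset_univ _) hb hc' h1)
    · exact Or.inl (hξ (mem_univ _) h1)
    · exact Or.inr (hwf.le_specificEntropy_of_pos (M := -a) (subset_univ _)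
        (by simpa using ha) hc h1)

lemma IsRightWallState.exists_halfFan {γ : ℝ} {i : Fin d} {U V : State d}
    (h : IsRightWallState γ i U V) : ∃ W, HalfFan γ i W U V ∧
      ∀ c, c ≤ specificEntropy γ U →
        ∀ᵐ ξ, ξ ∈ Iic (0 : ℝ) → W ξ = 0 ∨ c ≤ specificEntropy γ (W ξ) := by
  obtain ⟨W, hW, hL, h0, hV⟩ := h
  obtain ⟨a, ha⟩ := eventually_atBot.1 hL
  have hwf := hW.weakFan ordConnected_Iic
  refine ⟨W, ⟨hwf, ⟨max 0 (-a), le_max_left _ _, fun ξ hξ => ha ξ ?_⟩, h0⟩, fun c hc => ?_⟩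
  · linarith [le_max_right 0 (-a)]
  · filter_upwards [hwf.ae_vacuum_of_massFlux_eq_zero ordConnected_Iic] with ξ hξ hmem
    -- The mass flux is zero at the wall and nonincreasing, hence nonnegative on the gas side: all
    -- gas comes from the datum.
    have h2 : 0 ≤ massFlux i W ξ := by
      have := hwf.massFlux_le hmem (by simp) hmem ordConnected_Iic
      rw [massFlux, h0, hV] at this
      simpa using this
    rcases h2.eq_or_lt with h1 | h1
    · exact Or.inl (hξ hmem h1.symm)
    · exact Or.inr (hwf.le_specificEntropy_of_pos (M := -a) (Iic_subset_Iic.2 hmem)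
        (by simpa using ha) hc h1)

lemma IsFan.mirror {γ : ℝ} {i : Fin d} {I : Set ℝ} {W : ℝ → State d} (h : IsFan γ i I W)
    (hI : I.OrdConnected) : IsFan γ i {ξ | -ξ ∈ I} fun ξ => mirrorState i (W (-ξ)) := by
  have hw := (h.weakFan hI).mirror
  refine ⟨hw.admissible, ?_, hw.entropy_integrable, hw.conservation, hw.entropy_inequality⟩
  obtain ⟨D, hc, hD⟩ := h.piecewise
  have hneg : ∀ (s : ℝ) (A B : Set ℝ), (∀ x ∈ A, -x ∈ B) →
      Tendsto (fun x : ℝ => -x) (𝓝[A] s) (𝓝[B] (-s)) := fun s A B hAB =>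
    tendsto_nhdsWithin_iff.2 ⟨(continuous_neg.tendsto s).mono_left nhdsWithin_le_nhds,
      eventually_nhdsWithin_of_forall hAB⟩
  have hm := (mirrorState i).continuous
  refine ⟨D.image fun x => -x, ?_, fun s hs => ?_⟩
  · refine (mirrorState i).contDiff.comp_contDiffOn (hc.comp contDiff_neg.contDiffOn ?_)
    intro x hx
    refine ⟨hx.1, fun hxD => hx.2 ?_⟩
    rw [Finset.mem_coe, Finset.mem_image]
    exact ⟨-x, hxD, neg_neg x⟩
  · obtain ⟨t, ht, rfl⟩ := Finset.mem_image.1 hs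
    obtain ⟨⟨a, ha⟩, b, hb⟩ := hD t ht
    rw [← neg_neg t] at ha hb
    refine ⟨⟨_, (hm.tendsto b).comp (hb.comp (hneg _ _ _ ?_))⟩,
      ⟨_, (hm.tendsto a).comp (ha.comp (hneg _ _ _ ?_))⟩⟩
    · intro x hx
      refine ⟨hx.1, ?_⟩
      have := hx.2
      simp only [mem_Iio] at this
      simp only [neg_neg, mem_Ioi]; linarith
    · intro x hx
      refine ⟨hx.1, ?_⟩
      have := hx.2
      simp only [mem_Ioi] at this
      simp only [neg_neg, mem_Iio]; linarith

lemma IsRiemannState.mirror {γ : ℝ} {i : Fin d} {U U' V : State d}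
    (h : IsRiemannState γ i U U' V) :
    IsRiemannState γ i (mirrorState i U') (mirrorState i U) (mirrorState i V) := by
  obtain ⟨W, hW, hL, hR, h0⟩ := h
  refine ⟨fun ξ => mirrorState i (W (-ξ)), ?_, ?_, ?_, by simp [h0]⟩
  · have := hW.mirror ordConnected_univ
    simpa using this
  · filter_upwards [tendsto_neg_atBot_atTop.eventually hR] with ξ hξ
    rw [hξ]
  · filter_upwards [tendsto_neg_atTop_atBot.eventually hL] with ξ hξ
    rw [hξ]

lemma IsLeftWallState.mirror {γ : ℝ} {i : Fin d} {U V : State d}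
    (h : IsLeftWallState γ i U V) : IsRightWallState γ i (mirrorState i U) (mirrorState i V) := by
  obtain ⟨W, hW, hR, h0, hV⟩ := h
  refine ⟨fun ξ => mirrorState i (W (-ξ)), ?_, ?_, by simp [h0], ?_⟩
  · have := hW.mirror ordConnected_Ici
    convert this using 1
    ext ξ; simp
  · filter_upwards [tendsto_neg_atBot_atTop.eventually hR] with ξ hξ
    rw [hξ]
  · rw [momentum_mirror, flipCoord_apply]; simp [hV]

/-- The datum is attained by the fan, whose values are gas states or vacuum; positive density
excludes the vacuum. Positivity of the pressure thus comes from the solvability of the Riemann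
problem. -/
lemma IsRiemannState.gas_left {γ : ℝ} {i : Fin d} {U U' V : State d}
    (h : IsRiemannState γ i U U' V) (hU : 0 < density U) : IsGasState γ U := by
  obtain ⟨W, hW, hL, -, -⟩ := h
  obtain ⟨a, ha⟩ := hL.exists
  rcases hW.admissible a (mem_univ a) with h1 | h1
  · rwa [ha] at h1
  · rw [ha] at h1; simp [h1, density] at hU

lemma IsRightWallState.gas {γ : ℝ} {i : Fin d} {U V : State d}
    (h : IsRightWallState γ i U V) (hU : 0 < density U) : IsGasState γ U := by
  obtain ⟨W, hW, hL, -, -⟩ := h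
  obtain ⟨a, ha, ha0⟩ := (hL.and (eventually_le_atBot 0)).exists
  rcases hW.admissible a ha0 with h1 | h1
  · rwa [ha] at h1
  · rw [ha] at h1; simp [h1, density] at hU

/-- Admissible values at the interface on the upper (`ς = 1`) or lower (`ς = -1`) face of a cell
with value `U`, for `U'` the value beyond the face, if any. -/
def IsFaceState (γ : ℝ) (i : Fin d) (ς : ℝ) (U V : State d) (S : Set (State d)) : Prop :=
  (ς = 1 ∧ ((∃ U' ∈ S, IsRiemannState γ i U U' V) ∨ IsRightWallState γ i U V)) ∨
  (ς = -1 ∧ ((∃ U' ∈ S, IsRiemannState γ i U' U V) ∨ IsLeftWallState γ i U V))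

lemma FaceBound.of_mirror {γ : ℝ} {i : Fin d} {C D : ℝ} {U V : State d}
    (h : FaceBound γ i C 1 (mirrorState i U) (mirrorState i V) D) : FaceBound γ i C (-1) U V D := by
  have e : flux γ i (mirrorState i U) - flux γ i (mirrorState i V)
      = -mirrorState i (flux γ i U - flux γ i V) := by
    rw [flux_mirror, flux_mirror, map_sub]; abel
  refine ⟨h.nonneg, ?_, fun ε hε => ?_⟩
  · have := h.entropy_le
    rw [e, map_neg, entVar_mirror, entropyFlux_mirror, entropyFlux_mirror] at this
    linarith
  · have := h.norm_le ε hε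
    rwa [e, norm_neg, norm_mirror] at this

lemma mirrorState_mem_gasBox {γ r R π₀ : ℝ} (hγ : 1 < γ) (hr : 0 < r) (i : Fin d) {U : State d}
    (hU : U ∈ gasBox d γ r R π₀) : mirrorState i U ∈ gasBox d γ r R π₀ := by
  rw [mem_gasBox_iff hγ hr] at hU ⊢
  rwa [density_mirror, norm_mirror, pressure_mirror]

/-- Entropy production and consistency error at the faces of a cell. -/
lemma exists_faceBound_gasBox {γ r R π₀ : ℝ} (hγ : 1 < γ) (hγ2 : γ ≤ 2) (hr : 0 < r)
    (hπ : 0 < π₀) : ∃ C, 0 ≤ C ∧ ∀ (i : Fin d), ∀ U ∈ gasBox d γ r R π₀, ∀ ς V S,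
      IsFaceState γ i ς U V S → ∃ D, FaceBound γ i C ς U V D := by
  choose C hC0 hC using fun i : Fin d => exists_faceBound hγ hγ2 (isCompact_gasBox γ r R π₀)
    (convex_gasBox (d := d) γ r R π₀) (fun U hU => gasBox_gas hγ hr hπ hU) i
  have hCsum : ∀ i, C i ≤ ∑ j, C j := fun i =>
    Finset.single_le_sum (fun j _ => hC0 j) (Finset.mem_univ i)
  refine ⟨∑ j, C j, Finset.sum_nonneg fun j _ => hC0 j, fun i U hU ς V S h => ?_⟩
  have key : ∀ U ∈ gasBox d γ r R π₀, ∀ V W, HalfFan γ i W U V →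
      ∃ D, FaceBound γ i (∑ j, C j) 1 U V D := by
    intro U hU V W hW
    obtain ⟨D, hD⟩ := hC i U hU V W hW
    have hD0 := hD.nonneg
    exact ⟨D, hD.nonneg, hD.entropy_le, fun ε hε => (hD.norm_le ε hε).trans (by
      gcongr; exact hCsum i)⟩
  rcases h with ⟨rfl, ⟨U', -, h⟩ | h⟩ | ⟨rfl, ⟨U', -, h⟩ | h⟩
  · obtain ⟨W, hW, -⟩ := h.exists_halfFan
    exact key U hU V W hW
  · obtain ⟨W, hW, -⟩ := h.exists_halfFan
    exact key U hU V W hW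
  · obtain ⟨W, hW, -⟩ := h.mirror.exists_halfFan
    obtain ⟨D, hD⟩ := key _ (mirrorState_mem_gasBox hγ hr i hU) _ W hW
    exact ⟨D, hD.of_mirror⟩
  · obtain ⟨W, hW, -⟩ := h.mirror.exists_halfFan
    obtain ⟨D, hD⟩ := key _ (mirrorState_mem_gasBox hγ hr i hU) _ W hW
    exact ⟨D, hD.of_mirror⟩

lemma IsFaceState.gas {γ : ℝ} {i : Fin d} {ς : ℝ} {U V : State d} {S : Set (State d)}
    (h : IsFaceState γ i ς U V S) (hU : 0 < density U) : IsGasState γ U := by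
  rcases h with ⟨rfl, ⟨U', -, h⟩ | h⟩ | ⟨rfl, ⟨U', -, h⟩ | h⟩
  · exact h.gas_left hU
  · exact h.gas hU
  · exact (isGasState_mirror γ i U).1 (h.mirror.gas_left hU)
  · exact (isGasState_mirror γ i U).1 (h.mirror.gas hU)

/-- The entropy of a cell with minimal entropy does not decrease. -/
lemma IsFaceState.entVar_sub_nonneg {γ : ℝ} (hγ : 1 < γ) {i : Fin d} {ς : ℝ} {U V : State d}
    {S : Set (State d)} (h : IsFaceState γ i ς U V S) (hU : IsGasState γ U)
    (hS : ∀ U' ∈ S, specificEntropy γ U ≤ specificEntropy γ U') :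
    0 ≤ ς * (entVar γ U (flux γ i U - flux γ i V)
      - specificEntropy γ U * density (flux γ i U - flux γ i V)) := by
  have hmir : ∀ W, HalfFan γ i W (mirrorState i U) (mirrorState i V) →
      (∀ᵐ ξ, ξ ∈ Iic (0 : ℝ) → W ξ = 0 ∨
        specificEntropy γ (mirrorState i U) ≤ specificEntropy γ (W ξ)) →
      0 ≤ (-1) * (entVar γ U (flux γ i U - flux γ i V)
        - specificEntropy γ U * density (flux γ i U - flux γ i V)) := by
    intro W hW hae
    have := hW.entVar_sub_nonneg hγ ((isGasState_mirror γ i U).2 hU) hae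
    have e : flux γ i (mirrorState i U) - flux γ i (mirrorState i V)
        = -mirrorState i (flux γ i U - flux γ i V) := by
      rw [flux_mirror, flux_mirror, map_sub]; abel
    have e2 : ∀ X : State d, density (-X) = -density X := fun X => rfl
    rw [e, map_neg, entVar_mirror, specificEntropy_mirror, e2, density_mirror] at this
    linarith
  rcases h with ⟨rfl, ⟨U', hU', h⟩ | h⟩ | ⟨rfl, ⟨U', hU', h⟩ | h⟩
  · obtain ⟨W, hW, hs⟩ := h.exists_halfFan
    rw [one_mul]
    exact hW.entVar_sub_nonneg hγ hU (hs _ le_rfl (hS U' hU'))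
  · obtain ⟨W, hW, hs⟩ := h.exists_halfFan
    rw [one_mul]
    exact hW.entVar_sub_nonneg hγ hU (hs _ le_rfl)
  · obtain ⟨W, hW, hs⟩ := h.mirror.exists_halfFan
    exact hmir W hW (hs _ le_rfl (by
      rw [specificEntropy_mirror, specificEntropy_mirror]; exact hS U' hU'))
  · obtain ⟨W, hW, hs⟩ := h.mirror.exists_halfFan
    exact hmir W hW (hs _ le_rfl)

/-! ### Calculus on cells -/

lemma cellVolume_pos (K : Cell d) : 0 < cellVolume K :=
  Finset.prod_pos fun j _ => sub_pos.2 (K.lower_lt_upper j)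

lemma faceArea_pos (i : Fin d) (K : Cell d) : 0 < faceArea i K :=
  Finset.prod_pos fun j _ => sub_pos.2 (K.lower_lt_upper j)

lemma width_mul_faceArea (i : Fin d) (K : Cell d) :
    (K.upper i - K.lower i) * faceArea i K = cellVolume K :=
  Finset.mul_prod_erase Finset.univ (fun j => K.upper j - K.lower j) (Finset.mem_univ i)

lemma openCell_eq_preimage (K : Cell d) :
    openCell K = (WithLp.ofLp : Vec d → Fin d → ℝ) ⁻¹'
      (univ.pi fun j => Ioo (K.lower j) (K.upper j)) := by
  ext x; simp [openCell]

lemma closedCell_eq_preimage (K : Cell d) :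
    closedCell K = (WithLp.ofLp : Vec d → Fin d → ℝ) ⁻¹' (Icc K.lower K.upper) := by
  ext x; simp [closedCell, Pi.le_def, forall_and]

lemma isOpen_openCell (K : Cell d) : IsOpen (openCell K) := by
  rw [openCell_eq_preimage]
  exact (isOpen_set_pi finite_univ fun j _ => isOpen_Ioo).preimage (PiLp.continuous_ofLp 2 _)

lemma convex_openCell (K : Cell d) : Convex ℝ (openCell K) := by
  have : openCell K = ⋂ j, {x : Vec d | x j ∈ Ioo (K.lower j) (K.upper j)} := by
    ext x; simp [openCell]
  rw [this]
  refine convex_iInter fun j => ?_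
  exact (convex_Ioo (K.lower j) (K.upper j)).is_linear_preimage
    (EuclideanSpace.proj (𝕜 := ℝ) j).toLinearMap.isLinear

lemma isCompact_closedCell (K : Cell d) : IsCompact (closedCell K) := by
  have : closedCell K = (WithLp.toLp 2 : (Fin d → ℝ) → Vec d) '' Icc K.lower K.upper := by
    rw [closedCell_eq_preimage]
    ext x
    constructor
    · intro hx; exact ⟨_, hx, rfl⟩
    · rintro ⟨y, hy, rfl⟩; exact hy
  rw [this]
  exact isCompact_Icc.image (PiLp.continuous_toLp 2 _)

lemma openCell_subset_closedCell (K : Cell d) : openCell K ⊆ closedCell K :=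
  fun _ hx j => Ioo_subset_Icc_self (hx j)

lemma closedCell_ae_eq_openCell (K : Cell d) : closedCell K =ᵐ[volume] openCell K := by
  rw [openCell_eq_preimage, closedCell_eq_preimage]
  exact ((PiLp.volume_preserving_ofLp (Fin d)).quasiMeasurePreserving.preimage_ae_eq
    (Measure.univ_pi_Ioo_ae_eq_Icc (μ := fun _ : Fin d => (volume : Measure ℝ)))).symm

lemma volume_openCell (K : Cell d) : volume (openCell K) = ENNReal.ofReal (cellVolume K) := by
  rw [openCell_eq_preimage, (PiLp.volume_preserving_ofLp (Fin d)).measure_preimage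
    (MeasurableSet.univ_pi fun j => measurableSet_Ioo).nullMeasurableSet, Real.volume_pi_Ioo,
    cellVolume, ENNReal.ofReal_prod_of_nonneg fun j _ => (sub_pos.2 (K.lower_lt_upper j)).le]

lemma closure_openCell (K : Cell d) : closure (openCell K) = closedCell K := by
  have h := closure_pi_set univ fun j => Ioo (K.lower j) (K.upper j)
  have e := ((PiLp.homeomorph 2 (fun _ : Fin d => ℝ)).preimage_closure
    (univ.pi fun j => Ioo (K.lower j) (K.upper j)))
  have e1 : openCell K = (PiLp.homeomorph 2 (fun _ : Fin d => ℝ)) ⁻¹'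
    (univ.pi fun j => Ioo (K.lower j) (K.upper j)) := openCell_eq_preimage K
  rw [e1, ← e, h]
  ext x
  simp only [mem_preimage, mem_univ_pi, closedCell, mem_ofPred_eq]
  refine forall_congr' fun j => ?_
  rw [closure_Ioo (K.lower_lt_upper j).ne]
  rfl

section Slices
variable {n : ℕ}

/-- The point with `i`-th coordinate `p.1` and other coordinates `p.2`. -/
def insertCoord (i : Fin (n + 1)) (p : ℝ × (Fin n → ℝ)) : Vec (n + 1) :=
  WithLp.toLp 2 (i.insertNth p.1 p.2)

@[simp] lemma insertCoord_same (i : Fin (n + 1)) (p : ℝ × (Fin n → ℝ)) :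
    insertCoord i p i = p.1 := by
  simp [insertCoord]

@[simp] lemma insertCoord_succAbove (i : Fin (n + 1)) (p : ℝ × (Fin n → ℝ)) (j : Fin n) :
    insertCoord i p (i.succAbove j) = p.2 j := by
  simp [insertCoord]

lemma insertCoord_add (i : Fin (n + 1)) (θ s : ℝ) (y : Fin n → ℝ) :
    insertCoord i (θ + s, y) = insertCoord i (θ, y) + s • EuclideanSpace.single i (1 : ℝ) := by
  ext j
  refine Fin.succAboveCases i ?_ (fun k => ?_) j
  · simp
  · simp [Fin.succAbove_ne]

lemma insertCoord_sub (i : Fin (n + 1)) (θ s : ℝ) (y : Fin n → ℝ) :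
    insertCoord i (θ, y) - insertCoord i (s, y)
      = (θ - s) • EuclideanSpace.single i (1 : ℝ) := by
  have := insertCoord_add i s (θ - s) y
  rw [add_sub_cancel] at this
  rw [this, add_sub_cancel_left]

lemma measurePreserving_insertCoord (i : Fin (n + 1)) :
    MeasurePreserving (insertCoord i) volume volume :=
  (PiLp.volume_preserving_toLp (Fin (n + 1))).comp
    (volume_preserving_piFinSuccAbove (fun _ => ℝ) i).symm

lemma measurableEmbedding_insertCoord (i : Fin (n + 1)) :
    MeasurableEmbedding (insertCoord (n := n) i) :=
  (MeasurableEquiv.toLp 2 (Fin (n + 1) → ℝ)).measurableEmbedding.comp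
    (MeasurableEquiv.piFinSuccAbove (fun _ => ℝ) i).symm.measurableEmbedding

lemma continuous_insertCoord (i : Fin (n + 1)) : Continuous (insertCoord (n := n) i) :=
  (PiLp.continuous_toLp 2 _).comp (Continuous.finInsertNth i continuous_fst continuous_snd)

/-- The relative interior of a face. -/
def faceInterior (F : Cell n) : Set (Fin n → ℝ) := {y | ∀ j, y j ∈ Ioo (F.lower j) (F.upper j)}

lemma faceInterior_eq (F : Cell n) :
    faceInterior F = univ.pi fun j => Ioo (F.lower j) (F.upper j) := by
  ext y; simp [faceInterior]

lemma measurableSet_faceInterior (F : Cell n) : MeasurableSet (faceInterior F) := by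
  rw [faceInterior_eq]; exact MeasurableSet.univ_pi fun j => measurableSet_Ioo

lemma volume_faceInterior (i : Fin (n + 1)) (K : Cell (n + 1)) :
    volume (faceInterior (K.face i)) = ENNReal.ofReal (faceArea i K) := by
  rw [faceInterior_eq, Real.volume_pi_Ioo, ← ENNReal.ofReal_prod_of_nonneg fun j _ =>
    (sub_pos.2 ((K.face i).lower_lt_upper j)).le]
  congr 1
  have h1 := width_mul_faceArea i K
  have h2 : K.upper i - K.lower i ≠ 0 := (sub_pos.2 (K.lower_lt_upper i)).ne'
  rw [cellVolume, Fin.prod_univ_succAbove _ i] at h1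
  exact (mul_left_cancel₀ h2 h1).symm

lemma insertCoord_mem_openCell {i : Fin (n + 1)} {K : Cell (n + 1)} {p : ℝ × (Fin n → ℝ)} :
    insertCoord i p ∈ openCell K ↔
      p ∈ Ioo (K.lower i) (K.upper i) ×ˢ faceInterior (K.face i) := by
  simp only [openCell, mem_ofPred_eq, mem_prod, faceInterior, Fin.forall_iff_succAbove i,
    insertCoord_same, insertCoord_succAbove]
  rfl

lemma insertCoord_mem_closedCell {i : Fin (n + 1)} {K : Cell (n + 1)} {p : ℝ × (Fin n → ℝ)}
    (h : p ∈ Icc (K.lower i) (K.upper i) ×ˢ faceInterior (K.face i)) :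
    insertCoord i p ∈ closedCell K := by
  simp only [closedCell, mem_ofPred_eq, Fin.forall_iff_succAbove i,
    insertCoord_same, insertCoord_succAbove]
  exact ⟨h.1, fun j => Ioo_subset_Icc_self (h.2 j)⟩

variable {X : Type*} [NormedAddCommGroup X] [NormedSpace ℝ X]

/-- The integral of `f` over the part `{x_i = c}` of the cylinder above the face `F`. -/
def faceIntegral (i : Fin (n + 1)) (F : Cell n) (c : ℝ) (f : Vec (n + 1) → X) : X :=
  ∫ y in faceInterior F, f (insertCoord i (c, y))

lemma preimage_openCell (i : Fin (n + 1)) (K : Cell (n + 1)) :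
    insertCoord i ⁻¹' openCell K = Ioo (K.lower i) (K.upper i) ×ˢ faceInterior (K.face i) := by
  ext p; exact insertCoord_mem_openCell

omit [NormedSpace ℝ X] in
lemma integrableOn_insertCoord (i : Fin (n + 1)) {K : Cell (n + 1)} {f : Vec (n + 1) → X}
    (hf : IntegrableOn f (openCell K)) : IntegrableOn (fun p => f (insertCoord i p))
      (Ioo (K.lower i) (K.upper i) ×ˢ faceInterior (K.face i)) := by
  have := ((measurePreserving_insertCoord i).integrableOn_comp_preimage
    (measurableEmbedding_insertCoord i) (f := f) (s := openCell K)).2 hf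
  rwa [preimage_openCell] at this

lemma integral_openCell (i : Fin (n + 1)) {K : Cell (n + 1)} {f : Vec (n + 1) → X}
    (hf : IntegrableOn f (openCell K)) :
    ∫ x in openCell K, f x = ∫ y in faceInterior (K.face i),
      ∫ θ in Ioo (K.lower i) (K.upper i), f (insertCoord i (θ, y)) := by
  rw [← (measurePreserving_insertCoord i).setIntegral_preimage_emb
    (measurableEmbedding_insertCoord i), preimage_openCell]
  have h1 := integrableOn_insertCoord i hf
  rw [Measure.volume_eq_prod] at h1 ⊢
  rw [← setIntegral_prod_swap, setIntegral_prod]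
  · rfl
  · exact h1.swap

end Slices

section Slices
variable {n : ℕ}

lemma integrableOn_faceInterior {X : Type*} [NormedAddCommGroup X]
    {f : Vec (n + 1) → X} {K : Cell (n + 1)} (i : Fin (n + 1))
    (hf : ContinuousOn f (closedCell K)) {c : ℝ} (hc : c ∈ Icc (K.lower i) (K.upper i)) :
    IntegrableOn (fun y => f (insertCoord i (c, y))) (faceInterior (K.face i)) := by
  have hmem : ∀ y ∈ faceInterior (K.face i), insertCoord i (c, y) ∈ closedCell K := fun y hy =>
    insertCoord_mem_closedCell ⟨hc, hy⟩
  obtain ⟨C, hC⟩ := (isCompact_closedCell K).exists_bound_of_continuousOn hf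
  refine IntegrableOn.of_bound (C := C) ?_ ?_ ?_
  · rw [volume_faceInterior]; exact ENNReal.ofReal_lt_top
  · have h : ContinuousOn (fun y => f (insertCoord i (c, y))) (faceInterior (K.face i)) :=
      hf.comp ((continuous_insertCoord i).comp (by fun_prop)).continuousOn hmem
    exact h.aestronglyMeasurable (measurableSet_faceInterior _)
  · exact ae_restrict_of_forall_mem (measurableSet_faceInterior _) fun y hy => hC _ (hmem y hy)

lemma integrableOn_openCell {X : Type*} [NormedAddCommGroup X]
    {f : Vec d → X} {K : Cell d} (hf : ContinuousOn f (closedCell K)) :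
    IntegrableOn f (openCell K) :=
  (hf.integrableOn_compact (isCompact_closedCell K)).mono_set (openCell_subset_closedCell K)

lemma lipschitzOnWith_slice {X : Type*} [NormedAddCommGroup X] {f : Vec (n + 1) → X}
    {K : Cell (n + 1)} {L : ℝ≥0} (i : Fin (n + 1)) (hf : LipschitzOnWith L f (closedCell K))
    {y : Fin n → ℝ} (hy : y ∈ faceInterior (K.face i)) :
    LipschitzOnWith L (fun θ => f (insertCoord i (θ, y))) (Icc (K.lower i) (K.upper i)) := by
  refine LipschitzOnWith.of_dist_le_mul fun a ha b hb => ?_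
  refine (hf.dist_le_mul _ (insertCoord_mem_closedCell ⟨ha, hy⟩) _
    (insertCoord_mem_closedCell ⟨hb, hy⟩)).trans_eq ?_
  rw [dist_eq_norm, insertCoord_sub, norm_smul, PiLp.norm_single, norm_one, mul_one,
    dist_eq_norm]

/-- Fundamental theorem of calculus on a cell, for Lipschitz functions. -/
lemma integral_lineDeriv_openCell {f g : Vec (n + 1) → ℝ} {K : Cell (n + 1)} {L : ℝ≥0}
    (i : Fin (n + 1)) (hf : LipschitzOnWith L f (closedCell K)) (hg : IntegrableOn g (openCell K))
    (hd : ∀ᵐ x ∂(volume.restrict (openCell K)),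
      HasLineDerivAt ℝ f (g x) x (EuclideanSpace.single i (1 : ℝ))) :
    ∫ x in openCell K, g x = faceIntegral i (K.face i) (K.upper i) f
      - faceIntegral i (K.face i) (K.lower i) f := by
  have hlu := K.lower_lt_upper i
  have hd1 : ∀ᵐ y ∂(volume.restrict (faceInterior (K.face i))),
      ∀ᵐ θ ∂(volume.restrict (Ioo (K.lower i) (K.upper i))),
        HasLineDerivAt ℝ f (g (insertCoord i (θ, y))) (insertCoord i (θ, y))
          (EuclideanSpace.single i (1 : ℝ)) := by
    have h1 := (((measurePreserving_insertCoord i).restrict_preimage_emb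
      (measurableEmbedding_insertCoord i) (openCell K)).quasiMeasurePreserving).ae hd
    rw [preimage_openCell, Measure.volume_eq_prod, ← Measure.prod_restrict] at h1
    exact Measure.ae_ae_of_ae_prod
      (Measure.measurePreserving_swap.quasiMeasurePreserving.ae h1)
  rw [integral_openCell i hg, faceIntegral, faceIntegral, ← integral_sub
    (integrableOn_faceInterior i hf.continuousOn (right_mem_Icc.2 hlu.le))
    (integrableOn_faceInterior i hf.continuousOn (left_mem_Icc.2 hlu.le))]
  refine integral_congr_ae ?_
  filter_upwards [hd1, ae_restrict_mem (measurableSet_faceInterior _)] with y hy hyF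
  have hlip := lipschitzOnWith_slice i hf hyF
  rw [← uIcc_of_le hlu.le] at hlip
  have := hlip.absolutelyContinuousOnInterval.integral_deriv_eq_sub
  rw [← this, intervalIntegral.integral_of_le hlu.le, integral_Ioc_eq_integral_Ioo]
  refine integral_congr_ae ?_
  filter_upwards [hy] with θ hθ
  have h2 : HasDerivAt (fun t => f (insertCoord i (θ + t, y))) (g (insertCoord i (θ, y)))
      (θ - θ) := by
    rw [sub_self]
    unfold HasLineDerivAt at hθ
    simpa only [insertCoord_add] using hθ
  have h3 := h2.comp_sub_const θ θ
  simp only [add_sub_cancel] at h3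
  exact h3.deriv.symm

/-- On each line in direction i, f varies by at most L times the width of the cell. Integration over
the line gives one more factor of the width, and integration over the face turns it into the volume.
-/
lemma norm_faceIntegral_sub_le {X : Type*} [NormedAddCommGroup X] [NormedSpace ℝ X]
    [CompleteSpace X] {f : Vec (n + 1) → X} {K : Cell (n + 1)} {L : ℝ≥0} (i : Fin (n + 1))
    (hf : LipschitzOnWith L f (closedCell K)) {c : ℝ} (hc : c ∈ Icc (K.lower i) (K.upper i)) :
    ‖(K.upper i - K.lower i) • faceIntegral i (K.face i) c f - ∫ x in openCell K, f x‖
      ≤ L * (K.upper i - K.lower i) * cellVolume K := by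
  have hlu := K.lower_lt_upper i
  have hw : 0 < K.upper i - K.lower i := sub_pos.2 hlu
  have hint := integrableOn_openCell hf.continuousOn
  rw [integral_openCell i hint, faceIntegral, ← integral_smul, ← integral_sub]
  rotate_left
  · exact (integrableOn_faceInterior i hf.continuousOn hc).smul _
  · have h1 := integrableOn_insertCoord i hint
    rw [IntegrableOn, Measure.volume_eq_prod, ← Measure.prod_restrict] at h1
    exact h1.integral_prod_right
  have hb : ∀ y ∈ faceInterior (K.face i), ‖(K.upper i - K.lower i) • f (insertCoord i (c, y))
      - ∫ θ in Ioo (K.lower i) (K.upper i), f (insertCoord i (θ, y))‖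
      ≤ L * (K.upper i - K.lower i) * (K.upper i - K.lower i) := by
    intro y hy
    have hlip := lipschitzOnWith_slice i hf hy
    have h1 : (K.upper i - K.lower i) • f (insertCoord i (c, y))
        = ∫ θ in Ioo (K.lower i) (K.upper i), f (insertCoord i (c, y)) := by
      simp [hw.le]
    have h2 : IntegrableOn (fun θ => f (insertCoord i (θ, y))) (Ioo (K.lower i) (K.upper i)) :=
      (hlip.continuousOn.integrableOn_Icc).mono_set Ioo_subset_Icc_self
    rw [h1, ← integral_sub (by simp) h2]
    refine (norm_setIntegral_le_of_norm_le_const (C := L * (K.upper i - K.lower i)) (by simp)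
      fun θ hθ => ?_).trans ?_
    · rw [← dist_eq_norm]
      refine (hlip.dist_le_mul c hc θ (Ioo_subset_Icc_self hθ)).trans ?_
      gcongr
      rw [Real.dist_eq, abs_le]
      constructor <;> linarith [hc.1, hc.2, hθ.1, hθ.2]
    · simp [hw.le]
  refine (norm_setIntegral_le_of_norm_le_const (by rw [volume_faceInterior]; simp) hb).trans ?_
  rw [Measure.real, volume_faceInterior, ENNReal.toReal_ofReal (faceArea_pos i K).le,
    ← width_mul_faceArea i K]
  apply le_of_eq
  ring

end Slices

/-! ### Meshes -/

lemma openCell_disjoint_or {K L : Cell d}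
    (h : ∀ j, max (K.lower j) (L.lower j) < min (K.upper j) (L.upper j)) :
    ¬ Disjoint (openCell K) (openCell L) := by
  choose x hx using fun j => exists_between (h j)
  rw [Set.not_disjoint_iff]
  refine ⟨WithLp.toLp 2 x, fun j => ?_, fun j => ?_⟩
  · exact ⟨(le_max_left _ _).trans_lt (hx j).1, (hx j).2.trans_le (min_le_left _ _)⟩
  · exact ⟨(le_max_right _ _).trans_lt (hx j).1, (hx j).2.trans_le (min_le_right _ _)⟩

section Mesh
variable {Ω : Set (Vec d)} {𝒯 : Finset (Cell d)}

lemma IsRectMesh.isOpen (h : IsRectMesh Ω 𝒯) : IsOpen Ω := by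
  rw [h.domain_eq]; exact isOpen_interior

lemma IsRectMesh.openCell_subset (h : IsRectMesh Ω 𝒯) {K : Cell d} (hK : K ∈ 𝒯) :
    openCell K ⊆ Ω := by
  rw [h.domain_eq]
  refine interior_maximal ?_ (isOpen_openCell K)
  exact (openCell_subset_closedCell K).trans (subset_biUnion_of_mem (u := closedCell) hK)

lemma IsRectMesh.closedCell_subset (h : IsRectMesh Ω 𝒯) {K : Cell d} (hK : K ∈ 𝒯) :
    closedCell K ⊆ closure Ω := by
  rw [← closure_openCell]; exact closure_mono (h.openCell_subset hK)

lemma IsRectMesh.subset_iUnion (h : IsRectMesh Ω 𝒯) : Ω ⊆ ⋃ K ∈ 𝒯, closedCell K := by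
  conv_lhs => rw [h.domain_eq]
  exact interior_subset

lemma IsRectMesh.ae_eq (h : IsRectMesh Ω 𝒯) : Ω =ᵐ[volume] ⋃ K ∈ 𝒯, openCell K := by
  refine Filter.EventuallyLE.antisymm ?_ (LE.le.eventuallyLE
    (iUnion₂_subset fun K hK => h.openCell_subset hK))
  have h1 : (⋃ K ∈ 𝒯, closedCell K) =ᵐ[volume] ⋃ K ∈ 𝒯, openCell K :=
    Filter.EventuallyEq.countable_bUnion 𝒯.countable_toSet fun K _ => closedCell_ae_eq_openCell K
  exact (LE.le.eventuallyLE h.subset_iUnion).trans h1.le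

lemma IsRectMesh.nonempty (h : IsRectMesh Ω 𝒯) (hΩ : Ω.Nonempty) : 𝒯.Nonempty := by
  by_contra hne
  rw [Finset.not_nonempty_iff_eq_empty] at hne
  have := h.domain_eq
  rw [hne] at this
  simp only [Finset.notMem_empty, iUnion_of_empty, iUnion_empty, interior_empty] at this
  exact hΩ.ne_empty this

lemma IsRectMesh.pairwiseDisjoint (h : IsRectMesh Ω 𝒯) :
    (𝒯 : Set (Cell d)).PairwiseDisjoint openCell :=
  fun K hK L hL hKL => h.disjoint K hK L hL hKL

lemma IsRectMesh.sum_cellVolume (h : IsRectMesh Ω 𝒯) :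
    ENNReal.ofReal (∑ K ∈ 𝒯, cellVolume K) = volume Ω := by
  rw [measure_congr h.ae_eq, measure_biUnion_finset h.pairwiseDisjoint
    fun K _ => (isOpen_openCell K).measurableSet,
    ENNReal.ofReal_sum_of_nonneg fun K _ => (cellVolume_pos K).le]
  exact Finset.sum_congr rfl fun K _ => (volume_openCell K).symm

lemma diam_closedCell_le_meshSize {K : Cell d} (hK : K ∈ 𝒯) :
    Metric.diam (closedCell K) ≤ meshSize 𝒯 := by
  have h := Finset.le_sup (f := fun K : Cell d =>
    (⟨Metric.diam (closedCell K), Metric.diam_nonneg⟩ : ℝ≥0)) hK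
  exact h

lemma width_le_diam (K : Cell d) (i : Fin d) :
    K.upper i - K.lower i ≤ Metric.diam (closedCell K) := by
  have h1 : (WithLp.toLp 2 K.lower : Vec d) ∈ closedCell K := fun j =>
    ⟨le_rfl, (K.lower_lt_upper j).le⟩
  have h2 : (WithLp.toLp 2 K.upper : Vec d) ∈ closedCell K := fun j =>
    ⟨(K.lower_lt_upper j).le, le_rfl⟩
  refine le_trans ?_ (Metric.dist_le_diam_of_mem (isCompact_closedCell K).isBounded h2 h1)
  rw [dist_eq_norm]
  exact (le_abs_self _).trans (PiLp.norm_apply_le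
    ((WithLp.toLp 2 K.upper : Vec d) - WithLp.toLp 2 K.lower) i)

lemma width_le_meshSize {K : Cell d} (hK : K ∈ 𝒯) (i : Fin d) :
    K.upper i - K.lower i ≤ meshSize 𝒯 :=
  (width_le_diam K i).trans (diam_closedCell_le_meshSize hK)

lemma IsRectMesh.meshSize_le (h : IsRectMesh Ω 𝒯) (hΩ : Bornology.IsBounded Ω) :
    meshSize 𝒯 ≤ Metric.diam Ω := by
  have : (𝒯.sup fun K => (⟨Metric.diam (closedCell K), Metric.diam_nonneg⟩ : ℝ≥0))
      ≤ ⟨Metric.diam Ω, Metric.diam_nonneg⟩ := by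
    refine Finset.sup_le fun K hK => ?_
    change Metric.diam (closedCell K) ≤ Metric.diam Ω
    rw [← Metric.diam_closure Ω]
    exact Metric.diam_mono (h.closedCell_subset hK) hΩ.closure
  exact this

/-- Two upper neighbours of K have the same lower face and overlap just above it, so disjointness
identifies them. -/
lemma Adjacent.eq_upper (h : IsRectMesh Ω 𝒯) {i : Fin d} {K L L' : Cell d} (hL : L ∈ 𝒯)
    (hL' : L' ∈ 𝒯) (h1 : Adjacent i K L) (h2 : Adjacent i K L') : L = L' := by
  by_contra hne
  refine openCell_disjoint_or (fun j => ?_) (h.disjoint L hL L' hL' hne)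
  have hj := L.lower_lt_upper j
  have hj' := L'.lower_lt_upper j
  by_cases hji : j = i
  · subst hji
    rw [← h1.1, ← h2.1, max_self]
    exact lt_min (h1.1 ▸ hj) (h2.1 ▸ hj')
  · rw [← (h1.2 j hji).1, ← (h1.2 j hji).2, ← (h2.2 j hji).1, ← (h2.2 j hji).2, max_self, min_self]
    exact K.lower_lt_upper j

lemma Adjacent.eq_lower (h : IsRectMesh Ω 𝒯) {i : Fin d} {K L L' : Cell d} (hL : L ∈ 𝒯)
    (hL' : L' ∈ 𝒯) (h1 : Adjacent i L K) (h2 : Adjacent i L' K) : L = L' := by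
  by_contra hne
  refine openCell_disjoint_or (fun j => ?_) (h.disjoint L hL L' hL' hne)
  have hj := L.lower_lt_upper j
  have hj' := L'.lower_lt_upper j
  by_cases hji : j = i
  · subst hji
    rw [h1.1, h2.1, min_self]
    exact max_lt (h1.1 ▸ hj) (h2.1 ▸ hj')
  · rw [(h1.2 j hji).1, (h1.2 j hji).2, (h2.2 j hji).1, (h2.2 j hji).2, max_self, min_self]
    exact K.lower_lt_upper j

lemma Adjacent.faceArea_eq {i : Fin d} {K L : Cell d} (h : Adjacent i K L) :
    faceArea i K = faceArea i L := by
  refine Finset.prod_congr rfl fun j hj => ?_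
  have := h.2 j (Finset.ne_of_mem_erase hj)
  rw [this.1, this.2]

lemma Adjacent.face_eq {n : ℕ} {i : Fin (n + 1)} {K L : Cell (n + 1)} (h : Adjacent i K L) :
    K.face i = L.face i := by
  have h1 : (K.face i).lower = (L.face i).lower := by
    ext j; exact (h.2 _ (Fin.succAbove_ne i j)).1
  have h2 : (K.face i).upper = (L.face i).upper := by
    ext j; exact (h.2 _ (Fin.succAbove_ne i j)).2
  cases hK : K.face i
  cases hL : L.face i
  rw [hK, hL] at h1 h2
  simp only at h1 h2
  subst h1 h2
  rfl

open Classical in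
/-- Contributions of interior faces cancel. -/
lemma IsRectMesh.sum_faces_eq (h : IsRectMesh Ω 𝒯) (i : Fin d) {lo up : Cell d → ℝ}
    (hadj : ∀ K ∈ 𝒯, ∀ L ∈ 𝒯, Adjacent i K L → up K = lo L)
    (hup : ∀ K ∈ 𝒯, (∀ L ∈ 𝒯, ¬ Adjacent i K L) → up K = 0)
    (hlo : ∀ K ∈ 𝒯, (∀ L ∈ 𝒯, ¬ Adjacent i L K) → lo K = 0) :
    ∑ K ∈ 𝒯, up K = ∑ K ∈ 𝒯, lo K := by
  have h1 : ∀ K ∈ 𝒯, up K = ∑ L ∈ 𝒯, if Adjacent i K L then up K else 0 := by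
    intro K hK
    by_cases hex : ∃ L ∈ 𝒯, Adjacent i K L
    · obtain ⟨L, hL, hKL⟩ := hex
      rw [Finset.sum_eq_single_of_mem L hL, if_pos hKL]
      intro L' hL' hne
      rw [if_neg fun h' => hne (Adjacent.eq_upper h hL' hL h' hKL)]
    · push Not at hex
      rw [hup K hK hex]; simp
  have h2 : ∀ L ∈ 𝒯, lo L = ∑ K ∈ 𝒯, if Adjacent i K L then lo L else 0 := by
    intro L hL
    by_cases hex : ∃ K ∈ 𝒯, Adjacent i K L
    · obtain ⟨K, hK, hKL⟩ := hex
      rw [Finset.sum_eq_single_of_mem K hK, if_pos hKL]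
      intro K' hK' hne
      rw [if_neg fun h' => hne (Adjacent.eq_lower h hK' hK h' hKL)]
    · push Not at hex
      rw [hlo L hL hex]; simp
  rw [Finset.sum_congr rfl h1, Finset.sum_congr rfl h2, Finset.sum_comm]
  refine Finset.sum_congr rfl fun L hL => Finset.sum_congr rfl fun K hK => ?_
  split_ifs with hKL
  · exact hadj K hK L hL hKL
  · rfl

end Mesh

/-! ### Outer normals -/

lemma isOuterNormal_of_halfSpace {Ω : Set (Vec d)} (hΩ : IsOpen Ω) {i : Fin d} {s : ℝ}
    (hs : s = 1 ∨ s = -1) {x : Vec d} {r : ℝ} (hr : 0 < r)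
    (hin : ∀ y ∈ Metric.ball x r, s * (y i - x i) < 0 → y ∈ Ω)
    (hout : ∀ y ∈ Metric.ball x r, 0 < s * (y i - x i) → y ∉ Ω) :
    IsOuterNormal Ω x (s • EuclideanSpace.single i (1 : ℝ)) := by
  have hss : s * s = 1 := by rcases hs with rfl | rfl <;> norm_num
  have hinner : ∀ y : Vec d, inner ℝ (y - x) (s • EuclideanSpace.single i (1 : ℝ))
      = s * (y i - x i) := by
    intro y
    rw [inner_smul_right, EuclideanSpace.inner_single_right]
    simp
  have hline : ∀ c : ℝ, Tendsto (fun t : ℝ => x + (t * c) • EuclideanSpace.single i (1 : ℝ))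
      (𝓝[>] 0) (𝓝 x) := by
    intro c
    have : Continuous fun t : ℝ => x + (t * c) • EuclideanSpace.single i (1 : ℝ) := by fun_prop
    have h := this.tendsto 0
    simp only [zero_mul, zero_smul, add_zero] at h
    exact h.mono_left nhdsWithin_le_nhds
  refine ⟨?_, ?_, fun ε hε => ⟨r, hr, fun y hy => ⟨fun h => hin y hy ?_, fun h => hout y hy ?_⟩⟩⟩
  · rw [frontier, hΩ.interior_eq]
    refine ⟨?_, fun hx => ?_⟩
    · refine mem_closure_of_tendsto (hline (-s)) ?_
      filter_upwards [(hline (-s)).eventually (Metric.ball_mem_nhds x hr),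
        self_mem_nhdsWithin] with t ht ht0
      have ht0 : 0 < t := ht0
      refine hin _ ht ?_
      simp only [PiLp.add_apply, PiLp.smul_apply, PiLp.single_apply, if_true,
        smul_eq_mul, mul_one, add_sub_cancel_left]
      nlinarith
    · have h1 := (hline s).eventually (hΩ.mem_nhds hx)
      have h2 := (hline s).eventually (Metric.ball_mem_nhds x hr)
      obtain ⟨t, ⟨ht1, ht2⟩, ht0⟩ := ((h1.and h2).and self_mem_nhdsWithin).exists
      have ht0 : 0 < t := ht0
      refine hout _ ht2 ?_ ht1
      simp only [PiLp.add_apply, PiLp.smul_apply, PiLp.single_apply, if_true,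
        smul_eq_mul, mul_one, add_sub_cancel_left]
      nlinarith
  · rw [norm_smul, PiLp.norm_single]
    rcases hs with rfl | rfl <;> simp
  · rw [hinner] at h
    have : 0 ≤ ε * ‖y - x‖ := by positivity
    linarith
  · rw [hinner] at h
    have : 0 ≤ ε * ‖y - x‖ := by positivity
    linarith

lemma exists_ball_mem_closedCell (𝒯 : Finset (Cell d)) (x : Vec d) :
    ∃ r > 0, ∀ y ∈ Metric.ball x r, ∀ K ∈ 𝒯, y ∈ closedCell K → x ∈ closedCell K := by
  have : ∀ᶠ y in 𝓝 x, ∀ K ∈ 𝒯, y ∈ closedCell K → x ∈ closedCell K := by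
    rw [Finset.eventually_all]
    intro K _
    by_cases hx : x ∈ closedCell K
    · exact Eventually.of_forall fun _ _ => hx
    · filter_upwards [(isCompact_closedCell K).isClosed.isOpen_compl.mem_nhds hx] with y hy hy'
      exact absurd hy' hy
  obtain ⟨r, hr, h⟩ := Metric.eventually_nhds_iff_ball.1 this
  exact ⟨r, hr, h⟩

lemma exists_ball_coord {K : Cell d} {i : Fin d} {x : Vec d}
    (hx : ∀ j, j ≠ i → x j ∈ Ioo (K.lower j) (K.upper j)) {I : Set ℝ} (hI : IsOpen I)
    (hxI : x i ∈ I) :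
    ∃ r > 0, ∀ y ∈ Metric.ball x r, y i ∈ I ∧ ∀ j, j ≠ i → y j ∈ Ioo (K.lower j) (K.upper j) := by
  have hc : ∀ j, Continuous fun y : Vec d => y j := fun j => by fun_prop
  have h1 : ∀ᶠ y in 𝓝 x, y i ∈ I := (hc i).continuousAt.eventually (hI.mem_nhds hxI)
  have h2 : ∀ᶠ y in 𝓝 x, ∀ j, j ≠ i → y j ∈ Ioo (K.lower j) (K.upper j) := by
    rw [eventually_all]
    intro j
    by_cases hj : j = i
    · exact Eventually.of_forall fun _ h => absurd hj h
    · filter_upwards [(hc j).continuousAt.eventually (isOpen_Ioo.mem_nhds (hx j hj))] with y hy _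
      exact hy
  obtain ⟨r, hr, h⟩ := Metric.eventually_nhds_iff_ball.1 (h1.and h2)
  exact ⟨r, hr, h⟩

section Mesh
variable {Ω : Set (Vec d)} {𝒯 : Finset (Cell d)}

/-- A cell L ≠ K containing a relative interior point of a face of K overlaps that face in positive
area. Either L abuts K, and is a neighbour by conformity, or the two interiors meet; both are
excluded. -/
lemma IsRectMesh.eq_of_mem_closedCell (h : IsRectMesh Ω 𝒯) {K L : Cell d} (hK : K ∈ 𝒯)
    (hL : L ∈ 𝒯) {i : Fin d} {x : Vec d} (hx : ∀ j, j ≠ i → x j ∈ Ioo (K.lower j) (K.upper j))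
    (hxL : x ∈ closedCell L) (hxi : (x i = K.upper i ∧ ∀ L ∈ 𝒯, ¬ Adjacent i K L) ∨
      (x i = K.lower i ∧ ∀ L ∈ 𝒯, ¬ Adjacent i L K)) : L = K := by
  by_contra hne
  have hov : ∀ j, j ≠ i → max (K.lower j) (L.lower j) < min (K.upper j) (L.upper j) := by
    intro j hj
    have h1 := hx j hj
    have h2 := hxL j
    have h3 := L.lower_lt_upper j
    exact max_lt (lt_min (h1.1.trans h1.2) (h1.1.trans_le h2.2))
      (lt_min (h2.1.trans_lt h1.2) h3)
  have hdisj := h.disjoint K hK L hL (Ne.symm hne)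
  have hKi := K.lower_lt_upper i
  have hLi := L.lower_lt_upper i
  have hLx := hxL i
  rcases hxi with ⟨hxi, hno⟩ | ⟨hxi, hno⟩
  · rw [hxi] at hLx
    rcases hLx.1.eq_or_lt with heq | hlt
    · exact hno L hL (h.conforming K hK L hL i heq.symm hov)
    · refine openCell_disjoint_or (fun j => ?_) hdisj
      by_cases hj : j = i
      · subst hj
        rw [min_eq_left hLx.2]
        exact max_lt hKi hlt
      · exact hov j hj
  · rw [hxi] at hLx
    rcases hLx.2.eq_or_lt with heq | hlt
    · refine hno L hL (h.conforming L hL K hK i heq.symm fun j hj => ?_)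
      rw [max_comm, min_comm]
      exact hov j hj
    · refine openCell_disjoint_or (fun j => ?_) hdisj
      by_cases hj : j = i
      · subst hj
        rw [max_eq_left hLx.1]
        exact lt_min hKi hlt
      · exact hov j hj

/-- Just below the face lies K. A point of Ω just above it would lie in a cell which, being closed,
also contains x; that cell is K, a contradiction. This transfers the impermeability of the strong
solution to the wall faces of the mesh. -/
lemma IsRectMesh.isOuterNormal_upper (h : IsRectMesh Ω 𝒯) {K : Cell d} (hK : K ∈ 𝒯) {i : Fin d}
    (hno : ∀ L ∈ 𝒯, ¬ Adjacent i K L) {x : Vec d}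
    (hx : ∀ j, j ≠ i → x j ∈ Ioo (K.lower j) (K.upper j)) (hxi : x i = K.upper i) :
    IsOuterNormal Ω x ((1 : ℝ) • EuclideanSpace.single i (1 : ℝ)) := by
  obtain ⟨r₁, hr₁, h₁⟩ := exists_ball_mem_closedCell 𝒯 x
  obtain ⟨r₂, hr₂, h₂⟩ := exists_ball_coord hx (isOpen_Ioi (a := K.lower i))
    (show x i ∈ Ioi (K.lower i) from hxi ▸ K.lower_lt_upper i)
  refine isOuterNormal_of_halfSpace h.isOpen (Or.inl rfl) (lt_min hr₁ hr₂) (fun y hy hlt => ?_)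
    fun y hy hlt hyΩ => ?_
  · have hy2 := h₂ y (Metric.ball_subset_ball (min_le_right _ _) hy)
    refine h.openCell_subset hK fun j => ?_
    by_cases hj : j = i
    · subst hj
      exact ⟨hy2.1, by linarith⟩
    · exact hy2.2 j hj
  · obtain ⟨L, hL, hyL⟩ := mem_iUnion₂.1 (h.subset_iUnion hyΩ)
    have hxL := h₁ y (Metric.ball_subset_ball (min_le_left _ _) hy) L hL hyL
    have hLK := h.eq_of_mem_closedCell hK hL hx hxL (Or.inl ⟨hxi, hno⟩)
    subst hLK
    have := (hyL i).2
    linarith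

lemma IsRectMesh.isOuterNormal_lower (h : IsRectMesh Ω 𝒯) {K : Cell d} (hK : K ∈ 𝒯) {i : Fin d}
    (hno : ∀ L ∈ 𝒯, ¬ Adjacent i L K) {x : Vec d}
    (hx : ∀ j, j ≠ i → x j ∈ Ioo (K.lower j) (K.upper j)) (hxi : x i = K.lower i) :
    IsOuterNormal Ω x ((-1 : ℝ) • EuclideanSpace.single i (1 : ℝ)) := by
  obtain ⟨r₁, hr₁, h₁⟩ := exists_ball_mem_closedCell 𝒯 x
  obtain ⟨r₂, hr₂, h₂⟩ := exists_ball_coord hx (isOpen_Iio (a := K.upper i))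
    (show x i ∈ Iio (K.upper i) from hxi ▸ K.lower_lt_upper i)
  refine isOuterNormal_of_halfSpace h.isOpen (Or.inr rfl) (lt_min hr₁ hr₂) (fun y hy hlt => ?_)
    fun y hy hlt hyΩ => ?_
  · have hy2 := h₂ y (Metric.ball_subset_ball (min_le_right _ _) hy)
    refine h.openCell_subset hK fun j => ?_
    by_cases hj : j = i
    · subst hj
      exact ⟨by linarith, hy2.1⟩
    · exact hy2.2 j hj
  · obtain ⟨L, hL, hyL⟩ := mem_iUnion₂.1 (h.subset_iUnion hyΩ)
    have hxL := h₁ y (Metric.ball_subset_ball (min_le_left _ _) hy) L hL hyL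
    have hLK := h.eq_of_mem_closedCell hK hL hx hxL (Or.inr ⟨hxi, hno⟩)
    subst hLK
    have := (hyL i).1
    linarith

end Mesh

/-! ### Weak derivatives -/

instance isAddHaarMeasure_volume_spaceTime : (volume : Measure (ℝ × Vec d)).IsAddHaarMeasure := by
  rw [Measure.volume_eq_prod]; infer_instance

section Weak
variable {X : Type*} [NormedAddCommGroup X] [NormedSpace ℝ X] {D : Set (ℝ × Vec d)}
  {f g h : ℝ × Vec d → X} {v w : ℝ × Vec d}

lemma integrable_testFunction {φ : ℝ × Vec d → ℝ} (hφ : ContDiff ℝ ∞ φ)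
    (hc : HasCompactSupport φ) : Integrable φ :=
  hφ.continuous.integrable_of_hasCompactSupport hc

lemma integrable_fderiv_testFunction {φ : ℝ × Vec d → ℝ} (hφ : ContDiff ℝ ∞ φ)
    (hc : HasCompactSupport φ) (v : ℝ × Vec d) : Integrable fun z => fderiv ℝ φ z v := by
  have h1 : Continuous fun z => fderiv ℝ φ z v :=
    (hφ.continuous_fderiv (by simp)).clm_apply continuous_const
  exact h1.integrable_of_hasCompactSupport (hc.fderiv_apply (𝕜 := ℝ) v)

lemma HasWeakDeriv.smul (hf : HasWeakDeriv D f g v) (c : ℝ) :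
    HasWeakDeriv D f (c • g) (c • v) := by
  intro φ hφ hc hs
  have := hf φ hφ hc hs
  simp only [map_smul, Pi.smul_apply, smul_eq_mul, mul_smul, smul_comm (φ _) c]
  rw [integral_smul, integral_smul, this, smul_neg]

lemma integrableOn_testFunction_smul {φ : ℝ × Vec d → ℝ} (hφ : ContDiff ℝ ∞ φ)
    (hc : HasCompactSupport φ) (hg : MemLp g ∞ (volume.restrict D)) :
    IntegrableOn (fun z => φ z • g z) D :=
  (integrable_testFunction hφ hc).integrableOn.smul_of_top_left hg

lemma integrableOn_fderiv_testFunction_smul {φ : ℝ × Vec d → ℝ} (hφ : ContDiff ℝ ∞ φ)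
    (hc : HasCompactSupport φ) (hf : MemLp f ∞ (volume.restrict D)) (v : ℝ × Vec d) :
    IntegrableOn (fun z => fderiv ℝ φ z v • f z) D :=
  (integrable_fderiv_testFunction hφ hc v).integrableOn.smul_of_top_left hf

lemma HasWeakDeriv.add (hf : HasWeakDeriv D f g v) (hf' : HasWeakDeriv D f h w)
    (hfm : MemLp f ∞ (volume.restrict D)) (hg : MemLp g ∞ (volume.restrict D))
    (hh : MemLp h ∞ (volume.restrict D)) : HasWeakDeriv D f (g + h) (v + w) := by
  intro φ hφ hc hs
  have h1 := hf φ hφ hc hs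
  have h2 := hf' φ hφ hc hs
  simp only [map_add, add_smul, Pi.add_apply, smul_add]
  rw [integral_add (integrableOn_fderiv_testFunction_smul hφ hc hfm v)
      (integrableOn_fderiv_testFunction_smul hφ hc hfm w),
    integral_add (integrableOn_testFunction_smul hφ hc hg)
      (integrableOn_testFunction_smul hφ hc hh), h1, h2, neg_add]

lemma HasWeakDeriv.zero : HasWeakDeriv D f 0 0 := by
  intro φ _ _ _
  simp

lemma HasWeakDeriv.sum {ι : Type*} (s : Finset ι) {G : ι → ℝ × Vec d → X}
    {V : ι → ℝ × Vec d} (hf : ∀ k ∈ s, HasWeakDeriv D f (G k) (V k))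
    (hfm : MemLp f ∞ (volume.restrict D)) (hG : ∀ k ∈ s, MemLp (G k) ∞ (volume.restrict D)) :
    HasWeakDeriv D f (∑ k ∈ s, G k) (∑ k ∈ s, V k) := by
  classical
  induction s using Finset.induction_on with
  | empty => simpa using HasWeakDeriv.zero
  | insert a s ha ih =>
    rw [Finset.sum_insert ha, Finset.sum_insert ha]
    refine HasWeakDeriv.add (hf a (Finset.mem_insert_self a s))
      (ih (fun k hk => hf k (Finset.mem_insert_of_mem hk))
        fun k hk => hG k (Finset.mem_insert_of_mem hk)) hfm
      (hG a (Finset.mem_insert_self a s)) ?_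
    exact memLp_finsetSum' s fun k hk => hG k (Finset.mem_insert_of_mem hk)

omit [NormedSpace ℝ X] in
lemma exists_ae_bound (hg : MemLp g ∞ (volume.restrict D)) :
    ∃ C, 0 ≤ C ∧ ∀ᵐ z ∂(volume.restrict D), ‖g z‖ ≤ C := by
  refine ⟨(eLpNorm g ∞ (volume.restrict D)).toReal, ENNReal.toReal_nonneg, ?_⟩
  have h1 := ae_le_eLpNormEssSup (f := g) (μ := volume.restrict D)
  have h2 := hg.eLpNorm_ne_top
  rw [eLpNorm_exponent_top] at h2 ⊢
  filter_upwards [h1] with z hz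
  rw [← toReal_enorm]
  exact ENNReal.toReal_mono h2 hz

/-- The definition gives no uniformity in v. A combination of the weak derivatives in the coordinate
directions is a weak derivative in direction v, bounded by C‖v‖. -/
lemma MemW1inf.exists_bound (hf : MemW1inf D f) :
    ∃ C, 0 ≤ C ∧ ∀ v, ∃ g, HasWeakDeriv D f g v ∧ ∀ᵐ z ∂(volume.restrict D), ‖g z‖ ≤ C * ‖v‖ := by
  obtain ⟨hfm, hd⟩ := hf
  choose G hGm hG using hd
  choose B hB0 hB using fun v => exists_ae_bound (hGm v)
  set e : Option (Fin d) → ℝ × Vec d := fun k =>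
    k.elim (1, 0) fun j => (0, EuclideanSpace.single j (1 : ℝ)) with he
  refine ⟨∑ k, B (e k), Finset.sum_nonneg fun k _ => hB0 _, fun v => ?_⟩
  set c : Option (Fin d) → ℝ := fun k => k.elim v.1 fun j => v.2 j with hc
  have hv : v = ∑ k, c k • e k := by
    rw [Fintype.sum_option]
    simp only [hc, he, Option.elim]
    ext j
    · simp [Prod.fst_sum]
    · simp [Prod.snd_sum, Pi.single_apply]
  have hcv : ∀ k, |c k| ≤ ‖v‖ := by
    rintro (_ | j)
    · exact norm_fst_le v
    · exact (PiLp.norm_apply_le v.2 j).trans (norm_snd_le v)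
  refine ⟨∑ k, c k • G (e k), ?_, ?_⟩
  · conv => arg 4; rw [hv]
    exact HasWeakDeriv.sum _ (fun k _ => (hG (e k)).smul (c k)) hfm
      fun k _ => (hGm (e k)).const_smul (c k)
  · have := ae_all_iff.2 fun k => hB (e k)
    filter_upwards [this] with z hz
    rw [Finset.sum_apply, Finset.sum_mul]
    refine (norm_sum_le _ _).trans (Finset.sum_le_sum fun k _ => ?_)
    rw [Pi.smul_apply, norm_smul, mul_comm]
    exact mul_le_mul (hz k) (hcv k) (abs_nonneg _) (hB0 _)

/-- Mollification near the segment: the derivative of the mollified function along v is a weighted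
mean of g, hence at most C. The mean value inequality applies to it, and continuity of f at the two
end points makes the mollification error less than ε. -/
lemma HasWeakDeriv.norm_sub_le [CompleteSpace X] (hD : IsOpen D) (hfc : ContinuousOn f D)
    (hfm : MemLp f ∞ (volume.restrict D)) (hf : HasWeakDeriv D f g v) {C : ℝ}
    (hC : ∀ᵐ z ∂(volume.restrict D), ‖g z‖ ≤ C) {z : ℝ × Vec d}
    (hz : ∀ θ ∈ Icc (0 : ℝ) 1, z + θ • v ∈ D) : ‖f (z + v) - f z‖ ≤ C := by
  set F : ℝ × Vec d → X := D.indicator f with hF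
  have hFm : MemLp F ∞ volume := (memLp_indicator_iff_restrict hD.measurableSet).2 hfm
  have hFl : LocallyIntegrable F volume := hFm.locallyIntegrable le_top
  have hFeq : ∀ y ∈ D, F y = f y := fun y hy => indicator_of_mem hy f
  set S : Set (ℝ × Vec d) := (fun θ : ℝ => z + θ • v) '' Icc 0 1 with hS
  have hSc : IsCompact S := isCompact_Icc.image (by fun_prop)
  have hSD : S ⊆ D := by rintro _ ⟨θ, hθ, rfl⟩; exact hz θ hθ
  obtain ⟨δ, hδ, hδD⟩ := hSc.exists_cthickening_subset_open hD hSD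
  have hz0 : z ∈ D := by simpa using hz 0 (by simp)
  have hz1 : z + v ∈ D := by simpa using hz 1 (by simp)
  refine le_of_forall_pos_le_add fun ε hε => ?_
  have hnear : ∀ y ∈ D, ∃ r > 0, ∀ x ∈ Metric.ball y r, dist (F x) (F y) ≤ ε / 2 := by
    intro y hy
    have h1 : ContinuousAt F y := (hfc.continuousAt (hD.mem_nhds hy)).congr (by
      filter_upwards [hD.mem_nhds hy] with x hx using (hFeq x hx).symm)
    obtain ⟨r, hr, h⟩ := Metric.continuousAt_iff.1 h1 (ε / 2) (by positivity)
    exact ⟨r, hr, fun x hx => (h hx).le⟩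
  obtain ⟨r₀, hr₀, h₀⟩ := hnear z hz0
  obtain ⟨r₁, hr₁, h₁⟩ := hnear (z + v) hz1
  set r := min δ (min r₀ r₁) with hr
  have hrpos : 0 < r := lt_min hδ (lt_min hr₀ hr₁)
  let ψ : ContDiffBump (0 : ℝ × Vec d) := ⟨r / 2, r, by positivity, by linarith⟩
  set Ψ := ψ.normed volume with hΨ
  have hΨs : ContDiff ℝ ∞ Ψ := ψ.contDiff_normed
  have hΨc : HasCompactSupport Ψ := ψ.hasCompactSupport_normed
  set L := ContinuousLinearMap.lsmul ℝ ℝ (E := X) with hL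
  set c : ℝ × Vec d → X := convolution Ψ F L volume with hc
  have hder : ∀ x, HasFDerivAt c (convolution (fderiv ℝ Ψ) F
      (L.precompL (ℝ × Vec d)) volume x) x := fun x =>
    hΨc.hasFDerivAt_convolution_left L (hΨs.of_le (by simp)) hFl x
  -- The mollifier centred at x ∈ S is an admissible test function: its support stays within δ of
  -- the segment, hence inside D.
  have hbound : ∀ x ∈ S, ‖convolution (fderiv ℝ Ψ) F (L.precompL (ℝ × Vec d)) volume x v‖ ≤ C := by
    intro x hx
    set φ : ℝ × Vec d → ℝ := fun y => Ψ (x - y) with hφ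
    have hφs : ContDiff ℝ ∞ φ := hΨs.comp (contDiff_const.sub contDiff_id)
    have hφc : HasCompactSupport φ := hΨc.comp_homeomorph (Homeomorph.subLeft x)
    have hφd : ∀ y, fderiv ℝ φ y v = -fderiv ℝ Ψ (x - y) v := by
      intro y
      have h1 : HasFDerivAt Ψ (fderiv ℝ Ψ (x - y)) (x - y) :=
        (hΨs.differentiable (by simp)).differentiableAt.hasFDerivAt
      have h2 : HasFDerivAt φ _ y := h1.comp y ((hasFDerivAt_id y).const_sub x)
      rw [h2.fderiv]
      simp
    have hφsupp : tsupport φ ⊆ D := by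
      have h1 : Function.support φ ⊆ Metric.closedBall x r := by
        intro y hy
        have h2 : x - y ∈ Function.support Ψ := hy
        rw [hΨ, ψ.support_normed_eq, mem_ball_zero_iff] at h2
        rw [Metric.mem_closedBall, dist_comm, dist_eq_norm]
        exact h2.le
      refine (closure_minimal h1 Metric.isClosed_closedBall).trans fun y hy => hδD ?_
      exact Metric.mem_cthickening_of_dist_le y x δ S hx
        ((Metric.mem_closedBall.1 hy).trans (min_le_left _ _))
    have hw := hf φ hφs hφc hφsupp
    have hconv : convolution (fderiv ℝ Ψ) F (L.precompL (ℝ × Vec d)) volume x v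
        = ∫ y in D, φ y • g y := by
      have hint : ConvolutionExistsAt (fderiv ℝ Ψ) F x (L.precompL (ℝ × Vec d)) volume :=
        (hΨc.fderiv (𝕜 := ℝ)).convolutionExists_left _ (hΨs.continuous_fderiv (by simp)) hFl x
      rw [convolution, ContinuousLinearMap.integral_apply hint]
      rw [← integral_sub_left_eq_self _ volume x]
      have : ∀ y, (L.precompL (ℝ × Vec d)) (fderiv ℝ Ψ (x - y)) (F (x - (x - y))) v
          = D.indicator (fun y => -(fderiv ℝ φ y v • f y)) y := by
        intro y
        rw [ContinuousLinearMap.precompL_apply, sub_sub_cancel]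
        by_cases hy : y ∈ D
        · rw [indicator_of_mem hy, hφd]
          simp [hF, hy, hL]
        · rw [indicator_of_notMem hy]
          simp [hF, hy, hL]
      simp only [this]
      rw [integral_indicator hD.measurableSet, integral_neg, hw, neg_neg]
    rw [hconv]
    have hφi : Integrable φ := integrable_testFunction hφs hφc
    have hφ0 : ∀ y, 0 ≤ φ y := fun y => ψ.nonneg_normed _
    have hφ1 : ∫ y, φ y = 1 := by
      rw [hφ, integral_sub_left_eq_self Ψ volume x]
      exact ψ.integral_normed
    have hC0 : 0 ≤ C := by
      by_contra hneg
      have hx' : x ∈ D := hSD hx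
      have : ∀ᵐ y ∂(volume.restrict D), False := by
        filter_upwards [hC] with y hy
        linarith [norm_nonneg (g y)]
      rw [ae_iff] at this
      simp only [not_false_eq_true, ofPred_true, Measure.restrict_apply_univ] at this
      exact (hD.measure_pos volume ⟨x, hx'⟩).ne' this
    calc ‖∫ y in D, φ y • g y‖ ≤ ∫ y in D, C * φ y := by
          refine norm_integral_le_of_norm_le (hφi.integrableOn.const_mul C) ?_
          filter_upwards [hC] with y hy
          rw [norm_smul, Real.norm_eq_abs, abs_of_nonneg (hφ0 y), mul_comm]
          exact mul_le_mul_of_nonneg_right hy (hφ0 y)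
      _ = C * ∫ y in D, φ y := integral_const_mul _ _
      _ ≤ C * ∫ y, φ y := by
          exact mul_le_mul_of_nonneg_left
            (setIntegral_le_integral hφi (Eventually.of_forall hφ0)) hC0
      _ = C := by rw [hφ1, mul_one]
  have hmv : ‖c (z + v) - c z‖ ≤ C := by
    have := norm_image_sub_le_of_norm_deriv_le_segment_01' (f := fun θ : ℝ => c (z + θ • v))
      (f' := fun θ => convolution (fderiv ℝ Ψ) F (L.precompL (ℝ × Vec d)) volume (z + θ • v) v)
      (C := C) (fun θ _ => ?_) (fun θ hθ => hbound _ ⟨θ, Ico_subset_Icc_self hθ, rfl⟩)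
    · simpa using this
    · have h1 : HasDerivAt (fun θ : ℝ => z + θ • v) v θ := by
        simpa using ((hasDerivAt_id θ).smul_const v).const_add z
      exact ((hder (z + θ • v)).comp_hasDerivAt θ h1).hasDerivWithinAt
  have hc0 : dist (c z) (F z) ≤ ε / 2 := ψ.dist_normed_convolution_le hFm.aestronglyMeasurable
    fun x hx => h₀ x (Metric.ball_subset_ball ((min_le_right _ _).trans (min_le_left _ _)) hx)
  have hc1 : dist (c (z + v)) (F (z + v)) ≤ ε / 2 :=
    ψ.dist_normed_convolution_le hFm.aestronglyMeasurable
    fun x hx => h₁ x (Metric.ball_subset_ball ((min_le_right _ _).trans (min_le_right _ _)) hx)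
  rw [dist_eq_norm, hFeq z hz0] at hc0
  rw [dist_eq_norm, hFeq _ hz1, ← norm_neg, neg_sub] at hc1
  calc ‖f (z + v) - f z‖
      = ‖(f (z + v) - c (z + v)) + (c (z + v) - c z) + (c z - f z)‖ := by congr 1; abel
    _ ≤ ‖f (z + v) - c (z + v)‖ + ‖c (z + v) - c z‖ + ‖c z - f z‖ := norm_add₃_le
    _ ≤ ε / 2 + C + ε / 2 := by gcongr
    _ = C + ε := by ring

/-- Follows with v = x - y. D need not be convex, so the bound is for convex subsets only, but with
one constant for all of them; this keeps it independent of the mesh. -/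
lemma exists_lipschitzOnWith_of_memW1inf [CompleteSpace X] (hD : IsOpen D)
    (hfc : ContinuousOn f D) (hf : MemW1inf D f) :
    ∃ L : ℝ≥0, ∀ Q : Set (ℝ × Vec d), Convex ℝ Q → Q ⊆ D → LipschitzOnWith L f Q := by
  obtain ⟨C, hC0, hC⟩ := hf.exists_bound
  refine ⟨⟨C, hC0⟩, fun Q hQ hQD => LipschitzOnWith.of_dist_le_mul fun x hx y hy => ?_⟩
  obtain ⟨g, hg, hgC⟩ := hC (x - y)
  have := hg.norm_sub_le hD hfc hf.1 hgC (z := y) fun θ hθ =>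
    hQD (hQ.add_smul_sub_mem hy hx hθ)
  rw [add_sub_cancel] at this
  rw [dist_eq_norm, dist_eq_norm]
  exact this

lemma HasWeakDeriv.comp_clm {Y : Type*} [NormedAddCommGroup Y] [NormedSpace ℝ Y]
    [CompleteSpace X] [CompleteSpace Y] (ℓ : X →L[ℝ] Y) (hf : HasWeakDeriv D f g v)
    (hfm : MemLp f ∞ (volume.restrict D)) (hg : MemLp g ∞ (volume.restrict D)) :
    HasWeakDeriv D (fun z => ℓ (f z)) (fun z => ℓ (g z)) v := by
  intro φ hφ hc hs
  have h1 := congrArg ℓ (hf φ hφ hc hs)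
  rw [map_neg, ← ℓ.integral_comp_comm (integrableOn_fderiv_testFunction_smul hφ hc hfm v),
    ← ℓ.integral_comp_comm (integrableOn_testFunction_smul hφ hc hg)] at h1
  simpa only [map_smul] using h1

/-- Extend f from Q to a globally Lipschitz F. Rademacher's theorem and integration by parts show
that the line derivative of F and g have equal integrals against every test function supported in Q.
-/
lemma HasWeakDeriv.ae_eq_fderiv_real {f g : ℝ × Vec d → ℝ} (hD : MeasurableSet D)
    (hf : HasWeakDeriv D f g v)
    (hg : MemLp g ∞ (volume.restrict D)) {Q : Set (ℝ × Vec d)} (hQ : IsOpen Q)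
    (hQD : Q ⊆ D) {L : ℝ≥0} (hL : LipschitzOnWith L f Q) :
    ∀ᵐ z, z ∈ Q → fderiv ℝ f z v = g z := by
  obtain ⟨F, hF, hFeq⟩ := hL.extend_real
  have hlin : ∀ᵐ z, z ∈ Q → lineDeriv ℝ F z v = fderiv ℝ f z v := by
    filter_upwards [hF.ae_differentiableAt] with z hz hzQ
    have h1 : f =ᶠ[𝓝 z] F := by
      filter_upwards [hQ.mem_nhds hzQ] with y hy using hFeq hy
    rw [h1.fderiv_eq, hz.lineDeriv_eq_fderiv]
  have hFi : LocallyIntegrable (fun z => lineDeriv ℝ F z v) volume :=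
    hF.locallyIntegrable_lineDeriv v
  have hgi : LocallyIntegrable (D.indicator g) volume :=
    ((memLp_indicator_iff_restrict hD).2 hg).locallyIntegrable le_top
  have key := hQ.ae_eq_zero_of_integral_contDiff_smul_eq_zero (μ := volume)
    (f := fun z => lineDeriv ℝ F z v - D.indicator g z)
    ((hFi.sub hgi).locallyIntegrableOn Q) fun φ hφ hc hs => ?_
  · filter_upwards [key, hlin] with z h1 h2 hz
    have := h1 hz
    rw [h2 hz, indicator_of_mem (hQD hz)] at this
    linarith
  · obtain ⟨C', hC'⟩ := hφ.lipschitzWith_of_hasCompactSupport hc (by simp)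
    have h1 := hF.integral_lineDeriv_mul_eq (μ := volume) hC' hc v
    have h2 := hf φ hφ hc (hs.trans hQD)
    have hφc := hφ.continuous
    have i1 : Integrable fun z => φ z • lineDeriv ℝ F z v :=
      hFi.integrable_smul_left_of_hasCompactSupport hφc hc
    have i2 : Integrable fun z => φ z • D.indicator g z :=
      hgi.integrable_smul_left_of_hasCompactSupport hφc hc
    have e1 : ∀ z, lineDeriv ℝ φ z (-v) * F z
        = -D.indicator (fun z => fderiv ℝ φ z v • f z) z := by
      intro z
      rw [(hφ.differentiable (by simp) z).lineDeriv_eq_fderiv, map_neg]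
      by_cases hz : z ∈ tsupport φ
      · rw [indicator_of_mem (hQD (hs hz)), hFeq (hs hz), smul_eq_mul, neg_mul]
      · have h3 : fderiv ℝ φ z = 0 := image_eq_zero_of_notMem_tsupport
          fun h => hz (tsupport_fderiv_subset ℝ h)
        simp [h3, indicator]
    have e2 : ∀ z, φ z • D.indicator g z = D.indicator (fun z => φ z • g z) z := by
      intro z
      by_cases hz : z ∈ D <;> simp [hz]
    have e3 : ∫ z, φ z • lineDeriv ℝ F z v = ∫ z in D, φ z • g z := by
      calc ∫ z, φ z • lineDeriv ℝ F z v = ∫ z, lineDeriv ℝ F z v * φ z := by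
            simp only [smul_eq_mul, mul_comm]
        _ = ∫ z in D, φ z • g z := by
            rw [h1]
            simp only [e1]
            rw [integral_neg, integral_indicator hD, h2, neg_neg]
    simp only [smul_sub]
    rw [integral_sub i1 i2, e3]
    simp only [e2]
    rw [integral_indicator hD, sub_self]

end Weak

lemma HasWeakDeriv.ae_eq_fderiv {X : Type*} [NormedAddCommGroup X] [NormedSpace ℝ X]
    [FiniteDimensional ℝ X] {D : Set (ℝ × Vec d)} {f g : ℝ × Vec d → X} {v : ℝ × Vec d}
    (hD : MeasurableSet D) (hf : HasWeakDeriv D f g v) (hfm : MemLp f ∞ (volume.restrict D))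
    (hg : MemLp g ∞ (volume.restrict D)) {Q : Set (ℝ × Vec d)} (hQ : IsOpen Q)
    (hQD : Q ⊆ D) {L : ℝ≥0} (hL : LipschitzOnWith L f Q) :
    ∀ᵐ z, z ∈ Q → DifferentiableAt ℝ f z ∧ fderiv ℝ f z v = g z := by
  have : CompleteSpace X := FiniteDimensional.complete ℝ X
  set b := Module.finBasis ℝ X
  let ℓ : Fin (Module.finrank ℝ X) → X →L[ℝ] ℝ := fun k => (b.coord k).toContinuousLinearMap
  have h1 : ∀ᵐ z, ∀ k, z ∈ Q → fderiv ℝ (fun z => ℓ k (f z)) z v = ℓ k (g z) :=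
    ae_all_iff.2 fun k => (hf.comp_clm (ℓ k) hfm hg).ae_eq_fderiv_real hD
      ((ℓ k).comp_memLp' hg) hQ hQD ((ℓ k).lipschitz.comp_lipschitzOnWith hL)
  filter_upwards [h1, hL.ae_differentiableWithinAt_of_mem (μ := volume)] with z hz hdz hzQ
  have hd : DifferentiableAt ℝ f z := (hdz hzQ).differentiableAt (hQ.mem_nhds hzQ)
  refine ⟨hd, b.ext_elem fun k => ?_⟩
  have h2 := hz k hzQ
  have h3 : HasFDerivAt (fun z => ℓ k (f z)) _ z := (ℓ k).hasFDerivAt.comp z hd.hasFDerivAt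
  rw [h3.fderiv] at h2
  exact h2

/-! ### Regularity of strong solutions -/

lemma density_stateOf (γ ϱ : ℝ) (u : Vec d) (η : ℝ) : density (stateOf γ ϱ u η) = ϱ := rfl

lemma momentum_stateOf (γ ϱ : ℝ) (u : Vec d) (η : ℝ) : momentum (stateOf γ ϱ u η) = ϱ • u := rfl

lemma velocity_stateOf {γ ϱ : ℝ} (h : 0 < ϱ) (u : Vec d) (η : ℝ) :
    velocity (stateOf γ ϱ u η) = u := by
  rw [velocity, density_stateOf, momentum_stateOf, smul_smul, inv_mul_cancel₀ h.ne', one_smul]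

lemma pressure_stateOf {γ ϱ : ℝ} (hγ : 1 < γ) (h : 0 < ϱ) (u : Vec d) (η : ℝ) :
    pressure γ (stateOf γ ϱ u η) = pressureOf γ ϱ η := by
  have h1 : γ - 1 ≠ 0 := by linarith
  rw [pressure, internalEnergy, velocity_stateOf h, density_stateOf]
  simp only [energy, stateOf]
  field_simp
  ring

lemma isGasState_stateOf {γ ϱ : ℝ} (hγ : 1 < γ) (h : 0 < ϱ) (u : Vec d) (η : ℝ) :
    IsGasState γ (stateOf γ ϱ u η) := by
  refine ⟨h, ?_⟩
  rw [pressure_stateOf hγ h]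
  exact mul_pos (Real.rpow_pos_of_pos h _) (Real.exp_pos _)

lemma entropy_stateOf {γ ϱ : ℝ} (hγ : 1 < γ) (h : 0 < ϱ) (u : Vec d) (η : ℝ) :
    entropy γ (stateOf γ ϱ u η) = η := by
  have h1 : γ - 1 ≠ 0 := by linarith
  have h2 := (Real.rpow_pos_of_pos h γ).ne'
  rw [entropy, pressure_stateOf hγ h, density_stateOf, pressureOf, mul_div_cancel_left₀ _ h2,
    Real.log_exp]
  field_simp

lemma contDiffAt_stateOf (γ : ℝ) {n : WithTop ℕ∞} {y : ℝ × Vec d × ℝ} (hy : 0 < y.1) :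
    ContDiffAt ℝ n (fun y : ℝ × Vec d × ℝ => stateOf γ y.1 y.2.1 y.2.2) y := by
  have h1 : ContDiffAt ℝ n (fun y : ℝ × Vec d × ℝ => y.1) y := contDiffAt_fst
  have h2 : ContDiffAt ℝ n (fun y : ℝ × Vec d × ℝ => y.2.1) y :=
    contDiffAt_fst.comp y contDiffAt_snd
  have h3 : ContDiffAt ℝ n (fun y : ℝ × Vec d × ℝ => y.2.2) y :=
    contDiffAt_snd.comp y contDiffAt_snd
  have h4 : ContDiffAt ℝ n (fun y : ℝ × Vec d × ℝ => pressureOf γ y.1 y.2.2) y :=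
    (h1.rpow_const_of_ne hy.ne').mul
      ((contDiffAt_const.mul h3).div h1 hy.ne').exp
  exact h1.prodMk ((h1.smul h2).prodMk
    (((h1.mul (h2.norm_sq ℝ)).div_const 2).add (h4.div_const _)))

lemma exists_lipschitzOnWith_stateOf (γ : ℝ) {r : ℝ} (hr : 0 < r) (R : ℝ) :
    ∃ L : ℝ≥0, LipschitzOnWith L (fun y : ℝ × Vec d × ℝ => stateOf γ y.1 y.2.1 y.2.2)
      (Icc r R ×ˢ (Metric.closedBall 0 R ×ˢ Icc (-R) R)) := by
  obtain ⟨C, hC0, -, -, hC⟩ := exists_lipschitz_of_contDiffAt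
    (K := Icc r R ×ˢ (Metric.closedBall (0 : Vec d) R ×ˢ Icc (-R) R))
    (isCompact_Icc.prod ((isCompact_closedBall _ _).prod isCompact_Icc))
    ((convex_Icc _ _).prod ((convex_closedBall _ _).prod (convex_Icc _ _)))
    (f := fun y : ℝ × Vec d × ℝ => stateOf γ y.1 y.2.1 y.2.2)
    fun y hy => contDiffAt_stateOf γ (hr.trans_le hy.1.1)
  exact ⟨⟨C, hC0⟩, LipschitzOnWith.of_dist_le_mul fun x hx y hy => by
    rw [dist_eq_norm, dist_eq_norm]; exact hC y hy x hx⟩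

lemma lipschitzOnWith_stateOf_comp {α : Type*} [PseudoEMetricSpace α] {γ : ℝ} {ϱ η : α → ℝ}
    {u : α → Vec d} {Q : Set α} {P : Set (ℝ × Vec d × ℝ)} {L L₁ L₂ L₃ : ℝ≥0}
    (hL : LipschitzOnWith L (fun y : ℝ × Vec d × ℝ => stateOf γ y.1 y.2.1 y.2.2) P)
    (h₁ : LipschitzOnWith L₁ ϱ Q) (h₂ : LipschitzOnWith L₂ u Q) (h₃ : LipschitzOnWith L₃ η Q)
    (hP : MapsTo (fun z => (ϱ z, u z, η z)) Q P) :
    LipschitzOnWith (L * max L₁ (max L₂ L₃)) (fun z => stateOf γ (ϱ z) (u z) (η z)) Q :=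
  LipschitzOnWith.comp (f := fun z => (ϱ z, u z, η z)) hL (h₁.prodMk (h₂.prodMk h₃)) hP

lemma exists_lipschitzOnWith_flux {γ r π₀ : ℝ} (hγ : 1 < γ) (hr : 0 < r) (hπ : 0 < π₀) (R : ℝ) :
    ∃ L : ℝ≥0, ∀ i : Fin d, LipschitzOnWith L (flux γ i) (gasBox d γ r R π₀) ∧
      ∀ U ∈ gasBox d γ r R π₀, ‖flux γ i U‖ ≤ L := by
  have : ∀ i : Fin d, ∃ L : ℝ≥0, LipschitzOnWith L (flux γ i) (gasBox d γ r R π₀) ∧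
      ∀ U ∈ gasBox d γ r R π₀, ‖flux γ i U‖ ≤ L := by
    intro i
    obtain ⟨C, h0, h1, -, h2⟩ := exists_lipschitz_of_contDiffAt (f := flux γ i)
      (isCompact_gasBox (d := d) γ r R π₀) (convex_gasBox _ _ _ _)
      fun U hU => contDiffAt_flux γ i (gasBox_gas hγ hr hπ hU).1.ne'
    exact ⟨⟨C, h0⟩, LipschitzOnWith.of_dist_le_mul fun x hx y hy => by
      rw [dist_eq_norm, dist_eq_norm]; exact h2 y hy x hx, h1⟩
  choose L hL using this
  have hle : ∀ i, L i ≤ ∑ i, L i := fun i =>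
    Finset.single_le_sum (fun _ _ => zero_le) (Finset.mem_univ i)
  exact ⟨∑ i, L i, fun i => ⟨(hL i).1.weaken (hle i), fun U hU =>
    ((hL i).2 U hU).trans (NNReal.coe_le_coe.2 (hle i))⟩⟩

/-- Cellwise regularity of the strong solution `W` of the Euler system: bounds away from vacuum,
Lipschitz continuity up to the boundary of the cell, and the differential equation. -/
structure IsRegularOn (γ T : ℝ) (Ω : Set (Vec d)) (r R π₀ : ℝ) (L : ℝ≥0)
    (W : ℝ × Vec d → State d) : Prop where
  mem_gasBox : ∀ z ∈ Icc 0 T ×ˢ closure Ω, W z ∈ gasBox d γ r R π₀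
  lipschitz : ∀ K : Cell d, openCell K ⊆ Ω → LipschitzOnWith L W (Icc 0 T ×ˢ closedCell K)
  equation : ∀ K : Cell d, openCell K ⊆ Ω → ∀ᵐ z, z ∈ Ioo 0 T ×ˢ openCell K →
    DifferentiableAt ℝ W z ∧ fderiv ℝ W z (1, 0)
      + ∑ i, fderiv ℝ (flux γ i) (W z) (fderiv ℝ W z (0, EuclideanSpace.single i 1)) = 0
  impermeable : ∀ t ∈ Icc 0 T, ∀ x n, IsOuterNormal Ω x n → inner ℝ (velocity (W (t, x))) n = 0

/-- Compactness of the closed cylinder gives the bounds on density, pressure and norm. On the convex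
sets (0,T) × open cell the variables (ϱ, u, η) are Lipschitz, hence so is the state, and continuity
carries this to the closed cell. Weak derivatives then agree with classical ones almost everywhere.
No constant refers to a mesh. -/
theorem IsStrongSolution.exists_isRegularOn {γ T : ℝ} (hγ : 1 < γ) (hT : 0 < T)
    {Ω : Set (Vec d)} (hΩ : IsOpen Ω) (hΩn : Ω.Nonempty) (hΩb : Bornology.IsBounded Ω)
    {ϱ : ℝ × Vec d → ℝ} {u : ℝ × Vec d → Vec d} {η : ℝ × Vec d → ℝ}
    (hs : IsStrongSolution γ T Ω ϱ u η) :
    ∃ r R π₀ : ℝ, ∃ L : ℝ≥0, 0 < r ∧ 0 < π₀ ∧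
      IsRegularOn γ T Ω r R π₀ L fun z => stateOf γ (ϱ z) (u z) (η z) := by
  set W : ℝ × Vec d → State d := fun z => stateOf γ (ϱ z) (u z) (η z) with hW
  set Z : Set (ℝ × Vec d) := Icc 0 T ×ˢ closure Ω with hZ
  set D : Set (ℝ × Vec d) := Ioo 0 T ×ˢ Ω with hDdef
  have hDZ : D ⊆ Z := prod_mono Ioo_subset_Icc_self subset_closure
  have hDo : IsOpen D := isOpen_Ioo.prod hΩ
  have hZc : IsCompact Z := isCompact_Icc.prod
    (Metric.isCompact_of_isClosed_isBounded isClosed_closure hΩb.closure)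
  obtain ⟨x₀, hx₀⟩ := hΩn
  have hZn : Z.Nonempty := ⟨(0, x₀), ⟨le_rfl, hT.le⟩, subset_closure hx₀⟩
  set Y : ℝ × Vec d → ℝ × Vec d × ℝ := fun z => (ϱ z, u z, η z) with hY
  have hYc : ContinuousOn Y Z := hs.cont_density.prodMk (hs.cont_velocity.prodMk hs.cont_entropy)
  have hWc : ContinuousOn W Z := fun z hz =>
    ((contDiffAt_stateOf γ (n := 0) (y := Y z) (hs.density_pos z hz)).continuousAt).comp_continuousWithinAt
      (f := Y) (hYc z hz)
  have hgas : ∀ z ∈ Z, IsGasState γ (W z) := fun z hz =>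
    isGasState_stateOf hγ (hs.density_pos z hz) _ _
  obtain ⟨z₁, hz₁, hr⟩ := hZc.exists_isMinOn hZn hs.cont_density
  have hpc : ContinuousOn (fun z => pressure γ (W z)) Z := fun z hz =>
    ((contDiffAt_pressure γ (n := 0) (hgas z hz).1.ne').continuousAt).comp_continuousWithinAt
      (hWc z hz)
  obtain ⟨z₂, hz₂, hp⟩ := hZc.exists_isMinOn hZn hpc
  obtain ⟨R, hR⟩ := (hZc.image_of_continuousOn hWc).isBounded.exists_norm_le
  obtain ⟨R', hR'⟩ := (hZc.image_of_continuousOn hYc).isBounded.exists_norm_le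
  have hr0 : 0 < ϱ z₁ := hs.density_pos z₁ hz₁
  have hπ0 : 0 < pressure γ (W z₂) := (hgas z₂ hz₂).2
  have hbox : ∀ z ∈ Z, W z ∈ gasBox d γ (ϱ z₁) R (pressure γ (W z₂)) := fun z hz =>
    (mem_gasBox_iff hγ hr0).2 ⟨hr hz, hR _ ⟨z, hz, rfl⟩, hp hz⟩
  -- Lipschitz continuity
  obtain ⟨L₁, hL₁⟩ := exists_lipschitzOnWith_of_memW1inf hDo (hs.cont_density.mono hDZ)
    hs.mem_density
  obtain ⟨L₂, hL₂⟩ := exists_lipschitzOnWith_of_memW1inf hDo (hs.cont_velocity.mono hDZ)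
    hs.mem_velocity
  obtain ⟨L₃, hL₃⟩ := exists_lipschitzOnWith_of_memW1inf hDo (hs.cont_entropy.mono hDZ)
    hs.mem_entropy
  obtain ⟨L₀, hL₀⟩ := exists_lipschitzOnWith_stateOf (d := d) γ hr0 R'
  have hYP : ∀ z ∈ Z, Y z ∈ Icc (ϱ z₁) R' ×ˢ (Metric.closedBall 0 R' ×ˢ Icc (-R') R') := by
    intro z hz
    have h := hR' _ ⟨z, hz, rfl⟩
    have h1 := (norm_fst_le _).trans h
    have h2 := (norm_fst_le _).trans ((norm_snd_le _).trans h)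
    have h3 := (norm_snd_le _).trans ((norm_snd_le _).trans h)
    exact ⟨⟨hr hz, (le_abs_self _).trans h1⟩, mem_closedBall_zero_iff.2 h2, abs_le.1 h3⟩
  have hclosure : ∀ K : Cell d, closure (Ioo 0 T ×ˢ openCell K) = Icc 0 T ×ˢ closedCell K :=
    fun K => by rw [closure_prod_eq, closure_Ioo hT.ne, closure_openCell]
  have hKD : ∀ K : Cell d, openCell K ⊆ Ω → Ioo 0 T ×ˢ openCell K ⊆ D :=
    fun K hK => prod_mono_right hK
  have hKZ : ∀ K : Cell d, openCell K ⊆ Ω → Icc 0 T ×ˢ closedCell K ⊆ Z := fun K hK =>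
    prod_mono_right (closure_openCell K ▸ closure_mono hK)
  have hWo : ∀ K : Cell d, openCell K ⊆ Ω →
      LipschitzOnWith (L₀ * (max L₁ (max L₂ L₃))) W (Ioo 0 T ×ˢ openCell K) := by
    intro K hK
    have hc : Convex ℝ (Ioo 0 T ×ˢ openCell K) := (convex_Ioo _ _).prod (convex_openCell K)
    exact lipschitzOnWith_stateOf_comp hL₀ (hL₁ _ hc (hKD K hK)) (hL₂ _ hc (hKD K hK))
      (hL₃ _ hc (hKD K hK)) fun z hz => hYP z (hDZ (hKD K hK hz))
  obtain ⟨A, B, hAm, hA, hB, hAB⟩ := hs.equation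
  have hWm : MemLp W ∞ (volume.restrict D) :=
    memLp_top_of_bound ((hWc.mono hDZ).aestronglyMeasurable hDo.measurableSet) R
      ((ae_restrict_mem hDo.measurableSet).mono fun z hz => hR _ ⟨z, hDZ hz, rfl⟩)
  obtain ⟨L', hL'⟩ := exists_lipschitzOnWith_flux (d := d) hγ hr0 hπ0 R
  have hFm : ∀ i, MemLp (fun z => flux γ i (W z)) ∞ (volume.restrict D) := fun i => by
    refine memLp_top_of_bound (ContinuousOn.aestronglyMeasurable (fun z hz => ?_) hDo.measurableSet)
      L' ((ae_restrict_mem hDo.measurableSet).mono fun z hz => (hL' i).2 _ (hbox z (hDZ hz)))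
    exact ((contDiffAt_flux γ i (n := 0) (hgas z (hDZ hz)).1.ne').continuousAt).comp_continuousWithinAt
      ((hWc z (hDZ hz)).mono hDZ)
  refine ⟨ϱ z₁, R, pressure γ (W z₂), L₀ * max L₁ (max L₂ L₃), hr0, hπ0, hbox, fun K hK => ?_, fun K hK => ?_, ?_⟩
  · have := (hWo K hK).closure (by rw [hclosure]; exact hWc.mono (hKZ K hK))
    rwa [hclosure] at this
  · have hQo : IsOpen (Ioo 0 T ×ˢ openCell K) := isOpen_Ioo.prod (isOpen_openCell K)
    have e1 := hA.ae_eq_fderiv hDo.measurableSet hWm hAm hQo (hKD K hK) (hWo K hK)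
    have e2 : ∀ᵐ z, ∀ i, z ∈ Ioo 0 T ×ˢ openCell K →
        fderiv ℝ (fun z => flux γ i (W z)) z (0, EuclideanSpace.single i 1) = B i z := by
      refine ae_all_iff.2 fun i => ?_
      have h2 := (hL' i).1.comp (hWo K hK) fun z hz => hbox z (hDZ (hKD K hK hz))
      filter_upwards [(hB i).2.ae_eq_fderiv hDo.measurableSet (hFm i) (hB i).1 hQo (hKD K hK) h2]
        with z hz hzQ using (hz hzQ).2
    have e3 := (ae_restrict_iff' hDo.measurableSet).1 hAB
    filter_upwards [e1, e2, e3] with z h1 h2 h3 hz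
    refine ⟨(h1 hz).1, ?_⟩
    rw [(h1 hz).2, ← h3 (hKD K hK hz)]
    congr 1
    refine Finset.sum_congr rfl fun i _ => ?_
    have hF : DifferentiableAt ℝ (flux γ i) (W z) :=
      (contDiffAt_flux γ i (n := 1) (hgas z (hDZ (hKD K hK hz))).1.ne').differentiableAt (by simp)
    have h4 : HasFDerivAt (fun z => flux γ i (W z)) _ z :=
      hF.hasFDerivAt.comp z (h1 hz).1.hasFDerivAt
    rw [← h2 i hz, h4.fderiv]
    rfl
  · intro t ht x n hn
    rw [hW, velocity_stateOf (hs.density_pos _ ⟨ht, hn.1.1⟩)]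
    exact hs.impermeable t ht x n hn

/-! ### The Godunov method, cell by cell -/

/-- The balance on each cell: `dU` is the time derivative for the cell values `W`, where `Vp i K`
and `Vm i K` are the states at the upper and lower face of `K` in direction `i`. -/
structure IsGodunovStep (γ : ℝ) (𝒯 : Finset (Cell d)) (W dU : Cell d → State d)
    (Vp Vm : Fin d → Cell d → State d) : Prop where
  balance : ∀ K ∈ 𝒯, cellVolume K • dU K
    = ∑ i, faceArea i K • (flux γ i (Vm i K) - flux γ i (Vp i K))
  upper : ∀ i, ∀ K ∈ 𝒯, IsFaceState γ i 1 (W K) (Vp i K) (W '' 𝒯)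
  lower : ∀ i, ∀ K ∈ 𝒯, IsFaceState γ i (-1) (W K) (Vm i K) (W '' 𝒯)
  adjacent : ∀ i, ∀ K ∈ 𝒯, ∀ L ∈ 𝒯, Adjacent i K L → Vp i K = Vm i L
  wall_upper : ∀ i, ∀ K ∈ 𝒯, (∀ L ∈ 𝒯, ¬ Adjacent i K L) → momentum (Vp i K) i = 0
  wall_lower : ∀ i, ∀ K ∈ 𝒯, (∀ L ∈ 𝒯, ¬ Adjacent i L K) → momentum (Vm i K) i = 0

variable {γ T : ℝ} {Ω : Set (Vec d)} {𝒯 : Finset (Cell d)}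

open Classical in
-- Summation by parts over the interior faces; adjacent cells give the same area to their common
-- face.
lemma sum_adjacent_smul_sub {X : Type*} [AddCommGroup X] [Module ℝ X] (i : Fin d)
    (𝒯 : Finset (Cell d)) (φ : Cell d → ℝ) (f : Cell d → Cell d → X) :
    ∑ K ∈ 𝒯, ∑ L ∈ 𝒯 with Adjacent i K L, (faceArea i K * (φ L - φ K)) • f K L
      = ∑ K ∈ 𝒯, (faceArea i K * φ K) • ∑ L ∈ 𝒯 with Adjacent i L K, f L K
        - ∑ K ∈ 𝒯, (faceArea i K * φ K) • ∑ L ∈ 𝒯 with Adjacent i K L, f K L := by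
  simp_rw [mul_sub, sub_smul, Finset.sum_sub_distrib, Finset.smul_sum]
  congr 1
  rw [Finset.sum_comm' (t' := 𝒯) (s' := fun L => 𝒯.filter fun K => Adjacent i K L)
    (by intro K L; simp only [Finset.mem_filter]; tauto)]
  refine Finset.sum_congr rfl fun L _ => Finset.sum_congr rfl fun K hK => ?_
  rw [(Finset.mem_filter.1 hK).2.faceArea_eq]

/-- A face of a cell has at most one cell beyond it, so interface states may be indexed by cell and
direction, with walls treated alike. -/
lemma IsGodunovSolution.exists_step (hm : IsRectMesh Ω 𝒯) {U₀ : Vec d → State d}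
    {U : Cell d → ℝ → State d} (h : IsGodunovSolution γ T 𝒯 U₀ U) {t : ℝ} (ht : t ∈ Icc 0 T) :
    ∃ dU Vp Vm, (∀ K ∈ 𝒯, HasDerivWithinAt (U K) (dU K) (Icc 0 T) t) ∧
      IsGodunovStep γ 𝒯 (fun K => U K t) dU Vp Vm := by
  classical
  obtain ⟨dU, V, Vr, Vl, hd, hV, hVr, hVl, hs⟩ := h.scheme t ht
  let Vp : Fin d → Cell d → State d := fun i K =>
    if h : ∃ L ∈ 𝒯, Adjacent i K L then V i K h.choose else Vr i K
  let Vm : Fin d → Cell d → State d := fun i K =>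
    if h : ∃ L ∈ 𝒯, Adjacent i L K then V i h.choose K else Vl i K
  have hVp : ∀ i, ∀ K ∈ 𝒯, ∀ L ∈ 𝒯, Adjacent i K L → Vp i K = V i K L := by
    intro i K _ L hL hKL
    have h : ∃ L ∈ 𝒯, Adjacent i K L := ⟨L, hL, hKL⟩
    simp only [Vp, dif_pos h]
    rw [Adjacent.eq_upper hm h.choose_spec.1 hL h.choose_spec.2 hKL]
  have hVm : ∀ i, ∀ K ∈ 𝒯, ∀ L ∈ 𝒯, Adjacent i L K → Vm i K = V i L K := by
    intro i K _ L hL hKL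
    have h : ∃ L ∈ 𝒯, Adjacent i L K := ⟨L, hL, hKL⟩
    simp only [Vm, dif_pos h]
    rw [Adjacent.eq_lower hm h.choose_spec.1 hL h.choose_spec.2 hKL]
  have hVp' : ∀ i, ∀ K, (∀ L ∈ 𝒯, ¬ Adjacent i K L) → Vp i K = Vr i K := by
    intro i K h
    simp only [Vp]
    rw [dif_neg (by push Not; exact h)]
  have hVm' : ∀ i, ∀ K, (∀ L ∈ 𝒯, ¬ Adjacent i L K) → Vm i K = Vl i K := by
    intro i K h
    simp only [Vm]
    rw [dif_neg (by push Not; exact h)]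
  refine ⟨dU, Vp, Vm, hd, ?_, ?_, ?_, ?_, ?_, ?_⟩
  · intro K₀ hK₀
    have hup : ∀ i, (∑ L ∈ 𝒯 with Adjacent i K₀ L, flux γ i (V i K₀ L))
        + (if ∀ L ∈ 𝒯, ¬ Adjacent i K₀ L then flux γ i (Vr i K₀) else 0)
        = flux γ i (Vp i K₀) := by
      intro i
      by_cases h : ∀ L ∈ 𝒯, ¬ Adjacent i K₀ L
      · rw [if_pos h, Finset.filter_false_of_mem h, Finset.sum_empty, zero_add, hVp' i K₀ h]
      · rw [if_neg h, add_zero]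
        push Not at h
        obtain ⟨L, hL, hKL⟩ := h
        rw [Finset.sum_eq_single_of_mem L (Finset.mem_filter.2 ⟨hL, hKL⟩), hVp i K₀ hK₀ L hL hKL]
        intro L' hL' hne
        obtain ⟨hL', hKL'⟩ := Finset.mem_filter.1 hL'
        exact (hne (Adjacent.eq_upper hm hL' hL hKL' hKL)).elim
    have hlo : ∀ i, (∑ L ∈ 𝒯 with Adjacent i L K₀, flux γ i (V i L K₀))
        + (if ∀ L ∈ 𝒯, ¬ Adjacent i L K₀ then flux γ i (Vl i K₀) else 0)
        = flux γ i (Vm i K₀) := by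
      intro i
      by_cases h : ∀ L ∈ 𝒯, ¬ Adjacent i L K₀
      · rw [if_pos h, Finset.filter_false_of_mem h, Finset.sum_empty, zero_add, hVm' i K₀ h]
      · rw [if_neg h, add_zero]
        push Not at h
        obtain ⟨L, hL, hKL⟩ := h
        rw [Finset.sum_eq_single_of_mem L (Finset.mem_filter.2 ⟨hL, hKL⟩), hVm i K₀ hK₀ L hL hKL]
        intro L' hL' hne
        obtain ⟨hL', hKL'⟩ := Finset.mem_filter.1 hL'
        exact (hne (Adjacent.eq_lower hm hL' hL hKL' hKL)).elim
    -- Testing with the indicator of a single cell isolates its balance.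
    have h0 := hs fun K => if K = K₀ then 1 else 0
    simp only [sum_adjacent_smul_sub] at h0
    simp only [mul_ite, mul_one, mul_zero, ite_smul, zero_smul, Finset.sum_filter,
      Finset.sum_ite_eq', hK₀, if_true] at h0
    simp only [← Finset.sum_filter] at h0
    simp only [Finset.mem_filter, hK₀, true_and, Finset.sum_filter, Finset.sum_sub_distrib] at h0
    simp only [← hup, ← hlo, smul_sub, smul_add, Finset.sum_sub_distrib, Finset.sum_add_distrib,
      smul_ite, smul_zero, Finset.sum_filter]
    rw [← sub_eq_zero]
    refine Eq.trans ?_ h0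
    abel
  · intro i K hK
    refine Or.inl ⟨rfl, ?_⟩
    by_cases h : ∀ L ∈ 𝒯, ¬ Adjacent i K L
    · right; rw [hVp' i K h]; exact hVr i K hK h
    · push Not at h
      obtain ⟨L, hL, hKL⟩ := h
      left; rw [hVp i K hK L hL hKL]
      exact ⟨_, ⟨L, hL, rfl⟩, hV i K hK L hL hKL⟩
  · intro i K hK
    refine Or.inr ⟨rfl, ?_⟩
    by_cases h : ∀ L ∈ 𝒯, ¬ Adjacent i L K
    · right; rw [hVm' i K h]; exact hVl i K hK h
    · push Not at h
      obtain ⟨L, hL, hKL⟩ := h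
      left; rw [hVm i K hK L hL hKL]
      exact ⟨_, ⟨L, hL, rfl⟩, hV i L hL K hK hKL⟩
  · intro i K hK L hL hKL
    rw [hVp i K hK L hL hKL, hVm i L hL K hK hKL]
  · intro i K hK h
    rw [hVp' i K h]
    obtain ⟨_, _, _, _, h0⟩ := hVr i K hK h
    exact h0
  · intro i K hK h
    rw [hVm' i K h]
    obtain ⟨_, _, _, _, h0⟩ := hVl i K hK h
    exact h0

variable {W dU : Cell d → State d} {Vp Vm : Fin d → Cell d → State d}

lemma entropyFlux_eq_zero_of_momentum {i : Fin d} {V : State d} (h : momentum V i = 0) :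
    entropyFlux γ i V = 0 := by
  simp [entropyFlux, velocity, h]

/-- Entropy production of a step, given lower bounds for the production at the faces. -/
lemma IsGodunovStep.entropy_production (h : IsGodunovStep γ 𝒯 W dU Vp Vm) (hm : IsRectMesh Ω 𝒯)
    {C : ℝ} {Dp Dm : Fin d → Cell d → ℝ}
    (hp : ∀ i, ∀ K ∈ 𝒯, FaceBound γ i C 1 (W K) (Vp i K) (Dp i K))
    (hn : ∀ i, ∀ K ∈ 𝒯, FaceBound γ i C (-1) (W K) (Vm i K) (Dm i K)) :
    ∑ i, ∑ K ∈ 𝒯, faceArea i K * (Dp i K + Dm i K)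
      ≤ ∑ K ∈ 𝒯, cellVolume K * entVar γ (W K) (dU K) := by
  have h1 : ∀ K ∈ 𝒯, cellVolume K * entVar γ (W K) (dU K)
      = ∑ i, faceArea i K * entVar γ (W K) (flux γ i (Vm i K) - flux γ i (Vp i K)) := by
    intro K hK
    rw [← smul_eq_mul, ← map_smul, h.balance K hK, map_sum]
    simp only [map_smul, smul_eq_mul]
  -- The numerical entropy fluxes cancel in the sum over cells, so they may be inserted to match the
  -- bounds at the individual faces.
  have h2 : ∀ i, ∑ K ∈ 𝒯, faceArea i K * entropyFlux γ i (Vp i K)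
      = ∑ K ∈ 𝒯, faceArea i K * entropyFlux γ i (Vm i K) := by
    intro i
    refine hm.sum_faces_eq i (fun K hK L hL hKL => ?_) (fun K hK hw => ?_) fun K hK hw => ?_
    · rw [h.adjacent i K hK L hL hKL, hKL.faceArea_eq]
    · rw [entropyFlux_eq_zero_of_momentum (h.wall_upper i K hK hw), mul_zero]
    · rw [entropyFlux_eq_zero_of_momentum (h.wall_lower i K hK hw), mul_zero]
  rw [Finset.sum_congr rfl h1, Finset.sum_comm (s := 𝒯)]
  refine Finset.sum_le_sum fun i _ => ?_
  have h3 : ∑ K ∈ 𝒯, (faceArea i K * (Dp i K + Dm i K))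
      = ∑ K ∈ 𝒯, faceArea i K * (Dp i K + Dm i K
        + (entropyFlux γ i (Vm i K) - entropyFlux γ i (Vp i K))) := by
    simp only [mul_add, mul_sub, Finset.sum_add_distrib, Finset.sum_sub_distrib, h2 i]
    ring
  rw [h3]
  refine Finset.sum_le_sum fun K hK => mul_le_mul_of_nonneg_left ?_ (faceArea_pos i K).le
  have h4 := (hp i K hK).entropy_le
  have h5 := (hn i K hK).entropy_le
  simp only [map_sub] at h4 h5 ⊢
  linarith

lemma IsGodunovStep.argmin_nonneg (hγ : 1 < γ) (h : IsGodunovStep γ 𝒯 W dU Vp Vm) {K : Cell d}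
    (hK : K ∈ 𝒯) (hg : IsGasState γ (W K))
    (hmin : ∀ L ∈ 𝒯, specificEntropy γ (W K) ≤ specificEntropy γ (W L)) :
    0 ≤ entVar γ (W K) (dU K) - specificEntropy γ (W K) * density (dU K) := by
  have hS : ∀ U' ∈ W '' (𝒯 : Set (Cell d)), specificEntropy γ (W K) ≤ specificEntropy γ U' := by
    rintro _ ⟨L, hL, rfl⟩; exact hmin L hL
  set Λ : State d →L[ℝ] ℝ := entVar γ (W K)
    - specificEntropy γ (W K) • ContinuousLinearMap.fst ℝ ℝ (Vec d × ℝ) with hΛ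
  have hΛa : ∀ X, Λ X = entVar γ (W K) X - specificEntropy γ (W K) * density X := fun X => rfl
  rw [← hΛa]
  refine nonneg_of_mul_nonneg_right ?_ (cellVolume_pos K)
  rw [← smul_eq_mul, ← map_smul, h.balance K hK, map_sum]
  refine Finset.sum_nonneg fun i _ => ?_
  rw [map_smul]
  refine mul_nonneg (faceArea_pos i K).le ?_
  have h1 := (h.upper i K hK).entVar_sub_nonneg hγ hg hS
  have h2 := (h.lower i K hK).entVar_sub_nonneg hγ hg hS
  rw [← hΛa] at h1 h2
  simp only [map_sub] at h1 h2 ⊢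
  linarith

/-! ### The minimum entropy principle -/

/-- A finite family of functions whose minimum cannot decrease. -/
lemma le_of_deriv_nonneg_at_argmin {ι : Type*} {s : Finset ι} {f f' : ι → ℝ → ℝ} {c : ℝ}
    (hd : ∀ k ∈ s, ∀ t ∈ Icc 0 T, HasDerivWithinAt (f k) (f' k t) (Icc 0 T) t)
    (hmin : ∀ t ∈ Icc 0 T, ∀ k ∈ s, (∀ l ∈ s, f k t ≤ f l t) → 0 ≤ f' k t)
    (h0 : ∀ k ∈ s, c ≤ f k 0) {k : ι} (hk : k ∈ s) {t : ℝ} (ht : t ∈ Icc 0 T) : c ≤ f k t := by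
  refine le_of_forall_pos_le_add fun ε hε => ?_
  obtain ⟨δ, hδ, hδε⟩ : ∃ δ > 0, δ * t ≤ ε := by
    refine ⟨ε / (t + 1), div_pos hε (by linarith [ht.1]), ?_⟩
    rw [div_mul_eq_mul_div, div_le_iff₀ (by linarith [ht.1])]
    nlinarith
  -- The added slope excludes a minimum at a positive time: difference quotients from the left would
  -- be nonpositive there, while the derivative is at least δ.
  set g : ι → ℝ → ℝ := fun k t => f k t + δ * t with hg
  have hgd : ∀ k ∈ s, ∀ x ∈ Icc 0 T, HasDerivWithinAt (g k) (f' k x + δ) (Icc 0 T) x :=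
    fun k hk x hx => (hd k hk x hx).add (by simpa using (hasDerivWithinAt_id x _).const_mul δ)
  have h1 : ∀ k ∈ s, ∃ x ∈ Icc 0 T, IsMinOn (g k) (Icc 0 T) x := fun k hk =>
    isCompact_Icc.exists_isMinOn ⟨t, ht⟩ fun x hx => (hgd k hk x hx).continuousWithinAt
  choose! x hx hxmin using h1
  obtain ⟨l, hl, hlmin⟩ := s.exists_min_image (fun k => g k (x k)) ⟨k, hk⟩
  have hle : ∀ k ∈ s, ∀ y ∈ Icc 0 T, g l (x l) ≤ g k y := fun k hk y hy =>
    (hlmin k hk).trans (hxmin k hk hy)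
  suffices hx0 : x l = 0 by
    have h2 := hle k hk t ht
    rw [hx0] at h2
    have h3 := h0 l hl
    simp only [hg] at h2
    linarith
  by_contra hne
  have hpos : 0 < x l := lt_of_le_of_ne (hx l hl).1 (Ne.symm hne)
  have h2 : 0 ≤ f' l (x l) := hmin _ (hx l hl) l hl fun k hk => by
    have := hle k hk _ (hx l hl)
    simp only [hg] at this
    linarith
  have h3 : HasDerivWithinAt (g l) (f' l (x l) + δ) (Icc 0 (x l)) (x l) :=
    (hgd l hl _ (hx l hl)).mono (Icc_subset_Icc_right (hx l hl).2)
  rw [hasDerivWithinAt_iff_tendsto_slope] at h3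
  have h4 : Icc 0 (x l) \ {x l} = Ico 0 (x l) := Icc_sdiff_right
  rw [h4] at h3
  have : (𝓝[Ico 0 (x l)] (x l)).NeBot := by
    rw [← mem_closure_iff_nhdsWithin_neBot, closure_Ico hpos.ne]
    exact ⟨hpos.le, le_rfl⟩
  obtain ⟨y, hy, hys⟩ := ((h3.eventually (lt_mem_nhds (show 0 < f' l (x l) + δ by linarith))).and
    self_mem_nhdsWithin).exists
  rw [slope_def_field] at hy
  have h5 := hle l hl y ⟨hys.1, hys.2.le.trans (hx l hl).2⟩
  have h6 := div_nonpos_of_nonneg_of_nonpos (sub_nonneg.2 h5) (sub_nonpos.2 hys.2.le)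
  linarith

lemma specificEntropy_eq_div {U : State d} (h : 0 < density U) :
    specificEntropy γ U = entropy γ U / density U := by
  rw [entropy_eq_mul, mul_div_cancel_left₀ _ h.ne']

lemma hasDerivWithinAt_entropy (hγ : 1 < γ) {U : ℝ → State d} {U' : State d} {s : Set ℝ} {t : ℝ}
    (hg : IsGasState γ (U t)) (h : HasDerivWithinAt U U' s t) :
    HasDerivWithinAt (fun t => entropy γ (U t)) (entVar γ (U t) U') s t :=
  (hasFDerivAt_entropy hγ hg).comp_hasDerivWithinAt t h

lemma hasDerivWithinAt_specificEntropy (hγ : 1 < γ) {U : ℝ → State d} {U' : State d} {s : Set ℝ}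
    {t : ℝ} (ht : t ∈ s) (hg : ∀ t ∈ s, IsGasState γ (U t)) (h : HasDerivWithinAt U U' s t) :
    HasDerivWithinAt (fun t => specificEntropy γ (U t))
      ((entVar γ (U t) U' - specificEntropy γ (U t) * density U') / density (U t)) s t := by
  have h1 : HasDerivWithinAt (fun t => density (U t)) (density U') s t :=
    (ContinuousLinearMap.fst ℝ ℝ (Vec d × ℝ)).hasFDerivAt.comp_hasDerivWithinAt t h
  have h2 := (hasDerivWithinAt_entropy hγ (hg t ht) h).div h1 (hg t ht).1.ne'
  refine (h2.congr (fun x hx => specificEntropy_eq_div (hg x hx).1)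
    (specificEntropy_eq_div (hg t ht).1)).congr_deriv ?_
  have := (hg t ht).1.ne'
  rw [entropy_eq_mul]
  field_simp

/-- At a cell of minimal specific entropy all neighbouring data have at least that entropy, so its
time derivative is nonnegative by `IsGodunovStep.argmin_nonneg`. -/
lemma IsGodunovSolution.le_specificEntropy (hγ : 1 < γ) (hm : IsRectMesh Ω 𝒯)
    {U₀ : Vec d → State d} {U : Cell d → ℝ → State d} (h : IsGodunovSolution γ T 𝒯 U₀ U)
    (hg : ∀ t ∈ Icc 0 T, ∀ K ∈ 𝒯, IsGasState γ (U K t)) {c : ℝ}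
    (h0 : ∀ K ∈ 𝒯, c ≤ specificEntropy γ (U K 0)) {K : Cell d} (hK : K ∈ 𝒯) {t : ℝ}
    (ht : t ∈ Icc 0 T) : c ≤ specificEntropy γ (U K t) := by
  choose! dU Vp Vm hd hs using fun t (ht : t ∈ Icc 0 T) => h.exists_step hm ht
  refine le_of_deriv_nonneg_at_argmin (f := fun K t => specificEntropy γ (U K t))
    (fun K hK t ht => hasDerivWithinAt_specificEntropy hγ ht (fun t ht => hg t ht K hK)
      (hd t ht K hK)) (fun t ht K hK hmin => ?_) h0 hK ht
  exact div_nonneg ((hs t ht).argmin_nonneg hγ hK (hg t ht K hK) hmin) (hg t ht K hK).1.le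

/-- Jensen's inequality for the entropy. -/
lemma le_specificEntropy_average (hγ : 1 < γ) {K : Cell d} {f : Vec d → State d} {c : ℝ}
    (hf : IntegrableOn f (openCell K)) (hg : ∀ x ∈ openCell K, IsGasState γ (f x))
    (hc : ∀ x ∈ openCell K, c ≤ specificEntropy γ (f x))
    (ha : IsGasState γ (⨍ x in openCell K, f x)) :
    c ≤ specificEntropy γ (⨍ x in openCell K, f x) := by
  set A := ⨍ x in openCell K, f x with hA
  have hKm : MeasurableSet (openCell K) := (isOpen_openCell K).measurableSet
  have hvol : volume.real (openCell K) = cellVolume K := by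
    rw [Measure.real, volume_openCell, ENNReal.toReal_ofReal (cellVolume_pos K).le]
  set Λ : State d →L[ℝ] ℝ := entVar γ A - c • ContinuousLinearMap.fst ℝ ℝ (Vec d × ℝ) with hΛ
  -- The tangent of η at the average A lies above η, and η ≥ cϱ along f. So a linear functional of f
  -- x is bounded below, and its mean is its value at A.
  have h1 : ∀ x ∈ openCell K, -density A ≤ Λ (f x) := by
    intro x hx
    have h2 := relEnt_nonneg hγ (Or.inl (hg x hx)) ha
    rw [relEnt, entropy_eq_mul] at h2
    have h3 := mul_le_mul_of_nonneg_left (hc x hx) (hg x hx).1.le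
    change -density A ≤ entVar γ A (f x) - c * density (f x)
    linarith
  have hint : IntegrableOn (fun _ : Vec d => -density A) (openCell K) :=
    integrableOn_const (by rw [volume_openCell]; exact ENNReal.ofReal_ne_top)
  have h2 : ∫ _ in openCell K, -density A ≤ ∫ x in openCell K, Λ (f x) :=
    setIntegral_mono_on hint (Λ.integrable_comp hf) hKm h1
  have h3 : ∫ x in openCell K, Λ (f x) = cellVolume K * Λ A := by
    rw [Λ.integral_comp_comm hf, hA, setAverage_eq, map_smul, smul_eq_mul, hvol,
      mul_inv_cancel_left₀ (cellVolume_pos K).ne']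
  rw [h3, setIntegral_const, hvol, smul_eq_mul] at h2
  have h4 := le_of_mul_le_mul_left h2 (cellVolume_pos K)
  have h5 : Λ A = entVar γ A A - c * density A := rfl
  rw [h5, entVar_self hγ ha, entropy_eq_mul] at h4
  have h6 : 0 ≤ density A * (specificEntropy γ A - c) := by linarith
  exact sub_nonneg.1 (nonneg_of_mul_nonneg_right h6 ha.1)

/-! ### A priori bounds: one compact set for all meshes. -/

lemma gasBox_mono (hγ : 1 < γ) {r r' R R' π₀ π₁ : ℝ} (hr' : 0 < r') (hr : r' ≤ r) (hR : R ≤ R')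
    (hπ : π₁ ≤ π₀) : gasBox d γ r R π₀ ⊆ gasBox d γ r' R' π₁ := by
  intro U hU
  rw [mem_gasBox_iff hγ (hr'.trans_le hr)] at hU
  rw [mem_gasBox_iff hγ hr']
  exact ⟨hr.trans hU.1, hU.2.1.trans hR, hπ.trans hU.2.2⟩

/-- Specific entropy at least c means p ≥ ϱ^γ e^{(γ-1)c}, which bounds p from below. Together with p
≤ (γ - 1)E it bounds ϱ from above, since ϱ ≤ ϱ^γ for ϱ > 1. The kinetic energy then bounds the
momentum: |m|² ≤ 2ϱE. -/
lemma exists_gasBox_of_specificEntropy (hγ : 1 < γ) {ϱlow : ℝ} (hϱ : 0 < ϱlow) (Ebar c : ℝ) :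
    ∃ R π₀, 0 < π₀ ∧ ∀ U : State d, IsGasState γ U → ϱlow ≤ density U → energy U ≤ Ebar →
      c ≤ specificEntropy γ U → U ∈ gasBox d γ ϱlow R π₀ := by
  have hγ1 : 0 < γ - 1 := sub_pos.2 hγ
  set B := max 1 ((γ - 1) * Ebar * Real.exp (-((γ - 1) * c))) with hB
  refine ⟨max B (max (Real.sqrt (2 * B * Ebar)) Ebar), ϱlow ^ γ * Real.exp ((γ - 1) * c),
    mul_pos (Real.rpow_pos_of_pos hϱ _) (Real.exp_pos _), fun U hg hϱU hE hc => ?_⟩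
  have hpE : pressure γ U = (γ - 1) * (energy U - density U * ‖velocity U‖ ^ 2 / 2) :=
    pressure_eq_energy γ hg.1
  have hkin : 0 ≤ density U * ‖velocity U‖ ^ 2 / 2 := by have := hg.1; positivity
  have hϱγ := Real.rpow_pos_of_pos hg.1 γ
  have hp : density U ^ γ * Real.exp ((γ - 1) * c) ≤ pressure γ U := by
    have h1 : (γ - 1) * c ≤ Real.log (pressure γ U / density U ^ γ) := by
      rw [specificEntropy] at hc
      have := mul_le_mul_of_nonneg_left hc hγ1.le
      rwa [← mul_assoc, mul_one_div_cancel hγ1.ne', one_mul] at this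
    have h2 := (Real.le_log_iff_exp_le (div_pos hg.2 hϱγ)).1 h1
    rw [le_div_iff₀ hϱγ] at h2
    linarith
  have he0 : 0 < energy U - density U * ‖velocity U‖ ^ 2 / 2 := by
    have := hg.2; rw [hpE] at this; exact (pos_iff_pos_of_mul_pos this).1 hγ1
  have hE0 : 0 < energy U := by linarith
  have hϱB : density U ≤ B := by
    by_cases h1 : density U ≤ 1
    · exact h1.trans (le_max_left _ _)
    · refine le_trans ?_ (le_max_right _ _)
      push Not at h1
      have h2 : density U ≤ density U ^ γ := by
        simpa using Real.rpow_le_rpow_of_exponent_le h1.le hγ.le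
      have h3 : density U ^ γ * Real.exp ((γ - 1) * c) ≤ (γ - 1) * Ebar := by
        refine hp.trans ?_
        rw [hpE]
        exact mul_le_mul_of_nonneg_left (by linarith) hγ1.le
      have h4 : density U ^ γ ≤ (γ - 1) * Ebar * Real.exp (-((γ - 1) * c)) := by
        rw [Real.exp_neg, ← div_eq_mul_inv, le_div_iff₀ (Real.exp_pos _)]
        exact h3
      exact h2.trans h4
  have hmn : ‖momentum U‖ ≤ Real.sqrt (2 * B * Ebar) := by
    apply Real.le_sqrt_of_sq_le
    have h1 : ‖momentum U‖ = density U * ‖velocity U‖ := by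
      rw [momentum_eq hg.1, norm_smul, Real.norm_of_nonneg hg.1.le]
    rw [h1, mul_pow]
    have h2 : density U * ‖velocity U‖ ^ 2 ≤ 2 * Ebar := by linarith
    have h3 := mul_le_mul hϱB h2 (by have := hg.1; positivity) (hg.1.le.trans hϱB)
    nlinarith
  refine (mem_gasBox_iff hγ hϱ).2 ⟨hϱU, ?_, ?_⟩
  · have h1 : ‖U‖ = max |density U| (max ‖momentum U‖ |energy U|) := rfl
    rw [h1, abs_of_pos hg.1, abs_of_pos hE0]
    exact max_le_max hϱB (max_le_max hmn hE)
  · refine le_trans ?_ hp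
    gcongr

lemma IsGodunovSolution.isGasState (hm : IsRectMesh Ω 𝒯) {U₀ : Vec d → State d}
    {U : Cell d → ℝ → State d} (h : IsGodunovSolution γ T 𝒯 U₀ U) (i : Fin d) {t : ℝ}
    (ht : t ∈ Icc 0 T) {K : Cell d} (hK : K ∈ 𝒯) (hϱ : 0 < density (U K t)) :
    IsGasState γ (U K t) := by
  obtain ⟨dU, Vp, Vm, -, hs⟩ := h.exists_step hm ht
  exact (hs.upper i K hK).gas hϱ

lemma setAverage_closedCell {X : Type*} [NormedAddCommGroup X] [NormedSpace ℝ X] (K : Cell d)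
    {f g : Vec d → X} (h : EqOn f g (openCell K)) :
    ⨍ x in closedCell K, f x = ⨍ x in openCell K, g x := by
  rw [setAverage_congr (closedCell_ae_eq_openCell K)]
  exact setAverage_congr_fun (isOpen_openCell K).measurableSet (Eventually.of_forall h)

lemma IsRegularOn.mono_gasBox {r R π₀ r' R' π₁ : ℝ} {L : ℝ≥0} {W : ℝ × Vec d → State d}
    (h : IsRegularOn γ T Ω r R π₀ L W) (hs : gasBox d γ r R π₀ ⊆ gasBox d γ r' R' π₁) :
    IsRegularOn γ T Ω r' R' π₁ L W :=
  ⟨fun z hz => hs (h.mem_gasBox z hz), h.lipschitz, h.equation, h.impermeable⟩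

/-- The solutions of the Godunov method and the strong solution take values in a common convex
compact set of gas states. -/
theorem IsRegularOn.exists_common_gasBox (hγ : 1 < γ) (hT : 0 < T) (i : Fin d) {r R π₀ : ℝ}
    (hr : 0 < r) (hπ : 0 < π₀) {L : ℝ≥0} {W : ℝ × Vec d → State d}
    (hW : IsRegularOn γ T Ω r R π₀ L W) {U₀ : Vec d → State d} (hU₀ : ∀ x ∈ Ω, U₀ x = W (0, x))
    {ϱlow : ℝ} (hϱ : 0 < ϱlow) (Ebar : ℝ) :
    ∃ r' R' π₁, 0 < r' ∧ 0 < π₁ ∧ IsRegularOn γ T Ω r' R' π₁ L W ∧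
      ∀ 𝒯 : Finset (Cell d), IsRectMesh Ω 𝒯 → ∀ U, IsGodunovSolution γ T 𝒯 U₀ U →
      (∀ t ∈ Icc 0 T, ∀ K ∈ 𝒯, ϱlow ≤ density (U K t) ∧ 0 < energy (U K t) ∧
        energy (U K t) ≤ Ebar) → ∀ t ∈ Icc 0 T, ∀ K ∈ 𝒯, U K t ∈ gasBox d γ r' R' π₁ := by
  have hcont : ContinuousOn (specificEntropy γ) (gasBox d γ r R π₀) := fun U hU =>
    (contDiffAt_specificEntropy (n := 0) (gasBox_gas hγ hr hπ hU)).continuousAt.continuousWithinAt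
  obtain ⟨B, hB⟩ := (isCompact_gasBox γ r R π₀).exists_bound_of_continuousOn hcont
  -- -B is a lower bound for the specific entropy of the strong solution. It passes to the initial
  -- cell averages by Jensen and to all later times by the minimum principle.
  obtain ⟨R₂, π₂, hπ₂, h₂⟩ := exists_gasBox_of_specificEntropy (d := d) hγ hϱ Ebar (-B)
  refine ⟨min r ϱlow, max R R₂, min π₀ π₂, lt_min hr hϱ, lt_min hπ hπ₂,
    hW.mono_gasBox (gasBox_mono hγ (lt_min hr hϱ) (min_le_left _ _) (le_max_left _ _)
      (min_le_left _ _)), fun 𝒯 hm U hU hb t ht K hK => ?_⟩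
  refine gasBox_mono hγ (lt_min hr hϱ) (min_le_right _ _) (le_max_right _ _) (min_le_right _ _) ?_
  have hg : ∀ t ∈ Icc 0 T, ∀ K ∈ 𝒯, IsGasState γ (U K t) := fun t ht K hK =>
    hU.isGasState hm i ht hK (hϱ.trans_le (hb t ht K hK).1)
  refine h₂ _ (hg t ht K hK) (hb t ht K hK).1 (hb t ht K hK).2.2 ?_
  refine hU.le_specificEntropy hγ hm hg (fun K hK => ?_) hK ht
  have h0 : (0 : ℝ) ∈ Icc 0 T := ⟨le_rfl, hT.le⟩
  have hsub := hm.openCell_subset hK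
  have hbox : ∀ x ∈ openCell K, W (0, x) ∈ gasBox d γ r R π₀ := fun x hx =>
    hW.mem_gasBox (0, x) ⟨h0, subset_closure (hsub hx)⟩
  have e : U K 0 = ⨍ x in openCell K, W (0, x) := by
    rw [hU.initial K hK]
    exact setAverage_closedCell K fun x hx => hU₀ x (hsub hx)
  have hgK := hg 0 h0 K hK
  rw [e] at hgK ⊢
  refine le_specificEntropy_average hγ (integrableOn_openCell ?_)
    (fun x hx => gasBox_gas hγ hr hπ (hbox x hx)) (fun x hx => ?_) hgK
  · exact (hW.lipschitz K hsub).continuousOn.comp (by fun_prop) fun x hx => ⟨h0, hx⟩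
  · exact (abs_le.1 (hB _ (hbox x hx))).1

/-! ### Absolute continuity and Gronwall's lemma -/

lemma absolutelyContinuousOnInterval_of_dist_le {f G : ℝ → ℝ} {a b M : ℝ}
    (hG : AbsolutelyContinuousOnInterval G a b)
    (h : ∀ x ∈ uIcc a b, ∀ y ∈ uIcc a b, dist (f x) (f y) ≤ M * dist (G x) (G y)) :
    AbsolutelyContinuousOnInterval f a b := by
  have h1 : Tendsto (fun E : ℕ × (ℕ → ℝ × ℝ) =>
      M * ∑ i ∈ Finset.range E.1, dist (G (E.2 i).1) (G (E.2 i).2))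
      (AbsolutelyContinuousOnInterval.totalLengthFilter ⊓
        𝓟 (AbsolutelyContinuousOnInterval.disjWithin a b)) (𝓝 0) := by
    simpa using Tendsto.const_mul M hG
  refine squeeze_zero' (Eventually.of_forall fun E => Finset.sum_nonneg fun _ _ => dist_nonneg)
    ?_ h1
  filter_upwards [mem_inf_of_right (mem_principal_self _)] with E hE
  rw [Finset.mul_sum]
  exact Finset.sum_le_sum fun i hi => h _ (hE.1 i hi).1 _ (hE.1 i hi).2

/-- A nonnegative derivative that exists everywhere inside the interval is integrable, so G is its
primitive. No bound on G' is required. -/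
lemma absolutelyContinuousOnInterval_of_deriv_nonneg {G G' : ℝ → ℝ} {a b : ℝ} (hab : a ≤ b)
    (hG : ContinuousOn G (Icc a b)) (hd : ∀ t ∈ Ioo a b, HasDerivAt G (G' t) t)
    (h0 : ∀ t ∈ Ioo a b, 0 ≤ G' t) : AbsolutelyContinuousOnInterval G a b := by
  have hi : IntervalIntegrable G' volume a b :=
    (intervalIntegrable_iff_integrableOn_Ioc_of_le hab).2
      (intervalIntegral.integrableOn_deriv_of_nonneg hG hd h0)
  refine absolutelyContinuousOnInterval_of_dist_le (M := 1)
    (hi.absolutelyContinuousOnInterval_intervalIntegral (c := a) (by simp)) fun x hx y hy => ?_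
  have h1 : ∀ x ∈ uIcc a b, ∫ t in a..x, G' t = G x - G a := by
    intro x hx
    rw [uIcc_of_le hab] at hx
    refine intervalIntegral.integral_eq_sub_of_hasDerivAt_of_le hx.1
      (hG.mono (Icc_subset_Icc_right hx.2)) (fun t ht => hd t ⟨ht.1, ht.2.trans_le hx.2⟩) ?_
    exact hi.mono_set (by rw [uIcc_of_le hx.1, uIcc_of_le hab]; exact Icc_subset_Icc_right hx.2)
  rw [h1 x hx, h1 y hy, dist_sub_right, one_mul]

/-- Gronwall's lemma for a function whose increments are controlled by those of an increasing
function. -/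
lemma le_exp_of_ae_deriv_le {Y G G' : ℝ → ℝ} {T M C κ : ℝ} (hC : 0 ≤ C)
    (hκ : 0 ≤ κ) (hG : ContinuousOn G (Icc 0 T)) (hd : ∀ t ∈ Ioo 0 T, HasDerivAt G (G' t) t)
    (h0 : ∀ t ∈ Ioo 0 T, 0 ≤ G' t)
    (hY : ∀ s ∈ Icc 0 T, ∀ t ∈ Icc 0 T, dist (Y s) (Y t) ≤ M * dist (G s) (G t))
    (hYd : ∀ᵐ t, t ∈ Ioo 0 T → ∃ y, HasDerivAt Y y t ∧ y ≤ C * Y t + κ * G' t)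
    {τ : ℝ} (hτ : τ ∈ Icc 0 T) : Y τ ≤ (Y 0 + κ * (G τ - G 0)) * Real.exp (C * τ) := by
  have hsub : Icc 0 τ ⊆ Icc 0 T := Icc_subset_Icc_right hτ.2
  have hsub' : Ioo 0 τ ⊆ Ioo 0 T := Ioo_subset_Ioo_right hτ.2
  have aG := absolutelyContinuousOnInterval_of_deriv_nonneg hτ.1 (hG.mono hsub)
    (fun t ht => hd t (hsub' ht)) fun t ht => h0 t (hsub' ht)
  have aY : AbsolutelyContinuousOnInterval Y 0 τ := absolutelyContinuousOnInterval_of_dist_le (M := M) aG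
      fun s hs t ht => by
    rw [uIcc_of_le hτ.1] at hs ht
    exact hY s (hsub hs) t (hsub ht)
  have hexp : ContDiff ℝ 1 fun t => Real.exp (-(C * t)) := by fun_prop
  have aE : AbsolutelyContinuousOnInterval (fun t => Real.exp (-(C * t))) 0 τ := by
    rcases hτ.1.eq_or_lt with h | h
    · refine absolutelyContinuousOnInterval_of_dist_le (M := 0) aY fun x hx y hy => ?_
      rw [← h, uIcc_self, mem_singleton_iff] at hx hy
      simp [hx, hy]
    · exact hexp.contDiffOn.absolutelyContinuousOnInterval
  -- Since e^{-Ct} ≤ 1 and G' ≥ 0, G can be subtracted without the exponential weight and f' ≤ 0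
  -- still holds almost everywhere.
  set f : ℝ → ℝ := fun t => Y t * Real.exp (-(C * t)) - κ * G t with hf
  have af : AbsolutelyContinuousOnInterval f 0 τ := (aY.mul aE).sub (aG.const_mul κ)
  have hdf : ∀ᵐ t, t ∈ Ioc 0 τ → deriv f t ≤ 0 := by
    have hne : ∀ᵐ t : ℝ, t ≠ τ := by simp [ae_iff, measure_singleton]
    filter_upwards [hYd, hne] with t h1 h2 ht
    have ht' : t ∈ Ioo 0 T := ⟨ht.1, (lt_of_le_of_ne ht.2 h2).trans_le hτ.2⟩
    obtain ⟨y, hy, hyle⟩ := h1 ht'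
    have he : HasDerivAt (fun t => Real.exp (-(C * t))) (Real.exp (-(C * t)) * -(C * 1)) t :=
      (((hasDerivAt_id t).const_mul C).neg).exp
    have hfd : HasDerivAt f _ t := (hy.mul he).sub ((hd t ht').const_mul κ)
    rw [hfd.deriv]
    have e1 : Real.exp (-(C * t)) ≤ 1 := Real.exp_le_one_iff.2 (by
      have := mul_nonneg hC ht.1.le; linarith)
    have e0 := Real.exp_pos (-(C * t))
    have e2 : 0 ≤ κ * G' t := mul_nonneg hκ (h0 t ht')
    have e3 : (y - C * Y t) * Real.exp (-(C * t)) ≤ κ * G' t * Real.exp (-(C * t)) :=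
      mul_le_mul_of_nonneg_right (by linarith) e0.le
    have e4 : κ * G' t * Real.exp (-(C * t)) ≤ κ * G' t := mul_le_of_le_one_right e2 e1
    linarith
  have hint : f τ - f 0 ≤ 0 := by
    rw [← af.integral_deriv_eq_sub, intervalIntegral.integral_of_le hτ.1]
    exact integral_nonpos_of_ae ((ae_restrict_iff' measurableSet_Ioc).2 hdf)
  simp only [hf, mul_zero, neg_zero, Real.exp_zero, mul_one] at hint
  have e5 : Y τ * Real.exp (-(C * τ)) ≤ Y 0 + κ * (G τ - G 0) := by linarith
  have e6 := mul_le_mul_of_nonneg_right e5 (Real.exp_pos (C * τ)).le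
  rwa [mul_assoc, ← Real.exp_add, neg_add_cancel, Real.exp_zero, mul_one] at e6

/-! ### Differentiation of integrals over cells -/

section CellIntegral
variable {X : Type*} [NormedAddCommGroup X] [NormedSpace ℝ X] {T : ℝ}

omit [NormedSpace ℝ X] in
lemma lipschitzOnWith_timeSlice {f : ℝ × Vec d → X} {I : Set ℝ} {S : Set (Vec d)} {L : ℝ≥0}
    (hf : LipschitzOnWith L f (I ×ˢ S)) {t : ℝ} (ht : t ∈ I) :
    LipschitzOnWith L (fun x => f (t, x)) S := by
  refine LipschitzOnWith.of_dist_le_mul fun x hx y hy => ?_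
  refine (hf.dist_le_mul (t, x) ⟨ht, hx⟩ (t, y) ⟨ht, hy⟩).trans_eq ?_
  simp [Prod.dist_eq]

/-- Dominated convergence: the Lipschitz constant bounds the difference quotients, so
differentiability at (t, x) for almost every x is enough. -/
lemma hasDerivAt_cellIntegral [FiniteDimensional ℝ X] {f : ℝ × Vec d → X} {K : Cell d} {L : ℝ≥0}
    (hf : LipschitzOnWith L f (Icc 0 T ×ˢ closedCell K)) {t : ℝ} (ht : t ∈ Ioo 0 T)
    (hd : ∀ᵐ x ∂(volume.restrict (openCell K)), DifferentiableAt ℝ f (t, x)) :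
    IntegrableOn (fun x => fderiv ℝ f (t, x) (1, 0)) (openCell K) ∧
      HasDerivAt (fun t => ∫ x in openCell K, f (t, x))
        (∫ x in openCell K, fderiv ℝ f (t, x) (1, 0)) t := by
  borelize X
  have : CompleteSpace X := FiniteDimensional.complete ℝ X
  have : ProperSpace X := FiniteDimensional.proper_real X
  have hcont : ∀ s ∈ Icc 0 T, ContinuousOn (fun x => f (s, x)) (closedCell K) := fun s hs =>
    (lipschitzOnWith_timeSlice hf hs).continuousOn
  have hKm : MeasurableSet (openCell K) := (isOpen_openCell K).measurableSet
  have hfin : IsFiniteMeasure (volume.restrict (openCell K)) :=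
    ⟨by rw [Measure.restrict_apply_univ, volume_openCell]; exact ENNReal.ofReal_lt_top⟩
  refine hasDerivAt_integral_of_dominated_loc_of_lip (F := fun s x => f (s, x))
    (s := Ioo 0 T) (bound := fun _ => (L : ℝ))
    (isOpen_Ioo.mem_nhds ht) ?_ (integrableOn_openCell (hcont t (Ioo_subset_Icc_self ht))) ?_ ?_
    (integrable_const _) ?_
  · filter_upwards [isOpen_Ioo.mem_nhds ht] with s hs
    exact (integrableOn_openCell (hcont s (Ioo_subset_Icc_self hs))).aestronglyMeasurable
  · have h1 : Measurable fun z : ℝ × Vec d => fderiv ℝ f z (1, 0) :=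
      measurable_fderiv_apply_const ℝ f (1, 0)
    exact (h1.comp measurable_prodMk_left).aestronglyMeasurable
  · filter_upwards [ae_restrict_mem hKm] with x hx
    refine LipschitzOnWith.of_dist_le_mul fun s hs r hr => ?_
    refine (hf.dist_le_mul (s, x) ⟨Ioo_subset_Icc_self hs, openCell_subset_closedCell K hx⟩
      (r, x) ⟨Ioo_subset_Icc_self hr, openCell_subset_closedCell K hx⟩).trans_eq ?_
    simp [Prod.dist_eq]
  · filter_upwards [hd] with x hx
    have h1 : HasDerivAt (fun s : ℝ => (s, x)) ((1 : ℝ), (0 : Vec d)) t :=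
      (hasDerivAt_id t).prodMk (hasDerivAt_const t x)
    exact hx.hasFDerivAt.comp_hasDerivAt t h1

lemma dist_cellIntegral_le {f : ℝ × Vec d → X} {K : Cell d} {L : ℝ≥0}
    (hf : LipschitzOnWith L f (Icc 0 T ×ˢ closedCell K)) {s t : ℝ} (hs : s ∈ Icc 0 T)
    (ht : t ∈ Icc 0 T) :
    ‖(∫ x in openCell K, f (s, x)) - ∫ x in openCell K, f (t, x)‖ ≤ L * cellVolume K * |s - t| := by
  have hcont : ∀ s ∈ Icc 0 T, ContinuousOn (fun x => f (s, x)) (closedCell K) := fun s hs =>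
    (lipschitzOnWith_timeSlice hf hs).continuousOn
  rw [← integral_sub (integrableOn_openCell (hcont s hs)) (integrableOn_openCell (hcont t ht))]
  have h1 : volume (openCell K) < ⊤ := by rw [volume_openCell]; exact ENNReal.ofReal_lt_top
  refine (norm_setIntegral_le_of_norm_le_const (C := L * |s - t|) h1 fun x hx => ?_).trans_eq ?_
  · have h2 := hf.dist_le_mul (s, x) ⟨hs, openCell_subset_closedCell K hx⟩
      (t, x) ⟨ht, openCell_subset_closedCell K hx⟩
    rw [dist_eq_norm] at h2
    simpa [Prod.dist_eq, Real.dist_eq] using h2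
  · rw [Measure.real, volume_openCell, ENNReal.toReal_ofReal (cellVolume_pos K).le]; ring

end CellIntegral

/-! ### Identities for the entropy variables -/

section Identities
variable {γ : ℝ} {U : State d}

lemma hasFDerivAt_entVar (hγ : 1 < γ) (hU : IsGasState γ U) :
    HasFDerivAt (entVar γ) (fderiv ℝ (entVar γ) U) U :=
  ((contDiffAt_entVar (n := 1) hγ hU).differentiableAt (by simp)).hasFDerivAt

lemma hasFDerivAt_flux (i : Fin d) (hU : IsGasState γ U) :
    HasFDerivAt (flux γ i) (fderiv ℝ (flux γ i) U) U :=
  ((contDiffAt_flux (n := 1) γ i hU.1.ne').differentiableAt (by simp)).hasFDerivAt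

/-- The `i`-th component of the momentum, as a continuous linear functional. -/
def momentumCLM (i : Fin d) : State d →L[ℝ] ℝ :=
  (EuclideanSpace.proj i).comp ((ContinuousLinearMap.fst ℝ (Vec d) ℝ).comp
    (ContinuousLinearMap.snd ℝ ℝ (Vec d × ℝ)))

@[simp] lemma momentumCLM_apply (i : Fin d) (U : State d) : momentumCLM i U = momentum U i := rfl

/-- The derivative of the identity η'(W)W = η(W) - ϱ(W); the term η'(U)v occurs on both sides. -/
lemma fderiv_entVar_self (hγ : 1 < γ) (hU : IsGasState γ U) (v : State d) :
    fderiv ℝ (entVar γ) U v U = -density v := by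
  have h1 : HasFDerivAt (fun W => entVar γ W W) _ U :=
    (hasFDerivAt_entVar hγ hU).clm_apply (hasFDerivAt_id U)
  have h2 : HasFDerivAt (fun W => entropy γ W - density W)
      (entVar γ U - ContinuousLinearMap.fst ℝ ℝ (Vec d × ℝ)) U :=
    (hasFDerivAt_entropy hγ hU).sub (ContinuousLinearMap.fst ℝ ℝ (Vec d × ℝ)).hasFDerivAt
  have h3 : (fun W => entVar γ W W) =ᶠ[𝓝 U] fun W => entropy γ W - density W := by
    filter_upwards [(isOpen_gasState γ).mem_nhds hU] with W hW using entVar_self hγ hW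
  have h4 := congrArg (fun ℓ : State d →L[ℝ] ℝ => ℓ v) (h1.unique (h2.congr_of_eventuallyEq h3))
  have h5 : (ContinuousLinearMap.fst ℝ ℝ (Vec d × ℝ)) v = density v := rfl
  simp [h5] at h4
  linarith

/-- The derivative of η'(W)F_i(W) = q_i(W) - m_i(W), which is `relFlux_self`; the compatibility q' =
η'F' cancels the other terms. -/
lemma fderiv_entVar_flux (hγ : 1 < γ) (i : Fin d) (hU : IsGasState γ U) (v : State d) :
    fderiv ℝ (entVar γ) U v (flux γ i U) = -momentum v i := by
  have h1 : HasFDerivAt (fun W => entVar γ W (flux γ i W)) _ U :=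
    (hasFDerivAt_entVar hγ hU).clm_apply (hasFDerivAt_flux i hU)
  have h2 : HasFDerivAt (fun W => entropyFlux γ i W - momentumCLM i W)
      ((entVar γ U).comp (fderiv ℝ (flux γ i) U) - momentumCLM i) U :=
    (hasFDerivAt_entropyFlux hγ i hU).sub (momentumCLM i).hasFDerivAt
  have h3 : (fun W => entVar γ W (flux γ i W))
      =ᶠ[𝓝 U] fun W => entropyFlux γ i W - momentumCLM i W := by
    filter_upwards [(isOpen_gasState γ).mem_nhds hU] with W hW
    have := relFlux_self hγ i hW
    rw [relFlux] at this
    rw [momentumCLM_apply]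
    linarith
  have h4 := congrArg (fun ℓ : State d →L[ℝ] ℝ => ℓ v) (h1.unique (h2.congr_of_eventuallyEq h3))
  simp at h4
  linarith

/-- The evolution of the relative entropy density along a solution `w` of the Euler system, with
`∂_t w = v₀` and `∂_i w = v i`, relative to a constant state `W`. -/
lemma fderiv_entVar_time (hγ : 1 < γ) (hU : IsGasState γ U) {v₀ : State d} {v : Fin d → State d}
    (h : v₀ + ∑ i, fderiv ℝ (flux γ i) U (v i) = 0) (W : State d) :
    density v₀ + fderiv ℝ (entVar γ) U v₀ W
      + ∑ i, (fderiv ℝ (entVar γ) U (v i) (flux γ i W) + momentum (v i) i)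
      = ∑ i, fderiv ℝ (entVar γ) U (v i)
        (flux γ i W - flux γ i U - fderiv ℝ (flux γ i) U (W - U)) := by
  have h0 : v₀ = -∑ i, fderiv ℝ (flux γ i) U (v i) := eq_neg_of_add_eq_zero_left h
  have h1 : density v₀ + fderiv ℝ (entVar γ) U v₀ W = fderiv ℝ (entVar γ) U v₀ (W - U) := by
    rw [map_sub, fderiv_entVar_self hγ hU]; ring
  -- The Euler system replaces the time derivative, and the symmetry of η''F' moves F' onto W - U.
  have h2 : fderiv ℝ (entVar γ) U v₀ (W - U)
      = -∑ i, fderiv ℝ (entVar γ) U (v i) (fderiv ℝ (flux γ i) U (W - U)) := by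
    rw [h0, map_neg, map_sum, _root_.neg_apply, _root_.sum_apply]
    congr 1
    exact Finset.sum_congr rfl fun i _ => (fderiv_entVar_fderiv_flux hγ i hU _ _).symm
  rw [h1, h2, ← Finset.sum_neg_distrib, ← Finset.sum_add_distrib]
  refine Finset.sum_congr rfl fun i _ => ?_
  rw [map_sub _ _ (fderiv ℝ (flux γ i) U (W - U)), map_sub _ (flux γ i W), fderiv_entVar_flux hγ i hU]
  ring

end Identities

/-! ### Uniform constants on a compact set of states -/

lemma FaceBound.mono {γ C C' ς D : ℝ} {i : Fin d} {U V : State d} (h : FaceBound γ i C ς U V D)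
    (hC : C ≤ C') : FaceBound γ i C' ς U V D :=
  ⟨h.nonneg, h.entropy_le, fun ε hε => (h.norm_le ε hε).trans
    (mul_le_mul_of_nonneg_right hC (by have := h.nonneg; positivity))⟩

/-- Constants for the estimates in which all states belong to `B`. -/
structure StateBounds (γ : ℝ) (B : Set (State d)) (C : ℝ) : Prop where
  nonneg : 0 ≤ C
  gas : ∀ U ∈ B, IsGasState γ U
  norm_le : ∀ U ∈ B, ‖U‖ ≤ C
  face : ∀ (i : Fin d), ∀ U ∈ B, ∀ ς V S, IsFaceState γ i ς U V S → ∃ D, FaceBound γ i C ς U V D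
  relEnt_le : ∀ U ∈ B, ∀ W ∈ B, relEnt γ W U ≤ C * ‖W - U‖ ^ 2
  le_relEnt : ∀ U ∈ B, ∀ W ∈ B, ‖W - U‖ ^ 2 ≤ C * relEnt γ W U
  entVar_le : ∀ U ∈ B, ‖entVar γ U‖ ≤ C
  fderiv_entVar_le : ∀ U ∈ B, ‖fderiv ℝ (entVar γ) U‖ ≤ C
  entVar_sub_le : ∀ U ∈ B, ∀ W ∈ B, ‖entVar γ W - entVar γ U‖ ≤ C * ‖W - U‖
  entropy_le : ∀ U ∈ B, |entropy γ U| ≤ C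
  entropy_sub_le : ∀ U ∈ B, ∀ W ∈ B, |entropy γ W - entropy γ U| ≤ C * ‖W - U‖
  flux_le : ∀ (i : Fin d), ∀ U ∈ B, ∀ W ∈ B,
    ‖flux γ i W - flux γ i U - fderiv ℝ (flux γ i) U (W - U)‖ ≤ C * ‖W - U‖ ^ 2

lemma exists_stateBounds {γ r R π₀ : ℝ} (hγ : 1 < γ) (hγ2 : γ ≤ 2) (hr : 0 < r) (hπ : 0 < π₀) :
    ∃ C, StateBounds γ (gasBox d γ r R π₀) C := by
  have hK := isCompact_gasBox (d := d) γ r R π₀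
  have hc := convex_gasBox (d := d) γ r R π₀
  have hgas : ∀ U ∈ gasBox d γ r R π₀, IsGasState γ U := fun U hU => gasBox_gas hγ hr hπ hU
  obtain ⟨R', hR'⟩ := hK.isBounded.exists_norm_le
  obtain ⟨C₁, h₁, hC₁⟩ := exists_faceBound_gasBox (d := d) (R := R) hγ hγ2 hr hπ
  obtain ⟨C₂, h₂, hC₂⟩ := exists_relEnt_equiv hγ hγ2 hK hc hgas
  obtain ⟨C₃, h₃, hC₃⟩ := exists_lipschitz_of_contDiffAt (f := entVar γ) hK hc
    fun U hU => contDiffAt_entVar (n := 1) hγ (hgas U hU)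
  obtain ⟨C₄, h₄, hC₄⟩ := exists_lipschitz_of_contDiffAt (f := entropy γ) hK hc
    fun U hU => contDiffAt_entropy (hgas U hU)
  choose C₅ h₅ hC₅ using fun i : Fin d => exists_quadratic_of_contDiffAt (f := flux γ i) hK hc
    fun U hU => contDiffAt_flux γ i (hgas U hU).1.ne'
  have hle : ∀ i, C₅ i ≤ ∑ i, C₅ i := fun i =>
    Finset.single_le_sum (fun i _ => h₅ i) (Finset.mem_univ i)
  have h₆ : 0 ≤ ∑ i, C₅ i := Finset.sum_nonneg fun i _ => h₅ i
  set C := |R'| + C₁ + C₂ + C₃ + C₄ + ∑ i, C₅ i with hC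
  have hR0 := abs_nonneg R'
  have e0 : R' ≤ C := by have := le_abs_self R'; linarith
  have e1 : C₁ ≤ C := by linarith
  have e2 : C₂ ≤ C := by linarith
  have e3 : C₃ ≤ C := by linarith
  have e4 : C₄ ≤ C := by linarith
  have e5 : ∀ i, C₅ i ≤ C := fun i => by have := hle i; linarith
  refine ⟨C, by positivity, hgas, fun U hU => (hR' U hU).trans e0, fun i U hU ς V S h => ?_,
    fun U hU W hW => ?_, fun U hU W hW => ?_, fun U hU => (hC₃.1 U hU).trans e3,
    fun U hU => (hC₃.2.1 U hU).trans e3, fun U hU W hW => ?_,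
    fun U hU => (hC₄.1 U hU).trans e4, fun U hU W hW => ?_, fun i U hU W hW => ?_⟩
  · obtain ⟨D, hD⟩ := hC₁ i U hU ς V S h
    exact ⟨D, hD.mono e1⟩
  · exact (hC₂ U hU W hW).1.trans (by gcongr)
  · exact (hC₂ U hU W hW).2.trans (mul_le_mul_of_nonneg_right e2
      (relEnt_nonneg hγ (Or.inl (hgas W hW)) (hgas U hU)))
  · exact (hC₃.2.2 U hU W hW).trans (by gcongr)
  · exact (hC₄.2.2 U hU W hW).trans (by gcongr)
  · exact (hC₅ i U hU W hW).trans (by gcongr; exact e5 i)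

/-! ### The evolution of the relative entropy at fixed time -/

variable {n : ℕ}

lemma integral_fderiv_openCell {f : Vec (n + 1) → ℝ} {K : Cell (n + 1)} {L : ℝ≥0}
    (i : Fin (n + 1)) (hf : LipschitzOnWith L f (closedCell K)) :
    IntegrableOn (fun x => fderiv ℝ f x (EuclideanSpace.single i 1)) (openCell K) ∧
    ∫ x in openCell K, fderiv ℝ f x (EuclideanSpace.single i 1)
      = faceIntegral i (K.face i) (K.upper i) f - faceIntegral i (K.face i) (K.lower i) f := by
  have hKm : MeasurableSet (openCell K) := (isOpen_openCell K).measurableSet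
  have hint : IntegrableOn (fun x => fderiv ℝ f x (EuclideanSpace.single i 1)) (openCell K) := by
    refine Measure.integrableOn_of_bounded (M := L)
      (by rw [volume_openCell]; exact ENNReal.ofReal_ne_top)
      (measurable_fderiv_apply_const ℝ f _).aestronglyMeasurable ?_
    filter_upwards [ae_restrict_mem hKm] with x hx
    have h1 := norm_fderiv_le_of_lipschitzOn ℝ ((isOpen_openCell K).mem_nhds hx)
      (hf.mono (openCell_subset_closedCell K))
    refine ((fderiv ℝ f x).le_opNorm _).trans ?_
    rw [PiLp.norm_single, norm_one, mul_one]
    exact h1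
  refine ⟨hint, integral_lineDeriv_openCell i hf hint ?_⟩
  rw [ae_restrict_iff' hKm]
  filter_upwards [(hf.mono (openCell_subset_closedCell K)).ae_differentiableWithinAt_of_mem
    (μ := volume)] with x hx hxK
  exact ((hx hxK).differentiableAt ((isOpen_openCell K).mem_nhds hxK)).hasFDerivAt.hasLineDerivAt _

/-- The strong solution at a fixed time: `w` is its value, `wt` its time derivative. -/
structure IsTimeSlice (γ : ℝ) (Ω : Set (Vec d)) (𝒯 : Finset (Cell d)) (B : Set (State d))
    (L : ℝ≥0) (w wt : Vec d → State d) : Prop where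
  mem : ∀ x ∈ closure Ω, w x ∈ B
  lipschitz : ∀ K ∈ 𝒯, LipschitzOnWith L w (closedCell K)
  equation : ∀ K ∈ 𝒯, ∀ᵐ x ∂(volume.restrict (openCell K)), DifferentiableAt ℝ w x ∧
    wt x + ∑ i, fderiv ℝ (flux γ i) (w x) (fderiv ℝ w x (EuclideanSpace.single i 1)) = 0
  impermeable : ∀ x n, IsOuterNormal Ω x n → inner ℝ (velocity (w x)) n = 0

section Slice
variable {γ C : ℝ} {Ω : Set (Vec (n + 1))} {𝒯 : Finset (Cell (n + 1))} {B : Set (State (n + 1))}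
  {L : ℝ≥0} {w wt : Vec (n + 1) → State (n + 1)} {K : Cell (n + 1)}

lemma IsTimeSlice.mem_cell (h : IsTimeSlice γ Ω 𝒯 B L w wt) (hm : IsRectMesh Ω 𝒯) (hK : K ∈ 𝒯)
    {x : Vec (n + 1)} (hx : x ∈ closedCell K) : w x ∈ B := h.mem x (hm.closedCell_subset hK hx)

lemma IsTimeSlice.lipschitz_entVar (h : IsTimeSlice γ Ω 𝒯 B L w wt) (hm : IsRectMesh Ω 𝒯)
    (hB : StateBounds γ B C) (hK : K ∈ 𝒯) :
    LipschitzOnWith (⟨C, hB.nonneg⟩ * L) (fun x => entVar γ (w x)) (closedCell K) := by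
  refine LipschitzOnWith.comp (g := entVar γ) (t := B) (LipschitzOnWith.of_dist_le_mul
    fun U hU V hV => ?_) (h.lipschitz K hK) fun x hx => h.mem_cell hm hK hx
  rw [dist_eq_norm, dist_eq_norm]
  exact hB.entVar_sub_le V hV U hU

/-- The entropy variables tested with a constant flux `Φ`, corrected by the normal momentum. -/
def testedFlux (γ : ℝ) (i : Fin d) (w : Vec d → State d) (Φ : State d) (x : Vec d) : ℝ :=
  entVar γ (w x) Φ + momentum (w x) i

lemma IsTimeSlice.lipschitz_testedFlux (h : IsTimeSlice γ Ω 𝒯 B L w wt) (hm : IsRectMesh Ω 𝒯)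
    (hB : StateBounds γ B C) (hK : K ∈ 𝒯) (i : Fin (n + 1)) (Φ : State (n + 1)) :
    ∃ L' : ℝ≥0, LipschitzOnWith L' (testedFlux γ i w Φ) (closedCell K) :=
  ⟨_, ((ContinuousLinearMap.apply ℝ ℝ Φ).lipschitz.comp_lipschitzOnWith
    (h.lipschitz_entVar hm hB hK)).add
    ((momentumCLM i).lipschitz.comp_lipschitzOnWith (h.lipschitz K hK))⟩

lemma faceIntegral_testedFlux {i : Fin (n + 1)} {w : Vec (n + 1) → State (n + 1)}
    (ha : ContinuousOn (fun x => entVar γ (w x)) (closedCell K)) (hw : ContinuousOn w (closedCell K))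
    (Φ : State (n + 1)) {c : ℝ} (hc : c ∈ Icc (K.lower i) (K.upper i)) :
    faceIntegral i (K.face i) c (testedFlux γ i w Φ)
      = faceIntegral i (K.face i) c (fun x => entVar γ (w x)) Φ
        + faceIntegral i (K.face i) c (fun x => momentum (w x) i) := by
  have h1 := integrableOn_faceInterior i ha hc
  have h2 : IntegrableOn (fun y => momentum (w (insertCoord i (c, y))) i)
      (faceInterior (K.face i)) := (momentumCLM i).integrable_comp (integrableOn_faceInterior i hw hc)
  rw [faceIntegral, faceIntegral, faceIntegral, ContinuousLinearMap.integral_apply h1,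
    ← integral_add (h1.apply_continuousLinearMap Φ) h2]
  rfl

/-- `fderiv_entVar_time` integrated over the cell: derivatives of the tested fluxes become face
integrals. The Taylor remainder of F costs at most C³L H in each of the n + 1 directions. -/
lemma IsTimeSlice.cell_estimate (h : IsTimeSlice γ Ω 𝒯 B L w wt) (hm : IsRectMesh Ω 𝒯)
    (hγ : 1 < γ) (hB : StateBounds γ B C) (hK : K ∈ 𝒯) {U : State (n + 1)} (hU : U ∈ B)
    (hi : IntegrableOn (fun x => density (wt x) + fderiv ℝ (entVar γ) (w x) (wt x) U)
      (openCell K)) :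
    ∫ x in openCell K, (density (wt x) + fderiv ℝ (entVar γ) (w x) (wt x) U)
      ≤ ((n + 1) * (C ^ 3 * L)) * (∫ x in openCell K, relEnt γ U (w x))
        - ∑ i, (faceIntegral i (K.face i) (K.upper i) (testedFlux γ i w (flux γ i U))
          - faceIntegral i (K.face i) (K.lower i) (testedFlux γ i w (flux γ i U))) := by
  have hKm : MeasurableSet (openCell K) := (isOpen_openCell K).measurableSet
  have hb : ∀ i, IntegrableOn (fun x => fderiv ℝ (testedFlux γ i w (flux γ i U)) x
      (EuclideanSpace.single i 1)) (openCell K) ∧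
      ∫ x in openCell K, fderiv ℝ (testedFlux γ i w (flux γ i U)) x (EuclideanSpace.single i 1)
      = faceIntegral i (K.face i) (K.upper i) (testedFlux γ i w (flux γ i U))
        - faceIntegral i (K.face i) (K.lower i) (testedFlux γ i w (flux γ i U)) := fun i => by
    obtain ⟨L', hL'⟩ := h.lipschitz_testedFlux hm hB hK i (flux γ i U)
    exact integral_fderiv_openCell i hL'
  have hac : ContinuousOn (fun x => entVar γ (w x)) (closedCell K) :=
    (h.lipschitz_entVar hm hB hK).continuousOn
  have hwc : ContinuousOn w (closedCell K) := (h.lipschitz K hK).continuousOn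
  have hrel : IntegrableOn (fun x => relEnt γ U (w x)) (openCell K) := by
    refine integrableOn_openCell ?_
    have h1 : ContinuousOn (fun x => density (w x)) (closedCell K) :=
      (ContinuousLinearMap.fst ℝ ℝ (Vec (n + 1) × ℝ)).continuous.comp_continuousOn hwc
    exact (h1.add (hac.clm_apply continuousOn_const)).sub continuousOn_const
  simp_rw [← (hb _).2]
  rw [← integral_finsetSum _ fun i _ => (hb i).1, ← integral_const_mul, ← integral_sub
    (hrel.const_mul _) (integrable_finsetSum _ fun i _ => (hb i).1)]
  refine integral_mono_ae hi ((hrel.const_mul _).sub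
    (integrable_finsetSum _ fun i _ => (hb i).1)) ?_
  filter_upwards [h.equation K hK, ae_restrict_mem hKm] with x hx hxK
  have hwx : w x ∈ B := h.mem_cell hm hK (openCell_subset_closedCell K hxK)
  have hgx := hB.gas _ hwx
  have hfd : ∀ i, fderiv ℝ (testedFlux γ i w (flux γ i U)) x (EuclideanSpace.single i 1)
      = fderiv ℝ (entVar γ) (w x) (fderiv ℝ w x (EuclideanSpace.single i 1)) (flux γ i U)
        + momentum (fderiv ℝ w x (EuclideanSpace.single i 1)) i := by
    intro i
    have h1 : HasFDerivAt (fun x => entVar γ (w x)) _ x :=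
      (hasFDerivAt_entVar hγ hgx).comp x hx.1.hasFDerivAt
    have h2 : HasFDerivAt (testedFlux γ i w (flux γ i U)) _ x :=
      (h1.clm_apply (hasFDerivAt_const (flux γ i U) x)).add
        ((momentumCLM i).hasFDerivAt.comp x hx.1.hasFDerivAt)
    rw [h2.fderiv]
    simp
  have hLw : ‖fderiv ℝ w x‖ ≤ L := norm_fderiv_le_of_lipschitzOn ℝ
    ((isOpen_openCell K).mem_nhds hxK) ((h.lipschitz K hK).mono (openCell_subset_closedCell K))
  have key := fderiv_entVar_time hγ hgx hx.2 U
  simp only [hfd]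
  have hterm : ∀ i, fderiv ℝ (entVar γ) (w x) (fderiv ℝ w x (EuclideanSpace.single i 1))
      (flux γ i U - flux γ i (w x) - fderiv ℝ (flux γ i) (w x) (U - w x))
      ≤ C ^ 3 * L * relEnt γ U (w x) := by
    intro i
    have h1 := hB.flux_le i _ hwx U hU
    have h2 : ‖fderiv ℝ w x (EuclideanSpace.single i 1)‖ ≤ L := by
      refine ((fderiv ℝ w x).le_opNorm _).trans ?_
      rwa [PiLp.norm_single, norm_one, mul_one]
    have h3 := hB.le_relEnt _ hwx U hU
    have hC := hB.nonneg
    refine (le_abs_self _).trans ?_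
    rw [← Real.norm_eq_abs]
    calc _ ≤ ‖fderiv ℝ (entVar γ) (w x)‖ * ‖fderiv ℝ w x (EuclideanSpace.single i 1)‖
          * ‖flux γ i U - flux γ i (w x) - fderiv ℝ (flux γ i) (w x) (U - w x)‖ :=
        ContinuousLinearMap.le_opNorm₂ _ _ _
      _ ≤ C * L * (C * (C * relEnt γ U (w x))) := by
        gcongr
        · exact hB.fderiv_entVar_le _ hwx
        · exact h1.trans (by gcongr)
      _ = _ := by ring
  have hsum := Finset.sum_le_sum fun i (_ : i ∈ (Finset.univ : Finset (Fin (n + 1)))) => hterm i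
  rw [Finset.sum_const, Finset.card_univ, Fintype.card_fin, nsmul_eq_mul] at hsum
  push_cast at hsum
  linarith

/-- The ratio of face area to volume is the inverse width; the width in `norm_faceIntegral_sub_le`
compensates it. A flux difference is thus weighted with |K|, not with the face area. -/
lemma IsTimeSlice.norm_sub_faceIntegral_le (h : IsTimeSlice γ Ω 𝒯 B L w wt) (hm : IsRectMesh Ω 𝒯)
    (hB : StateBounds γ B C) (hK : K ∈ 𝒯) (i : Fin (n + 1)) {c : ℝ}
    (hc : c ∈ Icc (K.lower i) (K.upper i)) :
    ‖(faceArea i K / cellVolume K) • (∫ x in openCell K, entVar γ (w x))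
      - faceIntegral i (K.face i) c (fun x => entVar γ (w x))‖ ≤ C * L * cellVolume K := by
  have h1 := norm_faceIntegral_sub_le i (h.lipschitz_entVar hm hB hK) hc
  have hΔ : 0 < K.upper i - K.lower i := sub_pos.2 (K.lower_lt_upper i)
  have hratio : faceArea i K / cellVolume K = (K.upper i - K.lower i)⁻¹ := by
    have := (faceArea_pos i K).ne'
    rw [← width_mul_faceArea i K]
    field_simp
  rw [hratio]
  refine le_of_mul_le_mul_left ?_ hΔ
  have h2 : (K.upper i - K.lower i) • ((K.upper i - K.lower i)⁻¹ •
      (∫ x in openCell K, entVar γ (w x)) - faceIntegral i (K.face i) c fun x => entVar γ (w x))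
      = -((K.upper i - K.lower i) • faceIntegral i (K.face i) c (fun x => entVar γ (w x))
        - ∫ x in openCell K, entVar γ (w x)) := by
    rw [smul_sub, smul_inv_smul₀ hΔ.ne', neg_sub]
  calc (K.upper i - K.lower i) * _ = ‖(K.upper i - K.lower i) • ((K.upper i - K.lower i)⁻¹ •
      (∫ x in openCell K, entVar γ (w x)) - faceIntegral i (K.face i) c fun x => entVar γ (w x))‖ := by
        rw [norm_smul, Real.norm_of_nonneg hΔ.le]
    _ ≤ C * L * (K.upper i - K.lower i) * cellVolume K := by
        rw [h2, norm_neg]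
        exact h1
    _ = _ := by ring

variable {U dU : Cell (n + 1) → State (n + 1)} {Vp Vm : Fin (n + 1) → Cell (n + 1) → State (n + 1)}

/-- The exact balance of the tested fluxes: the contributions of the faces cancel. -/
lemma IsTimeSlice.sum_testedFlux (h : IsTimeSlice γ Ω 𝒯 B L w wt) (hm : IsRectMesh Ω 𝒯)
    (hB : StateBounds γ B C) (hs : IsGodunovStep γ 𝒯 U dU Vp Vm) (i : Fin (n + 1)) :
    ∑ K ∈ 𝒯, faceIntegral i (K.face i) (K.upper i) (testedFlux γ i w (flux γ i (Vp i K)))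
      = ∑ K ∈ 𝒯, faceIntegral i (K.face i) (K.lower i) (testedFlux γ i w (flux γ i (Vm i K))) := by
  -- At a wall the numerical flux is (0, p e_i, 0), and η'(w) sees it only through -p u_i(w)/ϑ(w),
  -- which is zero by impermeability; m_i(w) is zero as well.
  have hzero : ∀ V : State (n + 1), momentum V i = 0 → ∀ x, w x ∈ B → velocity (w x) i = 0 →
      testedFlux γ i w (flux γ i V) x = 0 := by
    intro V hV x hx hv
    have h1 : velocity V i = 0 := by simp [velocity, hV]
    have h2 : momentum (w x) i = 0 := by
      rw [momentum_eq (hB.gas _ hx).1]; simp [hv]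
    have e1 : density (flux γ i V) = 0 := hV
    have e2 : energy (flux γ i V) = 0 := by
      change velocity V i * _ = 0
      rw [h1, zero_mul]
    have e3 : momentum (flux γ i V) = pressure γ V • EuclideanSpace.single i 1 := by
      change velocity V i • _ + _ = _
      rw [h1, zero_smul, zero_add]
    rw [testedFlux, h2, entVar_apply, e1, e2, e3, inner_smul_right, EuclideanSpace.inner_single_right]
    simp [hv]
  refine hm.sum_faces_eq i (fun K hK M hM hKM => ?_) (fun K hK hw => ?_) fun K hK hw => ?_
  · rw [hs.adjacent i K hK M hM hKM, hKM.face_eq, hKM.1]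
  · rw [faceIntegral]
    refine setIntegral_eq_zero_of_forall_eq_zero fun y hy => ?_
    have hx : insertCoord i (K.upper i, y) ∈ closedCell K :=
      insertCoord_mem_closedCell ⟨⟨(K.lower_lt_upper i).le, le_rfl⟩, hy⟩
    refine hzero _ (hs.wall_upper i K hK hw) _ (h.mem_cell hm hK hx) ?_
    have hn := hm.isOuterNormal_upper hK hw (x := insertCoord i (K.upper i, y)) (fun j hj => ?_)
      (insertCoord_same i _)
    · have := h.impermeable _ _ hn
      simpa [inner_smul_right, EuclideanSpace.inner_single_right] using this
    · obtain ⟨k, rfl⟩ := Fin.exists_succAbove_eq hj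
      simpa [insertCoord] using hy k
  · rw [faceIntegral]
    refine setIntegral_eq_zero_of_forall_eq_zero fun y hy => ?_
    have hx : insertCoord i (K.lower i, y) ∈ closedCell K :=
      insertCoord_mem_closedCell ⟨⟨le_rfl, (K.lower_lt_upper i).le⟩, hy⟩
    refine hzero _ (hs.wall_lower i K hK hw) _ (h.mem_cell hm hK hx) ?_
    have hn := hm.isOuterNormal_lower hK hw (x := insertCoord i (K.lower i, y)) (fun j hj => ?_)
      (insertCoord_same i _)
    · have := h.impermeable _ _ hn
      simpa [inner_smul_right, EuclideanSpace.inner_single_right] using this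
    · obtain ⟨k, rfl⟩ := Fin.exists_succAbove_eq hj
      simpa [insertCoord] using hy k

/-- The defect at the faces is controlled by the differences between the fluxes of the cell values
and the numerical fluxes. -/
lemma IsTimeSlice.face_estimate (h : IsTimeSlice γ Ω 𝒯 B L w wt) (hm : IsRectMesh Ω 𝒯)
    (hB : StateBounds γ B C) (hs : IsGodunovStep γ 𝒯 U dU Vp Vm) (hK : K ∈ 𝒯) :
    (∫ x in openCell K, entVar γ (w x)) (dU K)
      - ∑ i, (faceIntegral i (K.face i) (K.upper i) (testedFlux γ i w (flux γ i (U K)))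
        - faceIntegral i (K.face i) (K.lower i) (testedFlux γ i w (flux γ i (U K))))
      ≤ ∑ i, (faceIntegral i (K.face i) (K.lower i) (testedFlux γ i w (flux γ i (Vm i K)))
        - faceIntegral i (K.face i) (K.upper i) (testedFlux γ i w (flux γ i (Vp i K)))
        + C * L * cellVolume K * (‖flux γ i (U K) - flux γ i (Vp i K)‖
          + ‖flux γ i (U K) - flux γ i (Vm i K)‖)) := by
  have hac : ContinuousOn (fun x => entVar γ (w x)) (closedCell K) :=
    (h.lipschitz_entVar hm hB hK).continuousOn
  have hwc : ContinuousOn w (closedCell K) := (h.lipschitz K hK).continuousOn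
  set A := ∫ x in openCell K, entVar γ (w x) with hA
  have h1 : A (dU K) = ∑ i, ((faceArea i K / cellVolume K) • A)
      (flux γ i (Vm i K) - flux γ i (Vp i K)) := by
    have h2 : dU K = (cellVolume K)⁻¹ • ∑ i, faceArea i K • (flux γ i (Vm i K) - flux γ i (Vp i K)) := by
      rw [← hs.balance K hK, inv_smul_smul₀ (cellVolume_pos K).ne']
    rw [h2, map_smul, map_sum, Finset.smul_sum]
    refine Finset.sum_congr rfl fun i _ => ?_
    rw [map_smul, smul_smul, _root_.smul_apply, div_eq_inv_mul]
  rw [h1, ← Finset.sum_sub_distrib]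
  refine Finset.sum_le_sum fun i _ => ?_
  have hup : K.upper i ∈ Icc (K.lower i) (K.upper i) := ⟨(K.lower_lt_upper i).le, le_rfl⟩
  have hlo : K.lower i ∈ Icc (K.lower i) (K.upper i) := ⟨le_rfl, (K.lower_lt_upper i).le⟩
  simp only [faceIntegral_testedFlux hac hwc _ hup, faceIntegral_testedFlux hac hwc _ hlo]
  have e1 := h.norm_sub_faceIntegral_le hm hB hK i hup
  have e2 := h.norm_sub_faceIntegral_le hm hB hK i hlo
  rw [← hA] at e1 e2
  set Λ := (faceArea i K / cellVolume K) • A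
  set Ap := faceIntegral i (K.face i) (K.upper i) fun x => entVar γ (w x)
  set Am := faceIntegral i (K.face i) (K.lower i) fun x => entVar γ (w x)
  have b1 : (Λ - Ap) (flux γ i (U K) - flux γ i (Vp i K))
      ≤ C * L * cellVolume K * ‖flux γ i (U K) - flux γ i (Vp i K)‖ :=
    (le_abs_self _).trans (((Λ - Ap).le_opNorm _).trans (by gcongr))
  have b2 : -(Λ - Am) (flux γ i (U K) - flux γ i (Vm i K))
      ≤ C * L * cellVolume K * ‖flux γ i (U K) - flux γ i (Vm i K)‖ :=
    (neg_le_abs _).trans (((Λ - Am).le_opNorm _).trans (by gcongr))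
  simp only [_root_.sub_apply, map_sub] at b1 b2 ⊢
  linarith

/-- Rate of change of the total relative entropy, apart from the entropy production. -/
theorem IsTimeSlice.estimate (h : IsTimeSlice γ Ω 𝒯 B L w wt) (hm : IsRectMesh Ω 𝒯)
    (hΩ : Bornology.IsBounded Ω) (hγ : 1 < γ) (hB : StateBounds γ B C)
    (hs : IsGodunovStep γ 𝒯 U dU Vp Vm) (hU : ∀ K ∈ 𝒯, U K ∈ B)
    (hi : ∀ K ∈ 𝒯, IntegrableOn
      (fun x => density (wt x) + fderiv ℝ (entVar γ) (w x) (wt x) (U K)) (openCell K)) :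
    ∑ K ∈ 𝒯, ((∫ x in openCell K, (density (wt x) + fderiv ℝ (entVar γ) (w x) (wt x) (U K)))
      + (∫ x in openCell K, entVar γ (w x)) (dU K))
      ≤ (n + 1) * (C ^ 3 * L) * (∑ K ∈ 𝒯, ∫ x in openCell K, relEnt γ (U K) (w x))
        + C ^ 2 * L * (2 * (n + 1) + 1 + √(Metric.diam Ω)) * √(meshSize 𝒯)
          * (∑ K ∈ 𝒯, cellVolume K + ∑ K ∈ 𝒯, cellVolume K * entVar γ (U K) (dU K)) := by
  have hC := hB.nonneg
  choose! Dp hDp using fun (i : Fin (n + 1)) K (hK : K ∈ 𝒯) =>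
    hB.face i (U K) (hU K hK) _ _ _ (hs.upper i K hK)
  choose! Dm hDm using fun (i : Fin (n + 1)) K (hK : K ∈ 𝒯) =>
    hB.face i (U K) (hU K hK) _ _ _ (hs.lower i K hK)
  have hprod := hs.entropy_production hm hDp hDm
  set V := ∑ K ∈ 𝒯, cellVolume K
  set P := ∑ K ∈ 𝒯, cellVolume K * entVar γ (U K) (dU K)
  set S := ∑ i, ∑ K ∈ 𝒯, faceArea i K * (Dp i K + Dm i K) with hS
  have hV0 : 0 ≤ V := Finset.sum_nonneg fun K _ => (cellVolume_pos K).le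
  have hS0 : 0 ≤ S := Finset.sum_nonneg fun i _ => Finset.sum_nonneg fun K hK =>
    mul_nonneg (faceArea_pos i K).le (add_nonneg (hDp i K hK).nonneg (hDm i K hK).nonneg)
  -- The face bounds are used with ε = √h. Since |K| ≤ h|σ|, the parts |K|ε and |K|D/ε are at most
  -- √h|K| and √h|σ|D. The part |K|D ≤ h|σ|D is of the same form after one factor √h is bounded by
  -- the root of the diameter of Ω.
  set q := √(meshSize 𝒯) with hq
  set δ := √(Metric.diam Ω) with hδ
  have hq0 : 0 ≤ q := Real.sqrt_nonneg _
  have hδ0 : 0 ≤ δ := Real.sqrt_nonneg _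
  have hqδ : q ≤ δ := Real.sqrt_le_sqrt (hm.meshSize_le hΩ)
  have hface : ∀ i, ∀ K ∈ 𝒯, C * L * cellVolume K * (‖flux γ i (U K) - flux γ i (Vp i K)‖
      + ‖flux γ i (U K) - flux γ i (Vm i K)‖)
      ≤ C ^ 2 * L * q * (2 * cellVolume K + (1 + δ) * (faceArea i K * (Dp i K + Dm i K))) := by
    intro i K hK
    have hv := cellVolume_pos K
    have ha := faceArea_pos i K
    have hΔ : 0 < K.upper i - K.lower i := sub_pos.2 (K.lower_lt_upper i)
    have hh : 0 < meshSize 𝒯 := hΔ.trans_le (width_le_meshSize hK i)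
    have hqpos : 0 < q := Real.sqrt_pos.2 hh
    have hqq : q * q = meshSize 𝒯 := Real.mul_self_sqrt hh.le
    have hD : 0 ≤ Dp i K + Dm i K := add_nonneg (hDp i K hK).nonneg (hDm i K hK).nonneg
    have h1 := (hDp i K hK).norm_le q hqpos
    have h2 := (hDm i K hK).norm_le q hqpos
    have h3 : cellVolume K ≤ q * q * faceArea i K := by
      rw [hqq, ← width_mul_faceArea i K]
      exact mul_le_mul_of_nonneg_right (width_le_meshSize hK i) ha.le
    have h4 : cellVolume K * ((Dp i K + Dm i K) / q) ≤ q * (faceArea i K * (Dp i K + Dm i K)) := by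
      rw [mul_div_assoc', div_le_iff₀ hqpos]
      calc cellVolume K * (Dp i K + Dm i K) ≤ q * q * faceArea i K * (Dp i K + Dm i K) :=
            mul_le_mul_of_nonneg_right h3 hD
        _ = _ := by ring
    have h5 : cellVolume K * (Dp i K + Dm i K) ≤ q * (δ * (faceArea i K * (Dp i K + Dm i K))) := by
      calc cellVolume K * (Dp i K + Dm i K) ≤ q * q * faceArea i K * (Dp i K + Dm i K) :=
            mul_le_mul_of_nonneg_right h3 hD
        _ = q * (q * (faceArea i K * (Dp i K + Dm i K))) := by ring
        _ ≤ q * (δ * (faceArea i K * (Dp i K + Dm i K))) := by gcongr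
    calc _ ≤ C * L * cellVolume K * (C * (q + Dp i K / q + Dp i K) + C * (q + Dm i K / q + Dm i K)) := by
          gcongr
      _ = C ^ 2 * L * (2 * q * cellVolume K + cellVolume K * ((Dp i K + Dm i K) / q)
          + cellVolume K * (Dp i K + Dm i K)) := by ring
      _ ≤ C ^ 2 * L * (2 * q * cellVolume K + q * (faceArea i K * (Dp i K + Dm i K))
          + q * (δ * (faceArea i K * (Dp i K + Dm i K)))) := by gcongr
      _ = _ := by ring
  have hcell : ∀ K ∈ 𝒯,
      (∫ x in openCell K, (density (wt x) + fderiv ℝ (entVar γ) (w x) (wt x) (U K)))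
      + (∫ x in openCell K, entVar γ (w x)) (dU K)
      ≤ (n + 1) * (C ^ 3 * L) * (∫ x in openCell K, relEnt γ (U K) (w x))
        + ∑ i, (faceIntegral i (K.face i) (K.lower i) (testedFlux γ i w (flux γ i (Vm i K)))
        - faceIntegral i (K.face i) (K.upper i) (testedFlux γ i w (flux γ i (Vp i K)))
        + C ^ 2 * L * q * (2 * cellVolume K + (1 + δ) * (faceArea i K * (Dp i K + Dm i K)))) := by
    intro K hK
    have h1 := h.cell_estimate hm hγ hB hK (hU K hK) (hi K hK)
    have h2 := h.face_estimate hm hB hs hK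
    have h3 := Finset.sum_le_sum fun i (_ : i ∈ (Finset.univ : Finset (Fin (n + 1)))) =>
      hface i K hK
    rw [Finset.sum_add_distrib] at h2 ⊢
    linarith
  refine (Finset.sum_le_sum hcell).trans ?_
  rw [Finset.sum_add_distrib, ← Finset.mul_sum]
  refine add_le_add_right ?_ _
  rw [Finset.sum_comm]
  have hcomb : ∀ i, ∑ K ∈ 𝒯, (faceIntegral i (K.face i) (K.lower i) (testedFlux γ i w (flux γ i (Vm i K)))
        - faceIntegral i (K.face i) (K.upper i) (testedFlux γ i w (flux γ i (Vp i K)))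
        + C ^ 2 * L * q * (2 * cellVolume K + (1 + δ) * (faceArea i K * (Dp i K + Dm i K))))
      = C ^ 2 * L * q * (2 * V + (1 + δ) * ∑ K ∈ 𝒯, faceArea i K * (Dp i K + Dm i K)) := by
    intro i
    rw [Finset.sum_add_distrib, Finset.sum_sub_distrib, h.sum_testedFlux hm hB hs i, sub_self,
      zero_add, ← Finset.mul_sum, Finset.sum_add_distrib, ← Finset.mul_sum, ← Finset.mul_sum]
  simp only [hcomb]
  rw [← Finset.mul_sum, Finset.sum_add_distrib, ← Finset.mul_sum, ← Finset.mul_sum, ← hS, Finset.sum_const,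
    Finset.card_univ, Fintype.card_fin, nsmul_eq_mul]
  push_cast
  have hP0 : 0 ≤ P := hS0.trans hprod
  have hn : (0 : ℝ) ≤ n := Nat.cast_nonneg n
  calc C ^ 2 * L * q * (2 * ((n + 1) * V) + (1 + δ) * S)
      ≤ C ^ 2 * L * q * ((2 * (n + 1) + 1 + δ) * (V + P)) := by
        refine mul_le_mul_of_nonneg_left ?_ (by positivity)
        have a1 : (1 + δ) * S ≤ (1 + δ) * P := by gcongr
        have a2 : 0 ≤ (1 + δ) * V := by positivity
        have a3 : 0 ≤ (2 * (n + 1)) * P := by positivity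
        linarith
    _ = _ := by ring

end Slice

/-! ### Functions with increments dominated by those of a given function -/

/-- On `[0,T]`, the increments of `f` are bounded by a multiple of those of `G`. -/
def DominatedBy {X : Type*} [PseudoMetricSpace X] (T : ℝ) (G : ℝ → ℝ) (f : ℝ → X) : Prop :=
  ∃ M, 0 ≤ M ∧ ∀ s ∈ Icc 0 T, ∀ t ∈ Icc 0 T, dist (f s) (f t) ≤ M * dist (G s) (G t)

section Dominated
variable {X Y : Type*} [NormedAddCommGroup X] [NormedSpace ℝ X] [NormedAddCommGroup Y]
  [NormedSpace ℝ Y] {T : ℝ} {G : ℝ → ℝ} {f g : ℝ → X}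

/-- The mean value inequality with G as comparison function. The derivatives exist at every time, so
integrability of f' plays no role. -/
lemma dominatedBy_of_deriv {f' : ℝ → X} {G' : ℝ → ℝ} {M : ℝ} (hM : 0 ≤ M)
    (hf : ∀ t ∈ Icc 0 T, HasDerivWithinAt f (f' t) (Icc 0 T) t)
    (hG : ∀ t ∈ Icc 0 T, HasDerivWithinAt G (G' t) (Icc 0 T) t)
    (h : ∀ t ∈ Icc 0 T, ‖f' t‖ ≤ M * G' t) : DominatedBy T G f := by
  have key : ∀ s ∈ Icc 0 T, ∀ t ∈ Icc 0 T, s ≤ t → dist (f s) (f t) ≤ M * dist (G s) (G t) := by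
    intro s hs t ht hst
    have hsub : Icc s t ⊆ Icc 0 T := Icc_subset_Icc hs.1 ht.2
    have hIci : ∀ x ∈ Ico s t, Icc 0 T ∈ 𝓝[≥] x := fun x hx =>
      mem_of_superset (Icc_mem_nhdsGE_of_mem (⟨le_rfl, hx.2⟩ : x ∈ Ico x t))
        (Icc_subset_Icc (hs.1.trans hx.1) ht.2)
    have h1 := image_norm_le_of_norm_deriv_right_le_deriv_boundary' (f := fun x => f x - f s)
      (f' := f') (a := s) (b := t) (B := fun x => M * (G x - G s)) (B' := fun x => M * G' x)
      (fun x hx => ((hf x (hsub hx)).continuousWithinAt.mono hsub).sub continuousWithinAt_const)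
      (fun x hx => ((hf x (hsub (Ico_subset_Icc_self hx))).mono_of_mem_nhdsWithin
        (hIci x hx)).sub_const _) (by simp)
      (fun x hx => (((hG x (hsub hx)).continuousWithinAt.mono hsub).sub
        continuousWithinAt_const).const_mul M)
      (fun x hx => (((hG x (hsub (Ico_subset_Icc_self hx))).mono_of_mem_nhdsWithin
        (hIci x hx)).sub_const _).const_mul M)
      (fun x hx => h x (hsub (Ico_subset_Icc_self hx))) ⟨hst, le_rfl⟩
    rw [dist_comm, dist_eq_norm, dist_comm, Real.dist_eq]
    exact h1.trans (mul_le_mul_of_nonneg_left (le_abs_self _) hM)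
  refine ⟨M, hM, fun s hs t ht => ?_⟩
  rcases le_total s t with hst | hst
  · exact key s hs t ht hst
  · rw [dist_comm, dist_comm (G s)]
    exact key t ht s hs hst

omit [NormedSpace ℝ X] in
lemma DominatedBy.add (hf : DominatedBy T G f) (hg : DominatedBy T G g) :
    DominatedBy T G fun t => f t + g t := by
  obtain ⟨M, hM, h⟩ := hf
  obtain ⟨M', hM', h'⟩ := hg
  refine ⟨M + M', add_nonneg hM hM', fun s hs t ht => ?_⟩
  refine (dist_add_add_le _ _ _ _).trans ?_
  rw [add_mul]
  exact add_le_add (h s hs t ht) (h' s hs t ht)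

omit [NormedSpace ℝ X] in
lemma DominatedBy.sum {ι : Type*} (S : Finset ι) {F : ι → ℝ → X}
    (hF : ∀ k ∈ S, DominatedBy T G (F k)) : DominatedBy T G fun t => ∑ k ∈ S, F k t := by
  classical
  induction S using Finset.induction_on with
  | empty => exact ⟨0, le_rfl, by simp⟩
  | insert a S ha ih =>
    simp only [Finset.sum_insert ha]
    exact (hF a (Finset.mem_insert_self a S)).add
      (ih fun k hk => hF k (Finset.mem_insert_of_mem hk))

omit [NormedSpace ℝ X] [NormedSpace ℝ Y] in
lemma DominatedBy.comp {φ : X → Y} {B : Set X} {C : ℝ} (hC : 0 ≤ C)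
    (hφ : ∀ x ∈ B, ∀ y ∈ B, ‖φ y - φ x‖ ≤ C * ‖y - x‖) (hf : DominatedBy T G f)
    (hB : ∀ t ∈ Icc 0 T, f t ∈ B) : DominatedBy T G fun t => φ (f t) := by
  obtain ⟨M, hM, h⟩ := hf
  refine ⟨C * M, mul_nonneg hC hM, fun s hs t ht => ?_⟩
  have h1 := hφ _ (hB t ht) _ (hB s hs)
  rw [← dist_eq_norm, ← dist_eq_norm] at h1
  refine h1.trans ?_
  rw [mul_assoc]
  exact mul_le_mul_of_nonneg_left (h s hs t ht) hC

lemma DominatedBy.clm_apply {A : ℝ → X →L[ℝ] Y} {a b : ℝ} (hA : DominatedBy T G A)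
    (hf : DominatedBy T G f) (ha : ∀ t ∈ Icc 0 T, ‖A t‖ ≤ a) (hb : ∀ t ∈ Icc 0 T, ‖f t‖ ≤ b) :
    DominatedBy T G fun t => A t (f t) := by
  obtain ⟨M, hM, h⟩ := hA
  obtain ⟨M', hM', h'⟩ := hf
  refine ⟨|b| * M + |a| * M', by positivity, fun s hs t ht => ?_⟩
  have e : A s (f s) - A t (f t) = (A s - A t) (f s) + A t (f s - f t) := by
    rw [_root_.sub_apply, map_sub]; abel
  have h1 := h s hs t ht
  have h2 := h' s hs t ht
  rw [dist_eq_norm] at h1 h2 ⊢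
  rw [e]
  calc _ ≤ ‖A s - A t‖ * ‖f s‖ + ‖A t‖ * ‖f s - f t‖ :=
        (norm_add_le _ _).trans (add_le_add ((A s - A t).le_opNorm _) ((A t).le_opNorm _))
    _ ≤ (M * dist (G s) (G t)) * |b| + |a| * (M' * dist (G s) (G t)) := by
        gcongr
        · exact (hb s hs).trans (le_abs_self _)
        · exact (ha t ht).trans (le_abs_self _)
    _ = _ := by ring

end Dominated

/-! ### The relative entropy estimate -/

section Estimate
variable {n : ℕ} {γ C T : ℝ} {Ω : Set (Vec (n + 1))} {𝒯 : Finset (Cell (n + 1))}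
  {B : Set (State (n + 1))}

/-- The second part, from the face bounds with ε = 1, depends badly on the mesh. It serves only to
dominate the increments of the cell values by those of G. -/
lemma IsGodunovStep.entropy_nonneg {W dU : Cell (n + 1) → State (n + 1)}
    {Vp Vm : Fin (n + 1) → Cell (n + 1) → State (n + 1)} (hm : IsRectMesh Ω 𝒯)
    (hB : StateBounds γ B C) (hs : IsGodunovStep γ 𝒯 W dU Vp Vm) (hW : ∀ K ∈ 𝒯, W K ∈ B) :
    0 ≤ ∑ K ∈ 𝒯, cellVolume K * entVar γ (W K) (dU K) ∧
    ∀ K ∈ 𝒯, cellVolume K * ‖dU K‖ ≤ 2 * C * (∑ i, ∑ K ∈ 𝒯, faceArea i K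
      + ∑ K ∈ 𝒯, cellVolume K * entVar γ (W K) (dU K)) := by
  have hC := hB.nonneg
  choose! Dp hDp using fun (i : Fin (n + 1)) K (hK : K ∈ 𝒯) =>
    hB.face i (W K) (hW K hK) _ _ _ (hs.upper i K hK)
  choose! Dm hDm using fun (i : Fin (n + 1)) K (hK : K ∈ 𝒯) =>
    hB.face i (W K) (hW K hK) _ _ _ (hs.lower i K hK)
  have hprod := hs.entropy_production hm hDp hDm
  have hterm : ∀ i, ∀ K ∈ 𝒯, 0 ≤ faceArea i K * (Dp i K + Dm i K) := fun i K hK =>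
    mul_nonneg (faceArea_pos i K).le (add_nonneg (hDp i K hK).nonneg (hDm i K hK).nonneg)
  refine ⟨(Finset.sum_nonneg fun i _ => Finset.sum_nonneg fun K hK => hterm i K hK).trans hprod,
    fun K hK => ?_⟩
  have h1 : ‖cellVolume K • dU K‖ ≤ ∑ i, 2 * C * (faceArea i K
      + faceArea i K * (Dp i K + Dm i K)) := by
    rw [hs.balance K hK]
    refine (norm_sum_le _ _).trans (Finset.sum_le_sum fun i _ => ?_)
    rw [norm_smul, Real.norm_of_nonneg (faceArea_pos i K).le]
    have e : flux γ i (Vm i K) - flux γ i (Vp i K)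
        = (flux γ i (W K) - flux γ i (Vp i K)) - (flux γ i (W K) - flux γ i (Vm i K)) := by abel
    have h2 := (hDp i K hK).norm_le 1 one_pos
    have h3 := (hDm i K hK).norm_le 1 one_pos
    have h4 : ‖flux γ i (Vm i K) - flux γ i (Vp i K)‖ ≤ 2 * C * (1 + (Dp i K + Dm i K)) := by
      rw [e]
      refine (norm_sub_le _ _).trans ((add_le_add h2 h3).trans_eq ?_)
      ring
    refine (mul_le_mul_of_nonneg_left h4 (faceArea_pos i K).le).trans_eq ?_
    ring
  rw [norm_smul, Real.norm_of_nonneg (cellVolume_pos K).le] at h1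
  refine h1.trans ?_
  rw [← Finset.mul_sum]
  refine mul_le_mul_of_nonneg_left ?_ (by positivity)
  rw [Finset.sum_add_distrib]
  refine add_le_add (Finset.sum_le_sum fun i _ => ?_) (le_trans ?_ hprod)
  · exact Finset.single_le_sum (f := fun K => faceArea i K) (fun K _ => (faceArea_pos i K).le) hK
  · exact Finset.sum_le_sum fun i _ => Finset.single_le_sum
      (f := fun K => faceArea i K * (Dp i K + Dm i K)) (fun K hK => hterm i K hK) hK

variable {r R π₀ : ℝ} {L : ℝ≥0} {W : ℝ × Vec (n + 1) → State (n + 1)}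

/-- Fubini: the system holds at almost every (t, x), hence for almost every t at almost every x of
each of the finitely many cells. -/
lemma IsRegularOn.ae_isTimeSlice (h : IsRegularOn γ T Ω r R π₀ L W) (hm : IsRectMesh Ω 𝒯) :
    ∀ᵐ t, t ∈ Ioo 0 T →
      (∀ K ∈ 𝒯, ∀ᵐ x ∂(volume.restrict (openCell K)), DifferentiableAt ℝ W (t, x)) ∧
      IsTimeSlice γ Ω 𝒯 (gasBox (n + 1) γ r R π₀) L (fun x => W (t, x))
        fun x => fderiv ℝ W (t, x) (1, 0) := by
  have h1 : ∀ᵐ t : ℝ, ∀ K ∈ 𝒯, ∀ᵐ x : Vec (n + 1), (t, x) ∈ Ioo 0 T ×ˢ openCell K →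
      DifferentiableAt ℝ W (t, x) ∧ fderiv ℝ W (t, x) (1, 0)
      + ∑ i, fderiv ℝ (flux γ i) (W (t, x))
        (fderiv ℝ W (t, x) (0, EuclideanSpace.single i 1)) = 0 := by
    refine (Filter.eventually_all_finset 𝒯).2 fun K hK => ?_
    have := h.equation K (hm.openCell_subset hK)
    rw [Measure.volume_eq_prod] at this
    exact Measure.ae_ae_of_ae_prod this
  filter_upwards [h1] with t h1 ht
  have ht' : t ∈ Icc 0 T := Ioo_subset_Icc_self ht
  have h2 : ∀ K ∈ 𝒯, ∀ᵐ x ∂(volume.restrict (openCell K)), DifferentiableAt ℝ W (t, x) ∧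
      fderiv ℝ W (t, x) (1, 0) + ∑ i, fderiv ℝ (flux γ i) (W (t, x))
        (fderiv ℝ W (t, x) (0, EuclideanSpace.single i 1)) = 0 := by
    intro K hK
    rw [ae_restrict_iff' (isOpen_openCell K).measurableSet]
    filter_upwards [h1 K hK] with x hx hxK using hx ⟨ht, hxK⟩
  refine ⟨fun K hK => (h2 K hK).mono fun x hx => hx.1,
    fun x hx => h.mem_gasBox (t, x) ⟨ht', hx⟩,
    fun K hK => lipschitzOnWith_timeSlice (h.lipschitz K (hm.openCell_subset hK)) ht',
    fun K hK => ?_, fun x n hn => h.impermeable t ht' x n hn⟩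
  filter_upwards [h2 K hK] with x hx
  have h3 : HasFDerivAt (fun x => W (t, x)) _ x :=
    hx.1.hasFDerivAt.comp x ((hasFDerivAt_const t x).prodMk (hasFDerivAt_id x))
  refine ⟨h3.differentiableAt, ?_⟩
  rw [h3.fderiv]
  exact hx.2

end Estimate

section Estimate
variable {n : ℕ} {γ C T : ℝ} {Ω : Set (Vec (n + 1))} {𝒯 : Finset (Cell (n + 1))}
  {r R π₀ : ℝ} {L : ℝ≥0} {W : ℝ × Vec (n + 1) → State (n + 1)}

/-- The relative entropy on a cell with value `U`, relative to the strong solution `W`. -/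
def cellRelEnt (γ : ℝ) (W : ℝ × Vec d → State d) (K : Cell d) (U : ℝ → State d) (t : ℝ) : ℝ :=
  -(cellVolume K * entropy γ (U t)) + ((∫ x in openCell K, density (W (t, x)))
    + (∫ x in openCell K, entVar γ (W (t, x))) (U t))

lemma IsRegularOn.lipschitz_entVar (h : IsRegularOn γ T Ω r R π₀ L W)
    (hB : StateBounds γ (gasBox (n + 1) γ r R π₀) C) {K : Cell (n + 1)} (hK : openCell K ⊆ Ω) :
    LipschitzOnWith (⟨C, hB.nonneg⟩ * L) (fun z => entVar γ (W z)) (Icc 0 T ×ˢ closedCell K) := by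
  refine LipschitzOnWith.comp (g := entVar γ) (t := gasBox (n + 1) γ r R π₀)
    (LipschitzOnWith.of_dist_le_mul fun U hU V hV => ?_) (h.lipschitz K hK)
    fun z hz => h.mem_gasBox z ⟨hz.1, closure_mono hK (closure_openCell K ▸ hz.2)⟩
  rw [dist_eq_norm, dist_eq_norm]
  exact hB.entVar_sub_le V hV U hU

lemma IsRegularOn.lipschitz_density (h : IsRegularOn γ T Ω r R π₀ L W) {K : Cell (n + 1)}
    (hK : openCell K ⊆ Ω) :
    LipschitzOnWith L (fun z => density (W z)) (Icc 0 T ×ˢ closedCell K) := by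
  have := LipschitzWith.prod_fst.comp_lipschitzOnWith (h.lipschitz K hK)
  rwa [one_mul] at this

/-- In `cellRelEnt` the cell value is taken out of the integral of η'(w), so that the product rule
and the domination of increments apply factor by factor; this lemma restores the integral of H. -/
lemma IsRegularOn.cellRelEnt_eq (h : IsRegularOn γ T Ω r R π₀ L W)
    (hB : StateBounds γ (gasBox (n + 1) γ r R π₀) C) {K : Cell (n + 1)} (hK : openCell K ⊆ Ω)
    (U : ℝ → State (n + 1)) {t : ℝ} (ht : t ∈ Icc 0 T) :
    IntegrableOn (fun x => relEnt γ (U t) (W (t, x))) (openCell K) ∧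
      cellRelEnt γ W K U t = ∫ x in openCell K, relEnt γ (U t) (W (t, x)) := by
  have i1 : IntegrableOn (fun x => density (W (t, x))) (openCell K) :=
    integrableOn_openCell (lipschitzOnWith_timeSlice (h.lipschitz_density hK) ht).continuousOn
  have i2 : IntegrableOn (fun x => entVar γ (W (t, x))) (openCell K) :=
    integrableOn_openCell (lipschitzOnWith_timeSlice (h.lipschitz_entVar hB hK) ht).continuousOn
  have i3 := i2.apply_continuousLinearMap (U t)
  have i4 : IntegrableOn (fun _ : Vec (n + 1) => entropy γ (U t)) (openCell K) :=
    integrableOn_const (by rw [volume_openCell]; exact ENNReal.ofReal_ne_top)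
  have i5 : IntegrableOn (fun x => density (W (t, x)) + entVar γ (W (t, x)) (U t)) (openCell K) :=
    i1.add i3
  refine ⟨i5.sub i4, ?_⟩
  simp only [relEnt]
  rw [integral_sub i5 i4, integral_add i1 i3, setIntegral_const, cellRelEnt,
    ContinuousLinearMap.integral_apply i2, Measure.real, volume_openCell,
    ENNReal.toReal_ofReal (cellVolume_pos K).le, smul_eq_mul]
  ring

/-- The time derivative of the relative entropy on a cell. -/
lemma IsRegularOn.hasDerivAt_cellRelEnt (h : IsRegularOn γ T Ω r R π₀ L W) (hγ : 1 < γ)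
    (hB : StateBounds γ (gasBox (n + 1) γ r R π₀) C) {K : Cell (n + 1)} (hK : openCell K ⊆ Ω)
    {U : ℝ → State (n + 1)} {U' : State (n + 1)} {t : ℝ} (ht : t ∈ Ioo 0 T)
    (hU : HasDerivAt U U' t) (hUB : U t ∈ gasBox (n + 1) γ r R π₀)
    (hd : ∀ᵐ x ∂(volume.restrict (openCell K)), DifferentiableAt ℝ W (t, x)) :
    IntegrableOn (fun x => density (fderiv ℝ W (t, x) (1, 0))
      + fderiv ℝ (entVar γ) (W (t, x)) (fderiv ℝ W (t, x) (1, 0)) (U t)) (openCell K) ∧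
    HasDerivAt (cellRelEnt γ W K U) (-(cellVolume K * entVar γ (U t) U')
      + ((∫ x in openCell K, (density (fderiv ℝ W (t, x) (1, 0))
      + fderiv ℝ (entVar γ) (W (t, x)) (fderiv ℝ W (t, x) (1, 0)) (U t)))
      + (∫ x in openCell K, entVar γ (W (t, x))) U')) t := by
  have hKm : MeasurableSet (openCell K) := (isOpen_openCell K).measurableSet
  have hgas : ∀ x ∈ openCell K, IsGasState γ (W (t, x)) := fun x hx =>
    hB.gas _ (h.mem_gasBox (t, x) ⟨Ioo_subset_Icc_self ht, subset_closure (hK hx)⟩)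
  have d1 : ∀ x, DifferentiableAt ℝ W (t, x) → HasFDerivAt (fun z => density (W z))
      ((ContinuousLinearMap.fst ℝ ℝ (Vec (n + 1) × ℝ)).comp (fderiv ℝ W (t, x))) (t, x) :=
    fun x hx => (ContinuousLinearMap.fst ℝ ℝ (Vec (n + 1) × ℝ)).hasFDerivAt.comp (t, x)
      hx.hasFDerivAt
  have d2 : ∀ x ∈ openCell K, DifferentiableAt ℝ W (t, x) → HasFDerivAt (fun z => entVar γ (W z))
      ((fderiv ℝ (entVar γ) (W (t, x))).comp (fderiv ℝ W (t, x))) (t, x) := fun x hxK hx =>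
    (hasFDerivAt_entVar hγ (hgas x hxK)).comp (t, x) hx.hasFDerivAt
  obtain ⟨i1, h1⟩ := hasDerivAt_cellIntegral (h.lipschitz_density hK) ht
    (hd.mono fun x hx => (d1 x hx).differentiableAt)
  obtain ⟨i2, h2⟩ := hasDerivAt_cellIntegral (h.lipschitz_entVar hB hK) ht (by
    filter_upwards [hd, ae_restrict_mem hKm] with x hx hxK using (d2 x hxK hx).differentiableAt)
  have hae : ∀ᵐ x ∂(volume.restrict (openCell K)), fderiv ℝ (fun z => density (W z)) (t, x) (1, 0)
      + fderiv ℝ (fun z => entVar γ (W z)) (t, x) (1, 0) (U t)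
      = density (fderiv ℝ W (t, x) (1, 0))
        + fderiv ℝ (entVar γ) (W (t, x)) (fderiv ℝ W (t, x) (1, 0)) (U t) := by
    filter_upwards [hd, ae_restrict_mem hKm] with x hx hxK
    rw [(d1 x hx).fderiv, (d2 x hxK hx).fderiv]
    rfl
  have i3 := i2.apply_continuousLinearMap (U t)
  refine ⟨(i1.add i3).congr hae, ?_⟩
  have h3 := ((hasFDerivAt_entropy hγ (hB.gas _ hUB)).comp_hasDerivAt t hU).const_mul (cellVolume K)
  have h4 : HasDerivAt (cellRelEnt γ W K U) _ t := h3.neg.add (h1.add (h2.clm_apply hU))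
  refine h4.congr_deriv ?_
  rw [← integral_congr_ae hae, integral_add i1 i3, ContinuousLinearMap.integral_apply i2]
  ring

lemma IsRegularOn.dominatedBy_cellRelEnt (h : IsRegularOn γ T Ω r R π₀ L W)
    (hB : StateBounds γ (gasBox (n + 1) γ r R π₀) C) {K : Cell (n + 1)} (hK : openCell K ⊆ Ω)
    {U : ℝ → State (n + 1)} (hUB : ∀ t ∈ Icc 0 T, U t ∈ gasBox (n + 1) γ r R π₀) {G : ℝ → ℝ}
    (hid : DominatedBy T G fun t => t) (hU : DominatedBy T G U) :
    DominatedBy T G (cellRelEnt γ W K U) := by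
  have hv := (cellVolume_pos K).le
  have e1 : DominatedBy T G fun t => -(cellVolume K * entropy γ (U t)) := by
    refine hU.comp (φ := fun V => -(cellVolume K * entropy γ V)) (C := cellVolume K * C)
      (mul_nonneg hv hB.nonneg) (fun x hx y hy => ?_) hUB
    have := hB.entropy_sub_le x hx y hy
    rw [show -(cellVolume K * entropy γ y) - -(cellVolume K * entropy γ x)
      = -(cellVolume K * (entropy γ y - entropy γ x)) by ring, norm_neg, norm_mul,
      Real.norm_of_nonneg hv, mul_assoc]
    exact mul_le_mul_of_nonneg_left this hv
  have e2 : DominatedBy T G fun t => ∫ x in openCell K, density (W (t, x)) :=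
    hid.comp (φ := fun t => ∫ x in openCell K, density (W (t, x))) (B := Icc 0 T)
      (C := L * cellVolume K) (by positivity)
      (fun s hs t ht => dist_cellIntegral_le (h.lipschitz_density hK) ht hs) fun t ht => ht
  have e3 : DominatedBy T G fun t => ∫ x in openCell K, entVar γ (W (t, x)) :=
    hid.comp (φ := fun t => ∫ x in openCell K, entVar γ (W (t, x))) (B := Icc 0 T)
      (C := (⟨C, hB.nonneg⟩ * L : ℝ≥0) * cellVolume K) (by positivity)
      (fun s hs t ht => dist_cellIntegral_le (h.lipschitz_entVar hB hK) ht hs) fun t ht => ht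
  refine e1.add (e2.add (e3.clm_apply hU (a := C * volume.real (openCell K)) (b := C)
    (fun t ht => ?_) fun t ht => hB.norm_le _ (hUB t ht)))
  refine norm_setIntegral_le_of_norm_le_const ?_ fun x hx =>
    hB.entVar_le _ (h.mem_gasBox (t, x) ⟨ht, subset_closure (hK hx)⟩)
  rw [volume_openCell]; exact ENNReal.ofReal_lt_top

/-- Gronwall with Y' ≤ (n + 1)C³L Y + κG', κ of order √h. The increment of G is at most |Ω|(T + 2C),
because time is bounded by T and the entropy by C. -/
lemma IsRegularOn.sum_cellRelEnt_le (h : IsRegularOn γ T Ω r R π₀ L W) (hm : IsRectMesh Ω 𝒯)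
    (hΩ : Bornology.IsBounded Ω) (hΩn : Ω.Nonempty) (hγ : 1 < γ) (hT : 0 < T)
    (hB : StateBounds γ (gasBox (n + 1) γ r R π₀) C) {U₀ : Vec (n + 1) → State (n + 1)}
    {U : Cell (n + 1) → ℝ → State (n + 1)} (hU : IsGodunovSolution γ T 𝒯 U₀ U)
    (hUB : ∀ t ∈ Icc 0 T, ∀ K ∈ 𝒯, U K t ∈ gasBox (n + 1) γ r R π₀) {τ : ℝ} (hτ : τ ∈ Icc 0 T) :
    ∑ K ∈ 𝒯, cellRelEnt γ W K (U K) τ ≤ ((∑ K ∈ 𝒯, cellRelEnt γ W K (U K) 0)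
      + C ^ 2 * L * (2 * (n + 1) + 1 + √(Metric.diam Ω)) * √(meshSize 𝒯)
        * ((∑ K ∈ 𝒯, cellVolume K) * (T + 2 * C))) * Real.exp ((n + 1) * (C ^ 3 * L) * T) := by
  have hC := hB.nonneg
  choose! dU Vp Vm hd hs using fun t (ht : t ∈ Icc 0 T) => hU.exists_step hm ht
  set V := ∑ K ∈ 𝒯, cellVolume K with hV
  have hVpos : 0 < V := Finset.sum_pos (fun K _ => cellVolume_pos K) (hm.nonempty hΩn)
  set P : ℝ → ℝ := fun t => ∑ K ∈ 𝒯, cellVolume K * entVar γ (U K t) (dU t K) with hP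
  have hP0 : ∀ t ∈ Icc 0 T, 0 ≤ P t := fun t ht => ((hs t ht).entropy_nonneg hm hB (hUB t ht)).1
  set N : ℝ → ℝ := fun t => ∑ K ∈ 𝒯, cellVolume K * entropy γ (U K t) with hN
  -- G' = V + P is nonnegative and dominates both the constant 1 and, by
  -- `IsGodunovStep.entropy_nonneg`, the derivatives of the cell values.
  set G : ℝ → ℝ := fun t => V * t + N t with hG
  set G' : ℝ → ℝ := fun t => V + P t with hG'
  have hGd : ∀ t ∈ Icc 0 T, HasDerivWithinAt G (G' t) (Icc 0 T) t := by
    intro t ht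
    have h1 : HasDerivWithinAt N (P t) (Icc 0 T) t := HasDerivWithinAt.fun_sum fun K hK =>
      (hasDerivWithinAt_entropy hγ (hB.gas _ (hUB t ht K hK)) (hd t ht K hK)).const_mul _
    have h2 : HasDerivWithinAt (fun t : ℝ => V * t) V (Icc 0 T) t := by
      simpa using (hasDerivWithinAt_id t (Icc 0 T)).const_mul V
    exact h2.add h1
  have hid : DominatedBy T G fun t => t := by
    refine dominatedBy_of_deriv (f' := fun _ => 1) (M := V⁻¹) (by positivity)
      (fun t _ => hasDerivWithinAt_id t _) hGd fun t ht => ?_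
    rw [norm_one, hG', mul_add, inv_mul_cancel₀ hVpos.ne']
    have := mul_nonneg (inv_nonneg.2 hVpos.le) (hP0 t ht)
    linarith
  have hdom : ∀ K ∈ 𝒯, DominatedBy T G (U K) := by
    intro K hK
    set A := ∑ i : Fin (n + 1), ∑ K ∈ 𝒯, faceArea i K
    have hA : 0 ≤ A := Finset.sum_nonneg fun i _ => Finset.sum_nonneg fun K _ => (faceArea_pos i K).le
    have hv := cellVolume_pos K
    refine dominatedBy_of_deriv (f' := fun t => dU t K) (M := 2 * C * (A / V + 1) / cellVolume K)
      (by positivity) (fun t ht => hd t ht K hK) hGd fun t ht => ?_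
    have h1 := ((hs t ht).entropy_nonneg hm hB (hUB t ht)).2 K hK
    have h2 := hP0 t ht
    rw [div_mul_eq_mul_div, le_div_iff₀ hv, mul_comm]
    refine h1.trans ?_
    rw [mul_assoc (2 * C)]
    refine mul_le_mul_of_nonneg_left ?_ (by positivity)
    have h3 : (A / V + 1) * G' t = A + P t + (A / V * P t + V) := by
      simp only [hG']
      field_simp
      ring
    rw [h3]
    have : 0 ≤ A / V * P t + V := by positivity
    exact le_add_of_nonneg_right this
  obtain ⟨M, hM, hYdom⟩ := DominatedBy.sum 𝒯 fun K hK => h.dominatedBy_cellRelEnt hB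
    (hm.openCell_subset hK) (fun t ht => hUB t ht K hK) hid (hdom K hK)
  set κ := C ^ 2 * L * (2 * (n + 1) + 1 + √(Metric.diam Ω)) * √(meshSize 𝒯) with hκ
  have hκ0 : 0 ≤ κ := by positivity
  have hmain := le_exp_of_ae_deriv_le (Y := fun t => ∑ K ∈ 𝒯, cellRelEnt γ W K (U K) t) (G := G)
    (G' := G') (T := T) (M := M) (C := (n + 1) * (C ^ 3 * L)) (κ := κ) (by positivity) hκ0
    (fun t ht => (hGd t ht).continuousWithinAt)
    (fun t ht => (hGd t (Ioo_subset_Icc_self ht)).hasDerivAt (Icc_mem_nhds ht.1 ht.2))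
    (fun t ht => add_nonneg hVpos.le (hP0 t (Ioo_subset_Icc_self ht))) hYdom ?_ hτ
  · refine hmain.trans ?_
    have hN' : ∀ t ∈ Icc 0 T, |N t| ≤ V * C := by
      intro t ht
      rw [hN, hV, Finset.sum_mul]
      refine (Finset.abs_sum_le_sum_abs _ _).trans (Finset.sum_le_sum fun K hK => ?_)
      rw [abs_mul, abs_of_pos (cellVolume_pos K)]
      exact mul_le_mul_of_nonneg_left (hB.entropy_le _ (hUB t ht K hK)) (cellVolume_pos K).le
    have h0 : (0 : ℝ) ∈ Icc 0 T := ⟨le_rfl, hT.le⟩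
    have hG0 : G τ - G 0 ≤ V * (T + 2 * C) := by
      have h1 := (abs_le.1 (hN' τ hτ)).2
      have h2 := (abs_le.1 (hN' 0 h0)).1
      have h3 : V * τ ≤ V * T := mul_le_mul_of_nonneg_left hτ.2 hVpos.le
      simp only [hG]
      linarith
    have hY0 : 0 ≤ ∑ K ∈ 𝒯, cellRelEnt γ W K (U K) 0 := by
      refine Finset.sum_nonneg fun K hK => ?_
      rw [(h.cellRelEnt_eq hB (hm.openCell_subset hK) (U K) h0).2]
      exact setIntegral_nonneg (isOpen_openCell K).measurableSet fun x hx =>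
        relEnt_nonneg hγ (Or.inl (hB.gas _ (hUB 0 h0 K hK)))
          (hB.gas _ (h.mem_gasBox (0, x) ⟨h0, subset_closure (hm.openCell_subset hK hx)⟩))
    have hexp : Real.exp ((n + 1) * (C ^ 3 * L) * τ) ≤ Real.exp ((n + 1) * (C ^ 3 * L) * T) :=
      Real.exp_le_exp.2 (mul_le_mul_of_nonneg_left hτ.2 (by positivity))
    gcongr
  · filter_upwards [h.ae_isTimeSlice hm] with t hts ht
    obtain ⟨hdiff, hslice⟩ := hts ht
    have ht' := Ioo_subset_Icc_self ht
    have hK := fun K (hK : K ∈ 𝒯) => h.hasDerivAt_cellRelEnt hγ hB (hm.openCell_subset hK) ht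
      ((hd t ht' K hK).hasDerivAt (Icc_mem_nhds ht.1 ht.2)) (hUB t ht' K hK) (hdiff K hK)
    refine ⟨_, HasDerivAt.fun_sum fun K hK' => (hK K hK').2, ?_⟩
    have hest := hslice.estimate hm hΩ hγ hB (hs t ht') (hUB t ht') fun K hK' => (hK K hK').1
    have e1 : ∑ K ∈ 𝒯, ∫ x in openCell K, relEnt γ (U K t) (W (t, x))
        = ∑ K ∈ 𝒯, cellRelEnt γ W K (U K) t := Finset.sum_congr rfl fun K hK' =>
      ((h.cellRelEnt_eq hB (hm.openCell_subset hK') (U K) ht').2).symm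
    rw [e1] at hest
    rw [Finset.sum_add_distrib, Finset.sum_neg_distrib]
    -- The derivative of the entropy of the cells enters Y' as -P ≤ 0 and is discarded.
    have := hP0 t ht'
    simp only [hP] at this
    simp only [hG', hP]
    linarith

end Estimate

/-! ### From relative entropy to L² errors. -/

lemma piecewiseConst_of_mem {X : Type*} [AddCommMonoid X] {Ω : Set (Vec d)} {𝒯 : Finset (Cell d)}
    (hm : IsRectMesh Ω 𝒯) (v : Cell d → X) {K : Cell d} (hK : K ∈ 𝒯) {x : Vec d}
    (hx : x ∈ openCell K) : piecewiseConst 𝒯 v x = v K := by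
  rw [piecewiseConst, Finset.sum_eq_single_of_mem K hK, indicator_of_mem hx]
  exact fun L hL hLK =>
    indicator_of_notMem (fun hxL => (hm.disjoint L hL K hK hLK).le_bot ⟨hxL, hx⟩) _

/-- A cellwise `L²` bound for the distance to a piecewise constant function. -/
lemma IsRectMesh.eLpNorm_two_le {X : Type*} [NormedAddCommGroup X] {Ω : Set (Vec d)}
    {𝒯 : Finset (Cell d)} (hm : IsRectMesh Ω 𝒯) {v : Cell d → X} {g : Vec d → X}
    {H : Cell d → Vec d → ℝ} (hint : ∀ K ∈ 𝒯, IntegrableOn (H K) (openCell K))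
    (hle : ∀ K ∈ 𝒯, ∀ x ∈ openCell K, ‖v K - g x‖ ^ 2 ≤ H K x) :
    eLpNorm (fun x => piecewiseConst 𝒯 v x - g x) 2 (volume.restrict Ω)
      ≤ ENNReal.ofReal √(∑ K ∈ 𝒯, ∫ x in openCell K, H K x) := by
  have hKm : ∀ K : Cell d, MeasurableSet (openCell K) := fun K => (isOpen_openCell K).measurableSet
  have hH0 : ∀ K ∈ 𝒯, ∀ x ∈ openCell K, 0 ≤ H K x := fun K hK x hx =>
    (sq_nonneg _).trans (hle K hK x hx)
  have hI0 : ∀ K ∈ 𝒯, 0 ≤ ∫ x in openCell K, H K x := fun K hK =>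
    setIntegral_nonneg (hKm K) (hH0 K hK)
  rw [eLpNorm_eq_lintegral_rpow_enorm_toReal two_ne_zero ENNReal.ofNat_ne_top, ENNReal.toReal_ofNat,
    Real.sqrt_eq_rpow, ← ENNReal.ofReal_rpow_of_nonneg (Finset.sum_nonneg hI0) (by norm_num)]
  refine ENNReal.rpow_le_rpow ?_ (by norm_num)
  rw [Measure.restrict_congr_set hm.ae_eq,
    lintegral_biUnion_finset hm.pairwiseDisjoint fun K _ => hKm K, ENNReal.ofReal_sum_of_nonneg hI0]
  refine Finset.sum_le_sum fun K hK => ?_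
  rw [ofReal_integral_eq_lintegral_ofReal (hint K hK)
    ((ae_restrict_iff' (hKm K)).2 (Eventually.of_forall (hH0 K hK)))]
  refine setLIntegral_mono' (hKm K) fun x hx => ?_
  rw [piecewiseConst_of_mem hm v hK hx, ENNReal.rpow_two, ← ofReal_norm,
    ← ENNReal.ofReal_pow (norm_nonneg _)]
  exact ENNReal.ofReal_le_ofReal (hle K hK x hx)

section Convergence
variable {n : ℕ} {γ C T : ℝ} {Ω : Set (Vec (n + 1))} {𝒯 : Finset (Cell (n + 1))}
  {r R π₀ : ℝ} {L : ℝ≥0} {W : ℝ × Vec (n + 1) → State (n + 1)}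
  {U₀ : Vec (n + 1) → State (n + 1)} {U : Cell (n + 1) → ℝ → State (n + 1)}

/-- On the cell W(0, ·) stays in the closed ball of radius Lh about W(0, x); the ball is convex, so
it contains the average. -/
lemma IsRegularOn.norm_initial_sub_le (h : IsRegularOn γ T Ω r R π₀ L W) (hT : 0 ≤ T)
    (hm : IsRectMesh Ω 𝒯) (hU₀ : ∀ x ∈ Ω, U₀ x = W (0, x)) (hU : IsGodunovSolution γ T 𝒯 U₀ U)
    {K : Cell (n + 1)} (hK : K ∈ 𝒯) {x : Vec (n + 1)} (hx : x ∈ openCell K) :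
    ‖U K 0 - W (0, x)‖ ≤ L * meshSize 𝒯 := by
  have hsub := hm.openCell_subset hK
  have hlip := lipschitzOnWith_timeSlice (h.lipschitz K hsub) (⟨le_rfl, hT⟩ : (0 : ℝ) ∈ Icc 0 T)
  rw [hU.initial K hK, setAverage_closedCell K fun y hy => hU₀ y (hsub hy), ← mem_closedBall_iff_norm]
  refine (convex_closedBall (W (0, x)) (L * meshSize 𝒯)).set_average_mem
    Metric.isClosed_closedBall ?_ ?_ ?_ (integrableOn_openCell hlip.continuousOn)
  · rw [volume_openCell]; exact (ENNReal.ofReal_pos.2 (cellVolume_pos K)).ne'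
  · rw [volume_openCell]; exact ENNReal.ofReal_ne_top
  · refine (ae_restrict_iff' (isOpen_openCell K).measurableSet).2 (Eventually.of_forall fun y hy => ?_)
    have hy' := openCell_subset_closedCell K hy
    have hx' := openCell_subset_closedCell K hx
    refine (hlip.dist_le_mul y hy' x hx').trans (mul_le_mul_of_nonneg_left ?_ L.2)
    exact (Metric.dist_le_diam_of_mem (isCompact_closedCell K).isBounded hy' hx').trans
      (diam_closedCell_le_meshSize hK)

lemma IsRegularOn.cellRelEnt_zero_le (h : IsRegularOn γ T Ω r R π₀ L W) (hT : 0 ≤ T)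
    (hm : IsRectMesh Ω 𝒯) (hB : StateBounds γ (gasBox (n + 1) γ r R π₀) C)
    (hU₀ : ∀ x ∈ Ω, U₀ x = W (0, x)) (hU : IsGodunovSolution γ T 𝒯 U₀ U)
    {K : Cell (n + 1)} (hK : K ∈ 𝒯) (hUB : U K 0 ∈ gasBox (n + 1) γ r R π₀) :
    cellRelEnt γ W K (U K) 0 ≤ C * (L * meshSize 𝒯) ^ 2 * cellVolume K := by
  have h0 : (0 : ℝ) ∈ Icc 0 T := ⟨le_rfl, hT⟩
  have hsub := hm.openCell_subset hK
  obtain ⟨hi, he⟩ := h.cellRelEnt_eq hB hsub (U K) h0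
  have hfin : volume (openCell K) ≠ ⊤ := by rw [volume_openCell]; exact ENNReal.ofReal_ne_top
  rw [he]
  calc ∫ x in openCell K, relEnt γ (U K 0) (W (0, x))
      ≤ ∫ _ in openCell K, C * (L * meshSize 𝒯) ^ 2 := by
        refine setIntegral_mono_on hi (integrableOn_const hfin)
          (isOpen_openCell K).measurableSet fun x hx => ?_
        refine (hB.relEnt_le _ (h.mem_gasBox (0, x) ⟨h0, subset_closure (hsub hx)⟩) _ hUB).trans ?_
        exact mul_le_mul_of_nonneg_left (pow_le_pow_left₀ (norm_nonneg _)
          (h.norm_initial_sub_le hT hm hU₀ hU hK hx) 2) hB.nonneg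
    _ = C * (L * meshSize 𝒯) ^ 2 * cellVolume K := by
        rw [setIntegral_const, Measure.real, volume_openCell,
          ENNReal.toReal_ofReal (cellVolume_pos K).le, smul_eq_mul, mul_comm]

lemma meshSize_nonneg (𝒯 : Finset (Cell d)) : 0 ≤ meshSize 𝒯 := NNReal.coe_nonneg _

/-- The relative entropy of the Godunov solution is of order `√h`, uniformly in the mesh. -/
theorem IsRegularOn.exists_sum_cellRelEnt_le (h : IsRegularOn γ T Ω r R π₀ L W)
    (hΩ : Bornology.IsBounded Ω) (hΩn : Ω.Nonempty) (hγ : 1 < γ) (hT : 0 < T)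
    (hB : StateBounds γ (gasBox (n + 1) γ r R π₀) C) (hU₀ : ∀ x ∈ Ω, U₀ x = W (0, x)) :
    ∃ A, 0 ≤ A ∧ ∀ 𝒯 : Finset (Cell (n + 1)), IsRectMesh Ω 𝒯 → ∀ U, IsGodunovSolution γ T 𝒯 U₀ U →
      (∀ t ∈ Icc 0 T, ∀ K ∈ 𝒯, U K t ∈ gasBox (n + 1) γ r R π₀) → ∀ τ ∈ Icc 0 T,
      ∑ K ∈ 𝒯, cellRelEnt γ W K (U K) τ ≤ A * √(meshSize 𝒯) := by
  have hC := hB.nonneg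
  set δ := Metric.diam Ω
  have hδ : 0 ≤ δ := Metric.diam_nonneg
  set V := (volume Ω).toReal
  -- The initial relative entropy is of order h² = (√h)³√h, and √h ≤ √δ turns this into a multiple
  -- of √h. The second summand is the Gronwall term.
  refine ⟨(C * L ^ 2 * √δ ^ 3 * V + C ^ 2 * L * (2 * (n + 1) + 1 + √δ) * (V * (T + 2 * C)))
    * Real.exp ((n + 1) * (C ^ 3 * L) * T), by positivity, fun 𝒯 hm U hU hUB τ hτ => ?_⟩
  have hVe : ∑ K ∈ 𝒯, cellVolume K = V := by
    rw [← ENNReal.toReal_ofReal (Finset.sum_nonneg fun K _ => (cellVolume_pos K).le),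
      hm.sum_cellVolume]
  have hq : √(meshSize 𝒯) ≤ √δ := Real.sqrt_le_sqrt (hm.meshSize_le hΩ)
  set q := √(meshSize 𝒯) with hqdef
  have hq0 : 0 ≤ q := Real.sqrt_nonneg _
  have hh : meshSize 𝒯 = q ^ 2 := (Real.sq_sqrt (meshSize_nonneg 𝒯)).symm
  have h0 : ∑ K ∈ 𝒯, cellRelEnt γ W K (U K) 0 ≤ C * L ^ 2 * √δ ^ 3 * V * q :=
    calc ∑ K ∈ 𝒯, cellRelEnt γ W K (U K) 0
        ≤ ∑ K ∈ 𝒯, C * (L * meshSize 𝒯) ^ 2 * cellVolume K := Finset.sum_le_sum fun K hK =>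
          h.cellRelEnt_zero_le hT.le hm hB hU₀ hU hK (hUB 0 ⟨le_rfl, hT.le⟩ K hK)
      _ = C * L ^ 2 * q ^ 3 * V * q := by rw [← Finset.mul_sum, hVe, hh]; ring
      _ ≤ _ := by gcongr
  refine (h.sum_cellRelEnt_le hm hΩ hΩn hγ hT hB hU hUB hτ).trans ?_
  rw [hVe, mul_right_comm _ (Real.exp _)]
  refine mul_le_mul_of_nonneg_right ?_ (Real.exp_pos _).le
  refine (add_le_add_left h0 _).trans (le_of_eq ?_)
  ring

/-- c is a Lipschitz constant of the quantity v as a function of the state. The L² norm is at most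
the root of c²C times the relative entropy, and the root of √h is h^{1/4}. -/
lemma IsRegularOn.eLpNorm_sub_le {X : Type*} [NormedAddCommGroup X]
    (h : IsRegularOn γ T Ω r R π₀ L W) (hm : IsRectMesh Ω 𝒯)
    (hB : StateBounds γ (gasBox (n + 1) γ r R π₀) C) {t : ℝ} (ht : t ∈ Icc 0 T)
    (hUB : ∀ K ∈ 𝒯, U K t ∈ gasBox (n + 1) γ r R π₀) {c : ℝ} {v : Cell (n + 1) → X}
    {g : Vec (n + 1) → X}
    (hv : ∀ K ∈ 𝒯, ∀ x ∈ openCell K, ‖v K - g x‖ ≤ c * ‖U K t - W (t, x)‖)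
    {A : ℝ} (hA : ∑ K ∈ 𝒯, cellRelEnt γ W K (U K) t ≤ A * √(meshSize 𝒯)) :
    eLpNorm (fun x => piecewiseConst 𝒯 v x - g x) 2 (volume.restrict Ω)
      ≤ ENNReal.ofReal (√(c ^ 2 * C * A) * meshSize 𝒯 ^ (1 / 4 : ℝ)) := by
  have hcC : 0 ≤ c ^ 2 * C := mul_nonneg (sq_nonneg c) hB.nonneg
  have hce := fun K (hK : K ∈ 𝒯) => h.cellRelEnt_eq hB (hm.openCell_subset hK) (U K) ht
  refine (hm.eLpNorm_two_le (H := fun K x => c ^ 2 * C * relEnt γ (U K t) (W (t, x)))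
    (fun K hK => (hce K hK).1.const_mul _) fun K hK x hx => ?_).trans (ENNReal.ofReal_le_ofReal ?_)
  · have hWx := h.mem_gasBox (t, x) ⟨ht, subset_closure (hm.openCell_subset hK hx)⟩
    calc ‖v K - g x‖ ^ 2 ≤ (c * ‖U K t - W (t, x)‖) ^ 2 :=
          pow_le_pow_left₀ (norm_nonneg _) (hv K hK x hx) 2
      _ = c ^ 2 * ‖U K t - W (t, x)‖ ^ 2 := mul_pow ..
      _ ≤ c ^ 2 * (C * relEnt γ (U K t) (W (t, x))) :=
          mul_le_mul_of_nonneg_left (hB.le_relEnt _ hWx _ (hUB K hK)) (sq_nonneg c)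
      _ = _ := (mul_assoc ..).symm
  · have hh : meshSize 𝒯 ^ (1 / 4 : ℝ) = √√(meshSize 𝒯) := by
      rw [Real.sqrt_eq_rpow, Real.sqrt_eq_rpow, ← Real.rpow_mul (meshSize_nonneg 𝒯)]
      norm_num
    rw [hh, ← Real.sqrt_mul' _ (Real.sqrt_nonneg _)]
    refine Real.sqrt_le_sqrt ?_
    calc ∑ K ∈ 𝒯, ∫ x in openCell K, c ^ 2 * C * relEnt γ (U K t) (W (t, x))
        = c ^ 2 * C * ∑ K ∈ 𝒯, cellRelEnt γ W K (U K) t := by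
          rw [Finset.mul_sum]
          refine Finset.sum_congr rfl fun K hK => ?_
          rw [(hce K hK).2, integral_const_mul]
      _ ≤ c ^ 2 * C * (A * √(meshSize 𝒯)) := mul_le_mul_of_nonneg_left hA hcC
      _ = _ := by ring

end Convergence

end

end EulerGodunov

/-! ### The convergence rate. -/

open EulerGodunov

theorem mainTheorem3 (d : ℕ) (hd : d = 1 ∨ d = 2 ∨ d = 3) (γ : ℝ) (hγ : 1 < γ ∧ γ ≤ 2)
    (T : ℝ) (hT : 0 < T)
    (Ω : Set (Vec d)) (hΩ_open : IsOpen Ω) (hΩ_conn : IsConnected Ω)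
    (hΩ_bdd : Bornology.IsBounded Ω)
    (ϱ : ℝ × Vec d → ℝ) (u : ℝ × Vec d → Vec d) (η : ℝ × Vec d → ℝ)
    (hsol : IsStrongSolution γ T Ω ϱ u η)
    (U₀ : Vec d → State d)
    (hU₀ : ∀ x ∈ Ω, U₀ x = stateOf γ (ϱ (0, x)) (u (0, x)) (η (0, x)))
    (ϱlow Ebar C₀ : ℝ) (hϱlow : 0 < ϱlow) (hEbar : 0 < Ebar) :
    ∃ C : ℝ, 0 < C ∧
      ∀ 𝒯 : Finset (Cell d), IsRectMesh Ω 𝒯 →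
      ∀ U : Cell d → ℝ → State d, IsGodunovSolution γ T 𝒯 U₀ U →
      (∀ t ∈ Set.Icc 0 T, ∀ K ∈ 𝒯,
        ϱlow ≤ density (U K t) ∧ 0 < energy (U K t) ∧ energy (U K t) ≤ Ebar) →
      eLpNorm (fun x => piecewiseConst 𝒯 (fun K => U K 0) x - U₀ x) 2 (volume.restrict Ω)
        ≤ ENNReal.ofReal (C₀ * meshSize 𝒯 ^ (1 / 2 : ℝ)) →
      ∀ τ ∈ Set.Ioo 0 T,
        eLpNorm (fun x => piecewiseConst 𝒯 (fun K => density (U K τ)) x - ϱ (τ, x)) 2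
            (volume.restrict Ω) ≤ ENNReal.ofReal (C * meshSize 𝒯 ^ (1 / 4 : ℝ)) ∧
        eLpNorm (fun x => piecewiseConst 𝒯 (fun K => momentum (U K τ)) x
              - ϱ (τ, x) • u (τ, x)) 2
            (volume.restrict Ω) ≤ ENNReal.ofReal (C * meshSize 𝒯 ^ (1 / 4 : ℝ)) ∧
        eLpNorm (fun x => piecewiseConst 𝒯 (fun K => entropy γ (U K τ)) x - η (τ, x)) 2
            (volume.restrict Ω) ≤ ENNReal.ofReal (C * meshSize 𝒯 ^ (1 / 4 : ℝ)) := by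
  obtain ⟨n, rfl⟩ : ∃ n, d = n + 1 := ⟨d - 1, by omega⟩
  obtain ⟨r₀, R₀, p₀, L, hr₀, hp₀, hW₀⟩ :=
    hsol.exists_isRegularOn hγ.1 hT hΩ_open hΩ_conn.nonempty hΩ_bdd
  obtain ⟨r, R, π₀, hr, hπ, hW, hbox⟩ :=
    hW₀.exists_common_gasBox hγ.1 hT 0 hr₀ hp₀ hU₀ hϱlow Ebar
  obtain ⟨C, hB⟩ := exists_stateBounds (d := n + 1) (R := R) hγ.1 hγ.2 hr hπ
  obtain ⟨A, hA, hsum⟩ :=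
    hW.exists_sum_cellRelEnt_le hΩ_bdd hΩ_conn.nonempty hγ.1 hT hB hU₀
  -- Density and momentum are components of the state, with Lipschitz constant 1; the entropy has
  -- constant C on the common compact set. The summand 1 makes the constant positive.
  refine ⟨√(1 ^ 2 * C * A) + √(C ^ 2 * C * A) + 1, by positivity,
    fun 𝒯 hm U hU hbd _ τ hτ => ?_⟩
  have hUB := hbox 𝒯 hm U hU hbd
  have hτ' := Ioo_subset_Icc_self hτ
  have hmono : ∀ a : ℝ, a ≤ √(1 ^ 2 * C * A) + √(C ^ 2 * C * A) + 1 →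
      ENNReal.ofReal (a * meshSize 𝒯 ^ (1 / 4 : ℝ)) ≤ ENNReal.ofReal
        ((√(1 ^ 2 * C * A) + √(C ^ 2 * C * A) + 1) * meshSize 𝒯 ^ (1 / 4 : ℝ)) := fun a ha =>
    ENNReal.ofReal_le_ofReal
      (mul_le_mul_of_nonneg_right ha (Real.rpow_nonneg (meshSize_nonneg 𝒯) _))
  have h1 := Real.sqrt_nonneg (1 ^ 2 * C * A)
  have h2 := Real.sqrt_nonneg (C ^ 2 * C * A)
  have hmem : ∀ K ∈ 𝒯, ∀ x ∈ openCell K, (τ, x) ∈ Icc 0 T ×ˢ closure Ω := fun K hK x hx =>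
    ⟨hτ', subset_closure (hm.openCell_subset hK hx)⟩
  refine ⟨(hW.eLpNorm_sub_le hm hB hτ' (hUB τ hτ') (c := 1) (fun K hK x hx => ?_)
      (hsum 𝒯 hm U hU hUB τ hτ')).trans (hmono _ (by linarith)),
    (hW.eLpNorm_sub_le hm hB hτ' (hUB τ hτ') (c := 1) (fun K hK x hx => ?_)
      (hsum 𝒯 hm U hU hUB τ hτ')).trans (hmono _ (by linarith)),
    (hW.eLpNorm_sub_le hm hB hτ' (hUB τ hτ') (c := C) (fun K hK x hx => ?_)
      (hsum 𝒯 hm U hU hUB τ hτ')).trans (hmono _ (by linarith))⟩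
  · rw [one_mul]
    exact abs_density_le (U K τ - stateOf γ (ϱ (τ, x)) (u (τ, x)) (η (τ, x)))
  · rw [one_mul]
    exact norm_momentum_le (U K τ - stateOf γ (ϱ (τ, x)) (u (τ, x)) (η (τ, x)))
  · have := hB.entropy_sub_le _ (hW.mem_gasBox _ (hmem K hK x hx)) _ (hUB τ hτ' K hK)
    rwa [entropy_stateOf hγ.1 (hsol.density_pos _ (hmem K hK x hx))] at this
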